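/- **Setting.** Let $S^2=\{(r,z)\in\mathbf R\times\mathbf C : |r|^2+|z|^2=1/4\}$ be the round sphere of radius $1/2$, $\mu$ its area measure normalized to be a probability measure, $PS^2$ the projectivized tangent bundle of $S^2$ (the space of tangent lines), $\pi:PS^2\to S^2$ the projection, and $m=\int m_p\,d\mu(p)$ the normalized Liouville measure on $PS^2$, where $m_p$ is the normalized angular measure on the fibre over $p$. For a diffeomorphism $h$ of $S^2$ let $h_\sharp:PS^2\to PS^2$ be the map induced by the tangent map of $h$. For $\varepsilon>0$ let $f_\varepsilon(r,z)=(r,e^{2\pi i(r+1/2)\varepsilon}z)$ be the twist map. For $\delta>0$ let $U_\delta$ be the ball of radius $\delta$ around the identity of $SO(3)$ for the bi-invariant geodesic metric (distance to the identity $=$ rotation angle), and let $\nu_\delta$ be Haar measure restricted to $U_\delta$ and normalized to be a probability measure. For $g\in SO(3)$ and a probability measure $\kappa$ on $PS^2$ let $P_g\kappa$ be the law of $(u g f_\varepsilon)_\sharp x$, where $u\sim\nu_\delta$ and $x\sim\kappa$ are independent; $\kappa$ is stationary for the $\delta$-diffused process about $gf_\varepsilon$ if $P_g\kappa=\kappa$.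 Let $m_{g,\varepsilon,\delta}$ be the weak limit of the Cesàro averages $\frac1n\sum_{k=1}^n P_g^k m$ as $n\to\infty$, and let $m_{\varepsilon,\delta}=\int_{SO(3)}m_{g,\varepsilon,\delta}\,dg$, where $dg$ is normalized Haar measure. **Theorem.** There is a constant $C>0$ such that for all $\varepsilon,\delta>0$ the following holds. For every $g\in SO(3)$ the measure $m_{g,\varepsilon,\delta}$ exists and is a stationary probability measure of the $\delta$-diffused process about $gf_\varepsilon$ that is absolutely continuous with respect to $m$ and satisfies $\pi_*m_{g,\varepsilon,\delta}=\mu$; the average $m_{\varepsilon,\delta}$ is a probability measure that is absolutely continuous with respect to $m$; and its density $\varphi_{\varepsilon,\delta}=dm_{\varepsilon,\delta}/dm$ satisfies $$\|\varphi_{\varepsilon,\delta}-1\|_{L^1(m)}<C\,\delta^{-11}\,\varepsilon^{-1/2}.$$ In particular, for every fixed $\delta>0$, $m_{\varepsilon,\delta}\to m$ weakly as $\varepsilon\to\infty$. -/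

import Mathlib

open MeasureTheory Filter Topology
open scoped ENNReal BoundedContinuousFunction Matrix

noncomputable section

namespace TwistSphere

/-- Euclidean three-space. The coordinates `(x 0, x 1, x 2)` stand for the point
`(r, z) = (x 0, x 1 + i x 2)` of `ℝ × ℂ`. -/
abbrev E3 : Type := EuclideanSpace ℝ (Fin 3)

/-- The round sphere of radius `1/2`. -/
abbrev S2 : Type := Metric.sphere (0 : E3) (1 / 2)

/-! ### The rotation group -/

/-- The rotation group `SO(3)`, with the topology of the space of matrices. -/
abbrev SO3 : Type := Matrix.specialOrthogonalGroup (Fin 3) ℝ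

instance : MeasurableSpace SO3 := borel SO3

instance : BorelSpace SO3 := ⟨rfl⟩

theorem isCompact_SO3 : IsCompact (Matrix.specialOrthogonalGroup (Fin 3) ℝ : Set
    (Matrix (Fin 3) (Fin 3) ℝ)) := by
  have hsub : (Matrix.specialOrthogonalGroup (Fin 3) ℝ : Set (Matrix (Fin 3) (Fin 3) ℝ)) ⊆
      Set.pi Set.univ (fun _ => Set.pi Set.univ (fun _ => Set.Icc (-1 : ℝ) 1)) := by
    intro A hA i _ j _
    have h1 : A * star A = 1 :=
      (Matrix.mem_orthogonalGroup_iff (Fin 3) ℝ).1 (Matrix.mem_specialOrthogonalGroup_iff.1 hA).1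
    have h2 : ∑ k, A i k * A i k = 1 := by
      have := congrFun (congrFun h1 i) i
      simpa [Matrix.mul_apply, Matrix.star_apply] using this
    have h3 : A i j * A i j ≤ 1 := by
      rw [← h2]
      exact Finset.single_le_sum (f := fun k => A i k * A i k)
        (fun k _ => mul_self_nonneg _) (Finset.mem_univ j)
    exact ⟨by nlinarith, by nlinarith⟩
  have hcl : IsClosed (Matrix.specialOrthogonalGroup (Fin 3) ℝ : Set
      (Matrix (Fin 3) (Fin 3) ℝ)) := by
    have : (Matrix.specialOrthogonalGroup (Fin 3) ℝ : Set (Matrix (Fin 3) (Fin 3) ℝ)) =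
        {A | A * star A = 1} ∩ {A | A.det = 1} := by
      ext A
      simp only [SetLike.mem_coe, Matrix.mem_specialOrthogonalGroup_iff,
        Matrix.mem_orthogonalGroup_iff]
      rfl
    rw [this]
    exact (isClosed_eq (by fun_prop) continuous_const).inter
      (isClosed_eq (Continuous.matrix_det continuous_id) continuous_const)
  exact IsCompact.of_isClosed_subset
    (isCompact_univ_pi fun _ => isCompact_univ_pi fun _ => isCompact_Icc) hcl hsub

instance : CompactSpace SO3 := isCompact_iff_compactSpace.1 isCompact_SO3

instance : IsTopologicalGroup SO3 where
  continuous_inv := by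
    refine Continuous.subtype_mk ?_ _
    exact continuous_star.comp continuous_subtype_val

/-- Haar measure on `SO(3)`, normalized to be a probability measure. -/
def haarSO3 : Measure SO3 := Measure.haarMeasure ⊤

/-- The distance of a rotation to the identity for the bi-invariant geodesic metric of `SO(3)`,
i.e. its rotation angle in `[0, π]`, determined by `tr g = 1 + 2 cos (angle g)`. -/
def rotationAngle (g : SO3) : ℝ :=
  Real.arccos (((g : Matrix (Fin 3) (Fin 3) ℝ).trace - 1) / 2)

/-- The ball `U_δ` of radius `δ` around the identity of `SO(3)`. -/
def rotationBall (δ : ℝ) : Set SO3 := {g | rotationAngle g < δ}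

/-- The restriction of Haar measure to `U_δ`, normalized to be a probability measure. -/
def noise (δ : ℝ) : Measure SO3 := ProbabilityTheory.cond haarSO3 (rotationBall δ)

/-- The rotation of `ℝ³` given by an element of `SO(3)`. -/
def rotate (g : SO3) (x : E3) : E3 :=
  WithLp.toLp 2 ((g : Matrix (Fin 3) (Fin 3) ℝ) *ᵥ x.ofLp)

theorem inner_rotate (g : SO3) (x y : E3) : inner ℝ (rotate g x) (rotate g y) = inner ℝ x y := by
  have h : (g : Matrix (Fin 3) (Fin 3) ℝ)ᵀ * (g : Matrix (Fin 3) (Fin 3) ℝ) = 1 := by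
    have := (Matrix.mem_orthogonalGroup_iff' (Fin 3) ℝ).1
      (Matrix.mem_specialOrthogonalGroup_iff.1 g.2).1
    simpa [Matrix.star_eq_conjTranspose] using this
  simp only [rotate, EuclideanSpace.inner_eq_star_dotProduct, star_trivial]
  rw [Matrix.dotProduct_mulVec, Matrix.vecMul_mulVec, h, Matrix.vecMul_one]

theorem norm_rotate (g : SO3) (x : E3) : ‖rotate g x‖ = ‖x‖ := by
  rw [norm_eq_sqrt_real_inner, inner_rotate, ← norm_eq_sqrt_real_inner]

/-! ### The unit tangent bundle and the projective bundle -/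

/-- The unit tangent bundle `T₁S²`: pairs of a base point `p` and a unit vector `v ⟂ p`. -/
abbrev T1S2 : Type :=
  {x : E3 × E3 // ‖x.1‖ = 1 / 2 ∧ ‖x.2‖ = 1 ∧ inner ℝ x.1 x.2 = 0}

/-- Two unit tangent vectors span the same tangent line. -/
def sameLine : Setoid T1S2 where
  r x y := x.1.1 = y.1.1 ∧ (x.1.2 = y.1.2 ∨ x.1.2 = -y.1.2)
  iseqv :=
    { refl := fun _ => ⟨rfl, Or.inl rfl⟩
      symm := by
        rintro x y ⟨h, h' | h'⟩
        · exact ⟨h.symm, Or.inl h'.symm⟩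
        · exact ⟨h.symm, Or.inr (by rw [h', neg_neg])⟩
      trans := by
        rintro x y z ⟨h, h' | h'⟩ ⟨k, k' | k'⟩
        · exact ⟨h.trans k, Or.inl (h'.trans k')⟩
        · exact ⟨h.trans k, Or.inr (h'.trans k')⟩
        · exact ⟨h.trans k, Or.inr (by rw [h', k'])⟩
        · exact ⟨h.trans k, Or.inl (by rw [h', k', neg_neg])⟩ }

/-- The projective tangent bundle `PS²`, the space of tangent lines of `S²`, with the quotient
topology and its Borel sets. -/
def PS2 : Type := Quotient sameLine

instance : TopologicalSpace PS2 := inferInstanceAs (TopologicalSpace (Quotient sameLine))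

instance : MeasurableSpace PS2 := borel PS2

instance : BorelSpace PS2 := ⟨rfl⟩

/-- The tangent line spanned by a unit tangent vector. -/
def PS2.mk (x : T1S2) : PS2 := Quotient.mk sameLine x

/-- The bundle projection `π : PS² → S²`. -/
def PS2.proj : PS2 → S2 :=
  Quotient.lift (fun x : T1S2 => (⟨x.1.1, by simpa using x.2.1⟩ : S2))
    (fun _ _ h => Subtype.ext h.1)

/-- The unit circle in the tangent plane `T_p S²`, with the metric of `ℝ³`. -/
abbrev TangentCircle (p : S2) : Type := {v : E3 // ‖v‖ = 1 ∧ inner ℝ (p : E3) v = 0}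

/-- The line in `T_p S²` spanned by a unit vector. -/
def tangentLine (p : S2) (v : TangentCircle p) : PS2 :=
  PS2.mk ⟨((p : E3), (v : E3)), by simp, v.2.1, v.2.2⟩

/-- Lebesgue measure `μ` on `S²`: the area, normalized to be a probability measure. -/
def area : Measure S2 := ProbabilityTheory.cond (Measure.hausdorffMeasure 2) Set.univ

/-- The measure `m_p` on the fibre of `PS²` over `p`: arc length on the unit circle of `T_p S²`,
normalized to be a probability measure and transported to lines. -/
def fiberMeasure (p : S2) : Measure PS2 :=
  (ProbabilityTheory.cond (Measure.hausdorffMeasure 1 : Measure (TangentCircle p)) Set.univ).map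
    (tangentLine p)

/-- The normalized Liouville measure on `PS²`: `m = ∫ m_p dμ(p)`. -/
def liouville : Measure PS2 := area.bind fiberMeasure

/-! ### Twist maps and rotations on the projective bundle -/

/-- The twist map `(r, z) ↦ (r, exp (2 π i (r + 1/2) ε) z)`, on all of `ℝ × ℂ`. -/
def twist (ε : ℝ) (x : E3) : E3 :=
  !₂[x 0,
    Real.cos (2 * Real.pi * (x 0 + 1 / 2) * ε) * x 1 -
      Real.sin (2 * Real.pi * (x 0 + 1 / 2) * ε) * x 2,
    Real.sin (2 * Real.pi * (x 0 + 1 / 2) * ε) * x 1 +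
      Real.cos (2 * Real.pi * (x 0 + 1 / 2) * ε) * x 2]

theorem inner_twist_self (ε : ℝ) (x : E3) :
    inner ℝ (twist ε x) (twist ε x) = inner ℝ x x := by
  simp only [twist, PiLp.inner_apply, Fin.sum_univ_three, RCLike.inner_apply, conj_trivial]
  simp [-one_div]
  linear_combination (x 1 ^ 2 + x 2 ^ 2) *
    Real.sin_sq_add_cos_sq (2 * Real.pi * (x 0 + 1 / 2) * ε)

theorem norm_twist (ε : ℝ) (x : E3) : ‖twist ε x‖ = ‖x‖ := by
  rw [norm_eq_sqrt_real_inner, inner_twist_self, ← norm_eq_sqrt_real_inner]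

theorem twist_neg_twist (ε : ℝ) (x : E3) : twist (-ε) (twist ε x) = x := by
  have h := Real.sin_sq_add_cos_sq (2 * Real.pi * (x 0 + 1 / 2) * ε)
  ext i
  fin_cases i
  · simp [twist]
  · simp only [twist, mul_neg]
    simp [-one_div]
    linear_combination (x 1) * h
  · simp only [twist, mul_neg]
    simp [-one_div]
    linear_combination (x 2) * h

theorem differentiable_twist (ε : ℝ) : Differentiable ℝ (twist ε) := by
  rw [differentiable_euclidean]
  intro i
  fin_cases i <;> simp only [twist] <;> simp <;> fun_prop

/-- The derivative of the twist map along `S²` takes tangent vectors at `p` to tangent vectors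
at the image of `p`. -/
theorem inner_fderiv_twist (ε : ℝ) (p v : E3) :
    inner ℝ (twist ε p) (fderiv ℝ (twist ε) p v) = inner ℝ p v := by
  have hd := (differentiable_twist ε p).hasFDerivAt
  have h1 := hd.inner ℝ hd
  have h2 := (hasFDerivAt_id (𝕜 := ℝ) p).inner ℝ (hasFDerivAt_id p)
  have h3 : (fun x => inner ℝ (twist ε x) (twist ε x)) = fun x : E3 => inner ℝ (id x) (id x) := by
    funext x
    exact inner_twist_self ε x
  rw [h3] at h1
  have h4 := congrArg (fun L => L v) (h1.unique h2)
  simp [real_inner_comm] at h4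
  have h5 := real_inner_comm (twist ε p) (fderiv ℝ (twist ε) p v)
  have h6 := real_inner_comm p v
  linarith

theorem fderiv_twist_ne_zero (ε : ℝ) (p : E3) {v : E3} (hv : v ≠ 0) :
    fderiv ℝ (twist ε) p v ≠ 0 := by
  intro h0
  have h1 := ((differentiable_twist (-ε) (twist ε p)).hasFDerivAt).comp p
    (differentiable_twist ε p).hasFDerivAt
  have h2 : (twist (-ε) ∘ twist ε) = (id : E3 → E3) := funext fun x => twist_neg_twist ε x
  rw [h2] at h1
  have h3 := congrArg (fun L => L v) (h1.unique (hasFDerivAt_id p))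
  simp [h0] at h3
  exact hv h3.symm

/-- The map of `T₁S²` induced by the twist map `f`, `(p, v) ↦ (f p, T_p f v / ‖T_p f v‖)`. As `v`
is tangent to `S²`, `T_p f v` is the derivative at `p` in the direction `v` of the twist map of
the ambient space. -/
def twistT1 (ε : ℝ) (x : T1S2) : T1S2 :=
  ⟨(twist ε x.1.1,
      (‖fderiv ℝ (twist ε) x.1.1 x.1.2‖)⁻¹ • fderiv ℝ (twist ε) x.1.1 x.1.2), by
    refine ⟨by simpa only [norm_twist] using x.2.1, ?_, ?_⟩
    · have hv : x.1.2 ≠ 0 := fun h => by simpa [h] using x.2.2.1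
      have := norm_ne_zero_iff.2 (fderiv_twist_ne_zero ε x.1.1 hv)
      simp only [norm_smul, norm_inv, norm_norm]
      exact inv_mul_cancel₀ this
    · simp only [inner_smul_right, inner_fderiv_twist, x.2.2.2, mul_zero]⟩

/-- The map `f_♯` of `PS²` induced by the twist map. -/
def twistSharp (ε : ℝ) : PS2 → PS2 :=
  Quotient.map' (s₁ := sameLine) (s₂ := sameLine) (twistT1 ε) (by
    rintro ⟨⟨p, v⟩, hx⟩ ⟨⟨q, w⟩, hy⟩ ⟨h, h'⟩
    simp only at h h'
    subst h
    refine ⟨rfl, ?_⟩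
    rcases h' with h' | h'
    · subst h'
      exact Or.inl rfl
    · subst h'
      exact Or.inr (by simp [twistT1]))

/-- The action of a rotation on `T₁S²` by its tangent map. -/
def rotateT1 (g : SO3) (x : T1S2) : T1S2 :=
  ⟨(rotate g x.1.1, rotate g x.1.2), by
    simpa only [norm_rotate, inner_rotate] using x.2⟩

/-- The action of a rotation on `PS²` by its tangent map. -/
def rotateSharp (g : SO3) : PS2 → PS2 :=
  Quotient.map' (s₁ := sameLine) (s₂ := sameLine) (rotateT1 g) (by
    rintro ⟨⟨p, v⟩, hx⟩ ⟨⟨q, w⟩, hy⟩ ⟨h, h'⟩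
    simp only at h h'
    subst h
    refine ⟨rfl, ?_⟩
    rcases h' with h' | h'
    · subst h'
      exact Or.inl rfl
    · subst h'
      exact Or.inr (by simp [rotateT1, rotate, Matrix.mulVec_neg]))

/-! ### The `δ`-diffused process and its stationary measures -/

/-- One step of the `δ`-diffused process about `g f_ε` on `PS²`: the law of `(u g f_ε)_♯ x` where
`u` has normalized Haar measure on `U_δ` as its law, and `x` has law `κ` and is independent
of `u`. -/
def step (ε δ : ℝ) (g : SO3) (κ : Measure PS2) : Measure PS2 :=
  ((noise δ).prod κ).map fun a => rotateSharp a.1 (rotateSharp g (twistSharp ε a.2))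

/-- `κ` is a stationary probability measure of the `δ`-diffused process about `g f_ε` that is
absolutely continuous with respect to Liouville measure and covers Lebesgue measure on `S²`. -/
structure IsDiffusedStationary (ε δ : ℝ) (g : SO3) (κ : Measure PS2) : Prop where
  isProbabilityMeasure : IsProbabilityMeasure κ
  stationary : step ε δ g κ = κ
  absolutelyContinuous : κ ≪ liouville
  covers : κ.map PS2.proj = area

/-- The Cesàro average of the first `n` images of Liouville measure under the process. -/
def cesaro (ε δ : ℝ) (g : SO3) (n : ℕ) : Measure PS2 :=
  (n : ℝ≥0∞)⁻¹ • ∑ k ∈ Finset.Icc 1 n, (step ε δ g)^[k] liouville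

/-- `κ` is the weak limit of the Cesàro averages. -/
def IsCesaroLimit (ε δ : ℝ) (g : SO3) (κ : Measure PS2) : Prop :=
  IsProbabilityMeasure κ ∧ ∀ F : PS2 →ᵇ ℝ,
    Tendsto (fun n => ∫ x, F x ∂(cesaro ε δ g n)) atTop (𝓝 (∫ x, F x ∂κ))

open Classical in
/-- The stationary measure `m_{g,ε,δ}`, the weak limit of the Cesàro averages. -/
def diffusedMeasure (ε δ : ℝ) (g : SO3) : Measure PS2 :=
  if h : ∃ κ, IsCesaroLimit ε δ g κ then h.choose else 0

/-- The averaged stationary measure `m_{ε,δ} = ∫ m_{g,ε,δ} dg`. -/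
def averagedMeasure (ε δ : ℝ) : Measure PS2 := haarSO3.bind (diffusedMeasure ε δ)

/-- The density `φ_{ε,δ}` of `m_{ε,δ}` with respect to Liouville measure. -/
def density (ε δ : ℝ) (x : PS2) : ℝ := ((averagedMeasure ε δ).rnDeriv liouville x).toReal

end TwistSphere

end

/-! The argument takes place on SO(3). A unit tangent vector is the same thing as an oriented
orthonormal frame, so `PS2` is a quotient of the group, Liouville measure is the image of Haar
measure (`liouville_eq_map_frameLine`), and the process lifts to frames (`step_map_frameLine`).
Write |U| for the Haar measure of the ball of radius δ.

Existence. Translating the noise by two frames at matrix distance d gives laws whose difference on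
any set is at most C |U|⁻¹ √d (`exists_ballDiff_bound`). So the Markov operator makes bounded
families of functions equicontinuous, and a mean ergodic theorem yields convergence of the Cesàro
averages to a stationary measure (`exists_frame_limit`). One step of noise bounds its density by
1/|U| (`frameLimit_le`), and it covers area because rotations and the twist preserve area.

Comparison. The twist shears along the circles of latitude, so for large ε it makes most tangent
lines nearly horizontal: the image of a frame g is within O(1/(ε w)) of a horizontal one, where w =
|g₀₁ g₀₂| (`one_sub_twistCos_sq_le`). By stationarity the limit measure is the law of u g f(x),
where x itself has the limit law. Replacing f(x) by the horizontal line at the same base point costs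
O(|U|⁻¹ ε^(-1/2) ∫ w^(-1/2)) with the integral against the limit measure; the density bound turns
this into |U|⁻² ε^(-1/2) times a finite Haar integral. After the replacement only the base point
matters, and its law is area for every g, so averaging over g produces exactly Liouville measure
(`lintegral_noise_horizontalLine`). Since |U| ≥ c δ³ for δ ≤ π, the error is O(δ⁻⁶ ε^(-1/2)),
stronger than required; a one-sided bound on sets already controls the L¹ norm. -/

noncomputable section

namespace TwistSphere

/-! ### The rotation group as a compact metrizable group -/

/-- The matrix of a rotation. -/
abbrev mat (g : SO3) : Matrix (Fin 3) (Fin 3) ℝ := g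

instance : SecondCountableTopology SO3 :=
  have : SecondCountableTopology (Matrix (Fin 3) (Fin 3) ℝ) :=
    inferInstanceAs (SecondCountableTopology (Fin 3 → Fin 3 → ℝ))
  TopologicalSpace.Subtype.secondCountableTopology _

instance : TopologicalSpace.MetrizableSpace SO3 :=
  TopologicalSpace.metrizableSpace_of_t3_secondCountable SO3

instance : haarSO3.IsHaarMeasure := Measure.isHaarMeasure_haarMeasure _

instance : IsProbabilityMeasure haarSO3 := by
  constructor
  have h := Measure.haarMeasure_self (G := SO3) (K₀ := ⊤)
  simpa [haarSO3] using h

/-- Right translations commute with left ones, so they carry Haar measure to a Haar probability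
measure, which is unique. -/
instance : haarSO3.IsMulRightInvariant := by
  constructor
  intro g
  have : IsProbabilityMeasure (haarSO3.map (· * g)) :=
    Measure.isProbabilityMeasure_map (measurable_mul_const g).aemeasurable
  exact Measure.isHaarMeasure_eq_of_isProbabilityMeasure _ _

theorem mat_mul (g h : SO3) : mat (g * h) = mat g * mat h := rfl

theorem mat_inv (g : SO3) : mat g⁻¹ = (mat g)ᵀ := rfl

theorem mat_mul_transpose (g : SO3) : mat g * (mat g)ᵀ = 1 := by
  have := (Matrix.mem_orthogonalGroup_iff (Fin 3) ℝ).1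
    (Matrix.mem_specialOrthogonalGroup_iff.1 g.2).1
  simpa [Matrix.star_eq_conjTranspose] using this

theorem mat_transpose_mul (g : SO3) : (mat g)ᵀ * mat g = 1 := by
  have := (Matrix.mem_orthogonalGroup_iff' (Fin 3) ℝ).1
    (Matrix.mem_specialOrthogonalGroup_iff.1 g.2).1
  simpa [Matrix.star_eq_conjTranspose] using this

theorem mat_det (g : SO3) : (mat g).det = 1 := (Matrix.mem_specialOrthogonalGroup_iff.1 g.2).2

theorem continuous_mat : Continuous mat := continuous_subtype_val

theorem continuous_entry (i j : Fin 3) : Continuous fun g : SO3 => mat g i j :=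
  continuous_mat.matrix_elem i j

theorem row_inner (g : SO3) (i j : Fin 3) :
    mat g i 0 * mat g j 0 + mat g i 1 * mat g j 1 + mat g i 2 * mat g j 2 =
      if i = j then 1 else 0 := by
  have := congrFun (congrFun (mat_mul_transpose g) i) j
  simpa [Matrix.mul_apply, Fin.sum_univ_three, Matrix.one_apply] using this

theorem col_inner (g : SO3) (i j : Fin 3) :
    mat g 0 i * mat g 0 j + mat g 1 i * mat g 1 j + mat g 2 i * mat g 2 j =
      if i = j then 1 else 0 := by
  have := congrFun (congrFun (mat_transpose_mul g) i) j
  simpa [Matrix.mul_apply, Fin.sum_univ_three, Matrix.one_apply] using this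

theorem abs_entry_le_one (g : SO3) (i j : Fin 3) : |mat g i j| ≤ 1 := by
  have h := row_inner g i i
  simp only [if_true] at h
  rw [abs_le_one_iff_mul_self_le_one]
  fin_cases j <;> simp only [Fin.zero_eta, Fin.mk_one, Fin.reduceFinMk] <;>
    nlinarith [mul_self_nonneg (mat g i 0), mul_self_nonneg (mat g i 1),
      mul_self_nonneg (mat g i 2)]

/-- A rotation is its own matrix of cofactors. -/
theorem adjugate_eq_transpose (g : SO3) : (mat g).adjugate = (mat g)ᵀ := by
  have h := Matrix.adjugate_mul (mat g)
  rw [mat_det, one_smul] at h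
  calc (mat g).adjugate = (mat g).adjugate * (mat g * (mat g)ᵀ) := by
        rw [mat_mul_transpose, mul_one]
    _ = (mat g)ᵀ := by rw [← mul_assoc, h, one_mul]

/-- The third column is the cross product of the first two, so a frame is determined by its point
and vector. -/
theorem col_two (g : SO3) :
    mat g 0 2 = mat g 1 0 * mat g 2 1 - mat g 2 0 * mat g 1 1 ∧
    mat g 1 2 = mat g 2 0 * mat g 0 1 - mat g 0 0 * mat g 2 1 ∧
    mat g 2 2 = mat g 0 0 * mat g 1 1 - mat g 1 0 * mat g 0 1 := by
  have h := adjugate_eq_transpose g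
  rw [Matrix.adjugate_fin_three] at h
  have h0 := congrFun (congrFun h 2) 0
  have h1 := congrFun (congrFun h 2) 1
  have h2 := congrFun (congrFun h 2) 2
  simp at h0 h1 h2
  refine ⟨?_, ?_, ?_⟩ <;> linarith

theorem entry_zero_zero (g : SO3) :
    mat g 0 0 = mat g 1 1 * mat g 2 2 - mat g 1 2 * mat g 2 1 := by
  have h := adjugate_eq_transpose g
  rw [Matrix.adjugate_fin_three] at h
  have h0 := congrFun (congrFun h 0) 0
  simp at h0
  linarith

theorem rotate_mul (g h : SO3) (x : E3) : rotate (g * h) x = rotate g (rotate h x) := by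
  simp [rotate, Matrix.mulVec_mulVec]

theorem rotate_one (x : E3) : rotate 1 x = x := by simp [rotate]

theorem rotate_apply (g : SO3) (x : E3) (i : Fin 3) :
    rotate g x i = mat g i 0 * x 0 + mat g i 1 * x 1 + mat g i 2 * x 2 := by
  simp [rotate, Matrix.mulVec, dotProduct, Fin.sum_univ_three]

theorem rotate_smul (g : SO3) (c : ℝ) (x : E3) : rotate g (c • x) = c • rotate g x := by
  simp [rotate, Matrix.mulVec_smul]

theorem rotate_sub (g : SO3) (x y : E3) : rotate g (x - y) = rotate g x - rotate g y := by
  simp [rotate, Matrix.mulVec_sub]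

theorem norm_sq_E3 (x : E3) : ‖x‖ ^ 2 = x 0 ^ 2 + x 1 ^ 2 + x 2 ^ 2 := by
  simp [EuclideanSpace.norm_sq_eq, Fin.sum_univ_three]

theorem inner_E3 (x y : E3) : inner ℝ x y = x 0 * y 0 + x 1 * y 1 + x 2 * y 2 := by
  simp [PiLp.inner_apply, Fin.sum_univ_three, mul_comm]

theorem continuous_rotate : Continuous fun a : SO3 × E3 => rotate a.1 a.2 := by
  unfold rotate
  refine (PiLp.continuous_toLp 2 _).comp ?_
  exact Continuous.matrix_mulVec (continuous_mat.comp continuous_fst)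
    ((PiLp.continuous_ofLp 2 _).comp continuous_snd)

/-! ### Frames -/

/-- The first vector of the standard frame. -/
def e0 : E3 := !₂[1, 0, 0]

/-- The second vector of the standard frame. -/
def e1 : E3 := !₂[0, 1, 0]

/-- The unit tangent vector given by the first two vectors of the frame `g`. -/
def frameVector (g : SO3) : T1S2 :=
  ⟨((1 / 2 : ℝ) • rotate g e0, rotate g e1), by
    have h0 : ‖e0‖ = 1 := by simp [e0, EuclideanSpace.norm_eq, Fin.sum_univ_three]
    have h1 : ‖e1‖ = 1 := by simp [e1, EuclideanSpace.norm_eq, Fin.sum_univ_three]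
    have h2 : inner ℝ e0 e1 = 0 := by simp [inner_E3, e0, e1]
    refine ⟨by rw [norm_smul, norm_rotate, h0]; norm_num, by rw [norm_rotate, h1], ?_⟩
    rw [inner_smul_left, inner_rotate, h2, mul_zero]⟩

theorem frameVector_fst_apply (g : SO3) (i : Fin 3) : (frameVector g).1.1 i = mat g i 0 / 2 := by
  simp [frameVector, rotate_apply, e0]
  ring

theorem frameVector_snd_apply (g : SO3) (i : Fin 3) : (frameVector g).1.2 i = mat g i 1 := by
  simp [frameVector, rotate_apply, e1]

/-- The matrix with columns `2 p`, `v`, `2 p × v`. -/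
def frameMat (p v : E3) : Matrix (Fin 3) (Fin 3) ℝ :=
  !![2 * p 0, v 0, 2 * (p 1 * v 2 - p 2 * v 1);
     2 * p 1, v 1, 2 * (p 2 * v 0 - p 0 * v 2);
     2 * p 2, v 2, 2 * (p 0 * v 1 - p 1 * v 0)]

theorem T1S2.coords (x : T1S2) :
    x.1.1 0 ^ 2 + x.1.1 1 ^ 2 + x.1.1 2 ^ 2 = 1 / 4 ∧
    x.1.2 0 ^ 2 + x.1.2 1 ^ 2 + x.1.2 2 ^ 2 = 1 ∧
    x.1.1 0 * x.1.2 0 + x.1.1 1 * x.1.2 1 + x.1.1 2 * x.1.2 2 = 0 := by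
  refine ⟨?_, ?_, ?_⟩
  · rw [← norm_sq_E3, x.2.1]; norm_num
  · rw [← norm_sq_E3, x.2.2.1]; norm_num
  · rw [← inner_E3, x.2.2.2]

theorem frameMat_mem {p v : E3} (h1 : p 0 ^ 2 + p 1 ^ 2 + p 2 ^ 2 = 1 / 4)
    (h2 : v 0 ^ 2 + v 1 ^ 2 + v 2 ^ 2 = 1) (h3 : p 0 * v 0 + p 1 * v 1 + p 2 * v 2 = 0) :
    frameMat p v ∈ Matrix.specialOrthogonalGroup (Fin 3) ℝ := by
  rw [Matrix.mem_specialOrthogonalGroup_iff, Matrix.mem_orthogonalGroup_iff']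
  unfold frameMat
  generalize p 0 = a at *
  generalize p 1 = b at *
  generalize p 2 = c at *
  generalize v 0 = d at *
  generalize v 1 = e at *
  generalize v 2 = f at *
  -- Lagrange's identity: |p × v|² = |p|² |v|² - ⟨p, v⟩².
  have h4 : (b * f - c * e) ^ 2 + (c * d - a * f) ^ 2 + (a * e - b * d) ^ 2 = 1 / 4 := by
    linear_combination (d ^ 2 + e ^ 2 + f ^ 2) * h1 + 1 / 4 * h2 -
      (a * d + b * e + c * f) * h3
  constructor
  · ext i j
    fin_cases i <;> fin_cases j <;>
      simp [Matrix.mul_apply, Fin.sum_univ_three, Matrix.transpose_apply] <;>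
      first
      | linear_combination 4 * h1
      | linear_combination h2
      | linear_combination 4 * h4
      | linear_combination 2 * h3
      | ring
  · rw [Matrix.det_fin_three]
    simp
    linear_combination 4 * h4

/-- The oriented orthonormal frame determined by a unit tangent vector. -/
def frame (x : T1S2) : SO3 :=
  ⟨frameMat x.1.1 x.1.2, frameMat_mem x.coords.1 x.coords.2.1 x.coords.2.2⟩

theorem mat_frame (x : T1S2) : mat (frame x) = frameMat x.1.1 x.1.2 := rfl

theorem frameVector_frame (x : T1S2) : frameVector (frame x) = x := by
  apply Subtype.ext
  apply Prod.ext
  · ext i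
    rw [frameVector_fst_apply]
    fin_cases i <;> simp [mat_frame, frameMat]
  · ext i
    rw [frameVector_snd_apply]
    fin_cases i <;> simp [mat_frame, frameMat]

theorem frame_frameVector (g : SO3) : frame (frameVector g) = g := by
  obtain ⟨h0, h1, h2⟩ := col_two g
  apply Subtype.ext
  change frameMat _ _ = mat g
  ext i j
  fin_cases i <;> fin_cases j <;>
    simp [frameMat, frameVector_fst_apply, frameVector_snd_apply, -one_div] <;>
    linarith

theorem continuous_frameVector : Continuous frameVector := by
  refine Continuous.subtype_mk ?_ _
  exact ((continuous_rotate.comp (continuous_id.prodMk continuous_const)).const_smul (1 / 2 : ℝ)).prodMk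
    (continuous_rotate.comp (continuous_id.prodMk continuous_const))

theorem continuous_frame : Continuous frame := by
  refine Continuous.subtype_mk ?_ _
  refine continuous_matrix fun i j => ?_
  fin_cases i <;> fin_cases j <;> simp [frameMat] <;> fun_prop

/-- Frames of `S²` are the same as unit tangent vectors. -/
def frameHomeo : SO3 ≃ₜ T1S2 where
  toFun := frameVector
  invFun := frame
  left_inv := frame_frameVector
  right_inv := frameVector_frame
  continuous_toFun := continuous_frameVector
  continuous_invFun := continuous_frame

theorem frameVector_mul (g h : SO3) : frameVector (g * h) = rotateT1 g (frameVector h) := by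
  apply Subtype.ext
  simp [frameVector, rotateT1, rotate_mul, rotate_smul]

instance : CompactSpace T1S2 := frameHomeo.compactSpace

/-! ### The projective bundle as a quotient of the rotation group -/

/-- The line of the second vector of a frame, at the point given by the first one. -/
def frameLine (g : SO3) : PS2 := PS2.mk (frameVector g)

/-- The base point of a frame. -/
def framePoint (g : SO3) : S2 :=
  ⟨(1 / 2 : ℝ) • rotate g e0, mem_sphere_zero_iff_norm.2 (frameVector g).2.1⟩

theorem continuous_mk : Continuous PS2.mk := continuous_quotient_mk'

theorem continuous_frameLine : Continuous frameLine := continuous_mk.comp continuous_frameVector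

theorem continuous_framePoint : Continuous framePoint :=
  Continuous.subtype_mk (continuous_fst.comp (continuous_subtype_val.comp
    continuous_frameVector)) _

theorem surjective_mk : Function.Surjective PS2.mk := Quotient.mk_surjective

theorem surjective_frameLine : Function.Surjective frameLine :=
  surjective_mk.comp frameHomeo.surjective

theorem frameLine_mul (g h : SO3) : frameLine (g * h) = rotateSharp g (frameLine h) := by
  rw [frameLine, frameVector_mul]
  rfl

theorem continuous_proj : Continuous PS2.proj :=
  Continuous.quotient_lift (Continuous.subtype_mk (continuous_fst.comp continuous_subtype_val) _) _

instance : CompactSpace PS2 := inferInstanceAs (CompactSpace (Quotient sameLine))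

/-- The orthogonal projection to a tangent line, together with its base point. -/
def lineProjector : PS2 → E3 × (Fin 3 → Fin 3 → ℝ) :=
  Quotient.lift (fun x : T1S2 => (x.1.1, fun i j => x.1.2 i * x.1.2 j)) (by
    rintro x y ⟨h, h' | h'⟩ <;> simp [h, h'])

theorem continuous_lineProjector : Continuous lineProjector := by
  refine Continuous.quotient_lift ?_ _
  fun_prop

/-- If `v vᵀ = w wᵀ` for unit vectors, then ⟨v, w⟩² = 1 and equality in Cauchy–Schwarz gives v = ±w.
This makes `PS2` Hausdorff and metrizable. -/
theorem injective_lineProjector : Function.Injective lineProjector := by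
  intro x y h
  obtain ⟨x, rfl⟩ := surjective_mk x
  obtain ⟨y, rfl⟩ := surjective_mk y
  change (x.1.1, fun i j => x.1.2 i * x.1.2 j) = (y.1.1, fun i j => y.1.2 i * y.1.2 j) at h
  rw [Prod.mk.injEq] at h
  obtain ⟨h1, h⟩ := h
  have h2 : ∀ i j, x.1.2 i * x.1.2 j = y.1.2 i * y.1.2 j := fun i j =>
    congrFun (congrFun h i) j
  refine Quotient.sound ⟨h1, ?_⟩
  have hin : inner ℝ x.1.2 y.1.2 * inner ℝ x.1.2 y.1.2 = 1 := by
    have hy := y.coords.2.1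
    rw [inner_E3]
    linear_combination (y.1.2 0 ^ 2 + y.1.2 1 ^ 2 + y.1.2 2 ^ 2 + 1) * hy +
      y.1.2 0 * y.1.2 0 * h2 0 0 + y.1.2 1 * y.1.2 1 * h2 1 1 + y.1.2 2 * y.1.2 2 * h2 2 2 +
      2 * y.1.2 0 * y.1.2 1 * h2 0 1 + 2 * y.1.2 0 * y.1.2 2 * h2 0 2 +
      2 * y.1.2 1 * y.1.2 2 * h2 1 2
  rcases mul_self_eq_one_iff.1 hin with h3 | h3
  · exact Or.inl ((inner_eq_one_iff_of_norm_eq_one (𝕜 := ℝ) x.2.2.1 y.2.2.1).1 h3)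
  · refine Or.inr ((inner_eq_one_iff_of_norm_eq_one (𝕜 := ℝ) x.2.2.1 (by rw [norm_neg, y.2.2.1])).1 ?_)
    rw [inner_neg_right, h3, neg_neg]

instance : T2Space PS2 :=
  T2Space.of_injective_continuous injective_lineProjector continuous_lineProjector

theorem isEmbedding_lineProjector : IsEmbedding lineProjector :=
  (continuous_lineProjector.isClosedEmbedding injective_lineProjector).isEmbedding

instance : SecondCountableTopology PS2 := isEmbedding_lineProjector.secondCountableTopology

instance : TopologicalSpace.MetrizableSpace PS2 :=
  TopologicalSpace.metrizableSpace_of_t3_secondCountable PS2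

/-- A product of quotient maps need not be a quotient map; here it is, as a continuous surjection
from a compact space onto a Hausdorff one. -/
theorem continuous_rotateSharp : Continuous fun a : SO3 × PS2 => rotateSharp a.1 a.2 := by
  have hq : IsQuotientMap (Prod.map (id : SO3 → SO3) frameLine) :=
    IsQuotientMap.of_surjective_continuous
      (Function.surjective_id.prodMap surjective_frameLine)
      (continuous_id.prodMap continuous_frameLine)
  rw [hq.continuous_iff]
  have : (fun a : SO3 × PS2 => rotateSharp a.1 a.2) ∘ Prod.map id frameLine =
      fun a : SO3 × SO3 => frameLine (a.1 * a.2) := by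
    funext a
    simp [frameLine_mul]
  rw [this]
  exact continuous_frameLine.comp continuous_mul

theorem contDiff_twist (ε : ℝ) : ContDiff ℝ 1 (twist ε) := by
  rw [contDiff_euclidean]
  intro i
  fin_cases i <;> simp only [twist] <;> simp <;> fun_prop

theorem continuous_twistT1 (ε : ℝ) : Continuous (twistT1 ε) := by
  refine Continuous.subtype_mk ?_ _
  have h1 : Continuous fun x : T1S2 => fderiv ℝ (twist ε) x.1.1 x.1.2 :=
    ((contDiff_twist ε).continuous_fderiv_apply one_ne_zero).comp continuous_subtype_val
  refine ((contDiff_twist ε).continuous.comp (continuous_fst.comp continuous_subtype_val)).prodMk ?_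
  refine (h1.norm.inv₀ fun x => ?_).smul h1
  have hv : x.1.2 ≠ 0 := fun h => by simpa [h] using x.2.2.1
  exact norm_ne_zero_iff.2 (fderiv_twist_ne_zero ε x.1.1 hv)

theorem twistSharp_mk (ε : ℝ) (x : T1S2) : twistSharp ε (PS2.mk x) = PS2.mk (twistT1 ε x) := rfl

theorem continuous_twistSharp (ε : ℝ) : Continuous (twistSharp ε) :=
  Continuous.quotient_map' (continuous_twistT1 ε) _

/-- The action of the twist map on frames. -/
def twistFrame (ε : ℝ) (g : SO3) : SO3 := frame (twistT1 ε (frameVector g))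

theorem continuous_twistFrame (ε : ℝ) : Continuous (twistFrame ε) :=
  continuous_frame.comp ((continuous_twistT1 ε).comp continuous_frameVector)

theorem frameLine_twistFrame (ε : ℝ) (g : SO3) :
    frameLine (twistFrame ε g) = twistSharp ε (frameLine g) := by
  simp only [frameLine, twistFrame, frameVector_frame, twistSharp_mk]

/-! ### Horizontal vectors -/

/-- The unit vector at `x` tangent to the circle of rotation about the first axis, and a fixed
vector on the axis. -/
def horizontal (x : E3) : E3 :=
  if x 1 = 0 ∧ x 2 = 0 then e1 else (√(x 1 ^ 2 + x 2 ^ 2))⁻¹ • !₂[0, -x 2, x 1]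

theorem measurable_horizontal : Measurable horizontal := by
  unfold horizontal
  refine Measurable.ite ?_ measurable_const (by fun_prop)
  exact (measurableSet_eq_fun (by fun_prop) measurable_const).inter
    (measurableSet_eq_fun (by fun_prop) measurable_const)

theorem norm_horizontal (x : E3) : ‖horizontal x‖ = 1 := by
  have h : ‖horizontal x‖ ^ 2 = 1 := by
    unfold horizontal
    split_ifs with hx
    · simp [norm_sq_E3, e1]
    · have hpos : 0 < x 1 ^ 2 + x 2 ^ 2 := by
        rcases not_and_or.1 hx with h | h <;> positivity
      rw [norm_smul, mul_pow, norm_sq_E3, norm_inv, inv_pow, Real.norm_eq_abs, sq_abs,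
        Real.sq_sqrt hpos.le]
      simp
      field_simp
      ring
  nlinarith [norm_nonneg (horizontal x)]

theorem inner_horizontal (x : E3) : inner ℝ x (horizontal x) = 0 := by
  unfold horizontal
  split_ifs with hx
  · simp [inner_E3, e1, hx.1]
  · rw [inner_smul_right, inner_E3]
    simp
    right
    ring

/-- The horizontal unit tangent vector at a point of the sphere. -/
def horizontalVector (p : S2) : T1S2 :=
  ⟨((p : E3), horizontal p), by simp, norm_horizontal _, inner_horizontal _⟩

theorem measurable_horizontalVector : Measurable horizontalVector :=
  (measurable_subtype_coe.prodMk (measurable_horizontal.comp measurable_subtype_coe)).subtype_mk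

theorem framePoint_frame (x : T1S2) : (framePoint (frame x) : E3) = x.1.1 :=
  congrArg (fun y : T1S2 => y.1.1) (frameVector_frame x)

theorem framePoint_horizontal (p : S2) : framePoint (frame (horizontalVector p)) = p :=
  Subtype.ext (framePoint_frame _)

theorem surjective_framePoint : Function.Surjective framePoint := fun p =>
  ⟨_, framePoint_horizontal p⟩

/-- Rotations act transitively on directions. -/
theorem exists_rotate_e0 (x : E3) : ∃ g : SO3, x = ‖x‖ • rotate g e0 := by
  by_cases hx : x = 0
  · exact ⟨1, by simp [hx]⟩
  have hx' : ‖x‖ ≠ 0 := norm_ne_zero_iff.2 hx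
  obtain ⟨g, hg⟩ := surjective_framePoint ⟨((1 / 2) * ‖x‖⁻¹) • x, by
    simp [norm_smul, hx']⟩
  refine ⟨g, ?_⟩
  have h : (1 / 2 : ℝ) • rotate g e0 = ((1 / 2) * ‖x‖⁻¹) • x := congrArg Subtype.val hg
  rw [mul_smul] at h
  rw [smul_right_injective E3 (by norm_num : (1 / 2 : ℝ) ≠ 0) h, smul_smul,
    mul_inv_cancel₀ hx', one_smul]

/-! ### Homogeneous spaces of the rotation group -/

/-- A uniformly distributed rotation of any independent point is uniformly distributed. -/
theorem map_act_haar_prod {X : Type*} [MeasurableSpace X] {act : SO3 → X → X} {o : SO3 → X}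
    (hact : Measurable fun a : SO3 × X => act a.1 a.2) (ho : Measurable o)
    (hsurj : Function.Surjective o) (heq : ∀ g h, o (g * h) = act g (o h))
    (ρ : Measure X) [IsProbabilityMeasure ρ] :
    (haarSO3.prod ρ).map (fun a => act a.1 a.2) = haarSO3.map o := by
  ext B hB
  rw [Measure.map_apply hact hB, Measure.map_apply ho hB, Measure.prod_apply_symm (hact hB)]
  have h : ∀ x : X, haarSO3 ((fun a => (a, x)) ⁻¹' ((fun a : SO3 × X => act a.1 a.2) ⁻¹' B)) =
      haarSO3 (o ⁻¹' B) := by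
    intro x
    -- By transitivity the point is `o c`, and right invariance of Haar measure removes `c`.
    obtain ⟨c, rfl⟩ := hsurj x
    rw [← measure_preimage_mul_right haarSO3 c (o ⁻¹' B)]
    congr 1
    ext a
    simp [heq]
  simp [h]

/-- The uniform distribution is the only invariant one. -/
theorem eq_map_haar_of_invariant {X : Type*} [MeasurableSpace X] {act : SO3 → X → X}
    {o : SO3 → X} (hact : Measurable fun a : SO3 × X => act a.1 a.2) (ho : Measurable o)
    (hsurj : Function.Surjective o) (heq : ∀ g h, o (g * h) = act g (o h))
    (ρ : Measure X) [IsProbabilityMeasure ρ] (hρ : ∀ g, ρ.map (act g) = ρ) :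
    ρ = haarSO3.map o := by
  -- A random rotation of `ρ` is uniform by the preceding lemma; by invariance it is also `ρ`
  -- itself.
  rw [← map_act_haar_prod hact ho hsurj heq ρ]
  ext B hB
  rw [Measure.map_apply hact hB, Measure.prod_apply (hact hB)]
  have h : ∀ a : SO3, ρ (Prod.mk a ⁻¹' ((fun a : SO3 × X => act a.1 a.2) ⁻¹' B)) = ρ B := by
    intro a
    conv_rhs => rw [← hρ a]
    have hm : Measurable (act a) := hact.comp measurable_prodMk_left
    rw [Measure.map_apply hm hB]
    rfl
  simp [h]

/-! ### Hausdorff measure on the sphere and on the tangent circles -/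

theorem cond_univ_map {X Y : Type*} [MeasurableSpace X] [MeasurableSpace Y] {μ : Measure X}
    {f : X → Y} (hf : Measurable f) :
    (ProbabilityTheory.cond μ Set.univ).map f = ProbabilityTheory.cond (μ.map f) Set.univ := by
  simp [ProbabilityTheory.cond, Measure.map_smul, Measure.map_apply hf]

theorem dist_le_of_coords {x y : E3} {c : ℝ} (h : ∀ i, |x i - y i| ≤ c) :
    dist x y ≤ 2 * c := by
  have hc : 0 ≤ c := (abs_nonneg _).trans (h 0)
  rw [dist_eq_norm]
  refine abs_le_of_sq_le_sq' ?_ (by positivity) |>.2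
  rw [norm_sq_E3]
  have h' : ∀ i, (x - y) i ^ 2 ≤ c ^ 2 := fun i => by
    rw [← sq_abs]
    exact pow_le_pow_left₀ (abs_nonneg _) (h i) 2
  nlinarith [h' 0, h' 1, h' 2]

theorem abs_mul_sub_mul_le {a b c d x y : ℝ} (ha : |a| ≤ 1) (hd : |d| ≤ 1) (h1 : |a - c| ≤ x)
    (h2 : |b - d| ≤ y) : |a * b - c * d| ≤ x + y := by
  have : a * b - c * d = a * (b - d) + (a - c) * d := by ring
  rw [this]
  refine (abs_add_le _ _).trans ?_
  rw [abs_mul, abs_mul]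
  nlinarith [abs_nonneg (b - d), abs_nonneg (a - c), abs_nonneg a, abs_nonneg d]

/-- Spherical coordinates. -/
def spherical (x : ℝ × ℝ) : S2 :=
  ⟨!₂[Real.cos x.1 / 2, Real.sin x.1 * Real.cos x.2 / 2, Real.sin x.1 * Real.sin x.2 / 2], by
    rw [mem_sphere_zero_iff_norm]
    refine (sq_eq_sq₀ (norm_nonneg _) (by norm_num)).1 ?_
    rw [norm_sq_E3]
    simp
    linear_combination (1 / 4 : ℝ) * Real.sin_sq_add_cos_sq x.1 +
      (1 / 4 : ℝ) * Real.sin x.1 ^ 2 * Real.sin_sq_add_cos_sq x.2⟩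

theorem abs_cos_sub_cos_le (x y : ℝ) : |Real.cos x - Real.cos y| ≤ |x - y| := by
  simpa [Real.dist_eq] using Real.lipschitzWith_cos.dist_le_mul x y

theorem abs_sin_sub_sin_le (x y : ℝ) : |Real.sin x - Real.sin y| ≤ |x - y| := by
  simpa [Real.dist_eq] using Real.lipschitzWith_sin.dist_le_mul x y

theorem lipschitzWith_spherical : LipschitzWith 2 spherical := by
  refine LipschitzWith.of_dist_le_mul fun x y => ?_
  rw [Subtype.dist_eq]
  refine dist_le_of_coords fun i => ?_
  have h1 : |x.1 - y.1| ≤ dist x y := by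
    rw [Prod.dist_eq, ← Real.dist_eq]; exact le_max_left _ _
  have h2 : |x.2 - y.2| ≤ dist x y := by
    rw [Prod.dist_eq, ← Real.dist_eq]; exact le_max_right _ _
  have h3 := (abs_cos_sub_cos_le x.1 y.1).trans h1
  have h4 := (abs_sin_sub_sin_le x.1 y.1).trans h1
  have h5 := (abs_cos_sub_cos_le x.2 y.2).trans h2
  have h6 := (abs_sin_sub_sin_le x.2 y.2).trans h2
  have key : ∀ {a b : ℝ}, |a - b| ≤ dist x y + dist x y → |a / 2 - b / 2| ≤ dist x y := by
    intro a b h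
    rw [← sub_div, abs_div, abs_two]
    linarith
  fin_cases i
  · exact key (h3.trans (by linarith [dist_nonneg (x := x) (y := y)]))
  · exact key (abs_mul_sub_mul_le (Real.abs_sin_le_one _) (Real.abs_cos_le_one _) h4 h5)
  · exact key (abs_mul_sub_mul_le (Real.abs_sin_le_one _) (Real.abs_sin_le_one _) h4 h6)

theorem exists_cos_sin {a b : ℝ} (h : a ^ 2 + b ^ 2 = 1) :
    ∃ t ∈ Set.Icc (-Real.pi) Real.pi, Real.cos t = a ∧ Real.sin t = b := by
  have hn : ‖(⟨a, b⟩ : ℂ)‖ = 1 := by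
    rw [Complex.norm_def, Complex.normSq_mk, Real.sqrt_eq_one]
    linarith
  have h0 : (⟨a, b⟩ : ℂ) ≠ 0 := fun h => by simp [h] at hn
  refine ⟨Complex.arg ⟨a, b⟩, ⟨(Complex.neg_pi_lt_arg _).le, Complex.arg_le_pi _⟩, ?_, ?_⟩
  · rw [Complex.cos_arg h0, hn, div_one]
  · rw [Complex.sin_arg, hn, div_one]

theorem exists_polar (a b : ℝ) : ∃ t ∈ Set.Icc (-Real.pi) Real.pi,
    a = √(a ^ 2 + b ^ 2) * Real.cos t ∧ b = √(a ^ 2 + b ^ 2) * Real.sin t := by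
  rcases eq_or_ne (√(a ^ 2 + b ^ 2)) 0 with h | h
  · have h' := (Real.sqrt_eq_zero (by positivity)).1 h
    have ha : a = 0 := by nlinarith [sq_nonneg a, sq_nonneg b]
    have hb : b = 0 := by nlinarith [sq_nonneg a, sq_nonneg b]
    exact ⟨0, ⟨by linarith [Real.pi_pos], Real.pi_pos.le⟩, by simp [ha, hb], by simp [ha, hb]⟩
  · obtain ⟨t, ht, h1, h2⟩ := exists_cos_sin (a := a / √(a ^ 2 + b ^ 2))
      (b := b / √(a ^ 2 + b ^ 2)) (by
        have := Real.sq_sqrt (show 0 ≤ a ^ 2 + b ^ 2 by positivity)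
        field_simp
        linarith)
    refine ⟨t, ht, ?_, ?_⟩
    · rw [h1]; field_simp
    · rw [h2]; field_simp

theorem S2.coords (p : S2) : (p : E3) 0 ^ 2 + (p : E3) 1 ^ 2 + (p : E3) 2 ^ 2 = 1 / 4 := by
  rw [← norm_sq_E3, mem_sphere_zero_iff_norm.1 p.2]
  norm_num

/-- Multiplicity is harmless: the parametrization only serves to show that the total area is finite.
-/
theorem spherical_image :
    spherical '' (Set.Icc (-Real.pi) Real.pi ×ˢ Set.Icc (-Real.pi) Real.pi) = Set.univ := by
  refine Set.eq_univ_of_forall fun p => ?_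
  have hp := S2.coords p
  obtain ⟨s, hs, h1, h2⟩ := exists_polar ((p : E3) 1) ((p : E3) 2)
  have hr := Real.sq_sqrt (show 0 ≤ (p : E3) 1 ^ 2 + (p : E3) 2 ^ 2 by positivity)
  set r := √((p : E3) 1 ^ 2 + (p : E3) 2 ^ 2)
  obtain ⟨t, ht, h3, h4⟩ := exists_cos_sin (a := 2 * (p : E3) 0) (b := 2 * r) (by
    rw [mul_pow, mul_pow, hr]; linarith)
  refine ⟨(t, s), ⟨ht, hs⟩, ?_⟩
  apply Subtype.ext
  ext i
  fin_cases i
  · simp [spherical, h3]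
  · simp only [spherical, h4]
    simp
    linarith
  · simp only [spherical, h4]
    simp
    linarith

theorem hausdorffMeasure_S2_lt_top : (Measure.hausdorffMeasure 2 : Measure S2) Set.univ < ∞ := by
  rw [← spherical_image]
  refine (lipschitzWith_spherical.lipschitzOnWith.hausdorffMeasure_image_le
    (by norm_num : (0 : ℝ) ≤ 2)).trans_lt ?_
  rw [hausdorffMeasure_prod_real]
  refine ENNReal.mul_lt_top (by simp) ?_
  exact (isCompact_Icc.prod isCompact_Icc).measure_lt_top

/-- The projection along the axis does not increase distances and covers a square. Together with
finiteness this makes the normalization in `area` legitimate; the exact total area is never needed.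
-/
theorem hausdorffMeasure_S2_pos : 0 < (Measure.hausdorffMeasure 2 : Measure S2) Set.univ := by
  let f : S2 → ℝ × ℝ := fun p => ((p : E3) 1, (p : E3) 2)
  have hf : LipschitzWith 1 f := by
    refine LipschitzWith.of_dist_le_mul fun x y => ?_
    rw [NNReal.coe_one, one_mul, Prod.dist_eq, Subtype.dist_eq]
    exact max_le (PiLp.dist_apply_le _ _ 1) (PiLp.dist_apply_le _ _ 2)
  have himg : Set.Icc (-(1 / 4)) (1 / 4) ×ˢ Set.Icc (-(1 / 4)) (1 / 4) ⊆ f '' Set.univ := by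
    rintro ⟨a, b⟩ ⟨⟨ha1, ha2⟩, hb1, hb2⟩
    simp only at ha1 ha2 hb1 hb2
    refine ⟨⟨!₂[√(1 / 4 - a ^ 2 - b ^ 2), a, b], ?_⟩, Set.mem_univ _, by simp [f]⟩
    rw [mem_sphere_zero_iff_norm]
    refine (sq_eq_sq₀ (norm_nonneg _) (by norm_num)).1 ?_
    rw [norm_sq_E3]
    simp [-one_div]
    rw [Real.sq_sqrt (by nlinarith)]
    ring
  have h := hf.lipschitzOnWith.hausdorffMeasure_image_le (s := Set.univ)
    (by norm_num : (0 : ℝ) ≤ 2)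
  rw [hausdorffMeasure_prod_real] at h
  simp only [ENNReal.coe_one, ENNReal.one_rpow, one_mul] at h
  refine lt_of_lt_of_le ?_ ((measure_mono himg).trans h)
  rw [Measure.volume_eq_prod, Measure.prod_prod]
  simp

instance : IsProbabilityMeasure area :=
  ProbabilityTheory.cond_isProbabilityMeasure_of_finite hausdorffMeasure_S2_pos.ne'
    hausdorffMeasure_S2_lt_top.ne

/-- The action of a rotation on the sphere. -/
def rotateS2 (g : SO3) (p : S2) : S2 :=
  ⟨rotate g p, by rw [mem_sphere_zero_iff_norm, norm_rotate, ← mem_sphere_zero_iff_norm]; exact p.2⟩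

theorem isometry_rotate (g : SO3) : Isometry (rotate g) :=
  Isometry.of_dist_eq fun x y => by rw [dist_eq_norm, ← rotate_sub, norm_rotate, dist_eq_norm]

theorem rotate_inv_rotate (g : SO3) (x : E3) : rotate g⁻¹ (rotate g x) = x := by
  rw [← rotate_mul, inv_mul_cancel, rotate_one]

theorem rotate_rotate_inv (g : SO3) (x : E3) : rotate g (rotate g⁻¹ x) = x := by
  rw [← rotate_mul, mul_inv_cancel, rotate_one]

/-- A rotation as an isometry of the sphere. -/
def rotateS2Equiv (g : SO3) : S2 ≃ᵢ S2 where
  toFun := rotateS2 g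
  invFun := rotateS2 g⁻¹
  left_inv p := Subtype.ext (rotate_inv_rotate g p)
  right_inv p := Subtype.ext (rotate_rotate_inv g p)
  isometry_toFun := Isometry.of_dist_eq fun x y => (isometry_rotate g).dist_eq x y

theorem continuous_rotateS2 : Continuous fun a : SO3 × S2 => rotateS2 a.1 a.2 :=
  Continuous.subtype_mk (continuous_rotate.comp
    (continuous_fst.prodMk (continuous_subtype_val.comp continuous_snd))) _

theorem framePoint_mul (g h : SO3) : framePoint (g * h) = rotateS2 g (framePoint h) :=
  Subtype.ext (by simp [framePoint, rotateS2, rotate_mul, rotate_smul])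

theorem map_rotateS2_area (g : SO3) : area.map (rotateS2 g) = area := by
  have h : Measurable (rotateS2 g) := (rotateS2Equiv g).isometry.continuous.measurable
  rw [area, cond_univ_map h]
  congr 1
  exact (rotateS2Equiv g).map_hausdorffMeasure 2

/-- Hausdorff measure is preserved by isometries, and the rotation-invariant probability measure is
unique. -/
theorem area_eq_map_framePoint : area = haarSO3.map framePoint :=
  eq_map_haar_of_invariant continuous_rotateS2.measurable continuous_framePoint.measurable
    surjective_framePoint framePoint_mul _ map_rotateS2_area

/-! ### Liouville measure as the image of Haar measure -/

/-- The pole of the sphere on the first axis. -/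
def pole : S2 := framePoint 1

theorem pole_coe : (pole : E3) = (1 / 2 : ℝ) • e0 := by
  simp [pole, framePoint, rotate_one]

/-- The unit circle of the tangent plane at the pole. -/
def poleCircle (t : ℝ) : TangentCircle pole :=
  ⟨!₂[0, Real.cos t, Real.sin t], by
    constructor
    · refine (sq_eq_sq₀ (norm_nonneg _) (by norm_num)).1 ?_
      rw [norm_sq_E3]
      simp
    · simp [pole_coe, inner_E3, e0]⟩

theorem lipschitzWith_poleCircle : LipschitzWith 2 poleCircle := by
  refine LipschitzWith.of_dist_le_mul fun x y => ?_
  rw [Subtype.dist_eq]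
  refine dist_le_of_coords fun i => ?_
  rw [Real.dist_eq]
  fin_cases i
  · simp [poleCircle]
  · exact abs_cos_sub_cos_le x y
  · exact abs_sin_sub_sin_le x y

theorem poleCircle_image : poleCircle '' Set.Icc (-Real.pi) Real.pi = Set.univ := by
  refine Set.eq_univ_of_forall fun v => ?_
  have h1 : (v : E3) 0 ^ 2 + (v : E3) 1 ^ 2 + (v : E3) 2 ^ 2 = 1 := by
    rw [← norm_sq_E3, v.2.1]; norm_num
  have h2 : (v : E3) 0 = 0 := by
    have := v.2.2
    rw [inner_E3] at this
    simpa [pole_coe, e0] using this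
  obtain ⟨t, ht, h3, h4⟩ := exists_cos_sin (a := (v : E3) 1) (b := (v : E3) 2) (by
    rw [h2] at h1; linarith)
  refine ⟨t, ht, Subtype.ext ?_⟩
  ext i
  fin_cases i <;> simp [poleCircle, h2, h3, h4]

theorem hausdorffMeasure_poleCircle_lt_top :
    (Measure.hausdorffMeasure 1 : Measure (TangentCircle pole)) Set.univ < ∞ := by
  rw [← poleCircle_image]
  refine (lipschitzWith_poleCircle.lipschitzOnWith.hausdorffMeasure_image_le
    (by norm_num : (0 : ℝ) ≤ 1)).trans_lt ?_
  rw [hausdorffMeasure_real]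
  exact ENNReal.mul_lt_top (by simp) isCompact_Icc.measure_lt_top

theorem hausdorffMeasure_poleCircle_pos :
    0 < (Measure.hausdorffMeasure 1 : Measure (TangentCircle pole)) Set.univ := by
  let f : TangentCircle pole → ℝ := fun v => (v : E3) 1
  have hf : LipschitzWith 1 f := by
    refine LipschitzWith.of_dist_le_mul fun x y => ?_
    rw [NNReal.coe_one, one_mul, Subtype.dist_eq]
    exact PiLp.dist_apply_le _ _ 1
  have himg : Set.Icc (-1) 1 ⊆ f '' Set.univ := by
    rintro a ⟨ha1, ha2⟩
    exact ⟨poleCircle (Real.arccos a), Set.mem_univ _, by simp [f, poleCircle,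
      Real.cos_arccos ha1 ha2]⟩
  have h := hf.lipschitzOnWith.hausdorffMeasure_image_le (s := Set.univ)
    (by norm_num : (0 : ℝ) ≤ 1)
  rw [hausdorffMeasure_real] at h
  simp only [ENNReal.coe_one, ENNReal.one_rpow, one_mul] at h
  refine lt_of_lt_of_le ?_ ((measure_mono himg).trans h)
  simp

theorem continuous_tangentLine (p : S2) : Continuous (tangentLine p) :=
  continuous_mk.comp (Continuous.subtype_mk
    (continuous_const.prodMk continuous_subtype_val) _)

instance : IsProbabilityMeasure (fiberMeasure pole) := by
  have : IsProbabilityMeasure (ProbabilityTheory.cond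
      (Measure.hausdorffMeasure 1 : Measure (TangentCircle pole)) Set.univ) :=
    ProbabilityTheory.cond_isProbabilityMeasure_of_finite hausdorffMeasure_poleCircle_pos.ne'
      hausdorffMeasure_poleCircle_lt_top.ne
  exact Measure.isProbabilityMeasure_map (continuous_tangentLine pole).measurable.aemeasurable

/-- A rotation as an isometry between tangent circles. -/
def rotateCircle (g : SO3) (p : S2) : TangentCircle p ≃ᵢ TangentCircle (rotateS2 g p) where
  toFun v := ⟨rotate g v, by rw [norm_rotate]; exact v.2.1, by
    change inner ℝ (rotate g p) _ = 0
    rw [inner_rotate]; exact v.2.2⟩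
  invFun v := ⟨rotate g⁻¹ v, by rw [norm_rotate]; exact v.2.1, by
    rw [← rotate_inv_rotate g p, inner_rotate]; exact v.2.2⟩
  left_inv v := Subtype.ext (rotate_inv_rotate g v)
  right_inv v := Subtype.ext (rotate_rotate_inv g v)
  isometry_toFun := Isometry.of_dist_eq fun x y => (isometry_rotate g).dist_eq x y

theorem measurable_rotateSharp (g : SO3) : Measurable (rotateSharp g) :=
  (continuous_rotateSharp.comp (Continuous.prodMk_right g)).measurable

theorem measurable_rotateS2 (g : SO3) : Measurable (rotateS2 g) :=
  (rotateS2Equiv g).isometry.continuous.measurable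

/-- Rotations are isometries between tangent circles, so every fibre measure is a rotated copy of
the one at the pole. -/
theorem fiberMeasure_rotateS2 (g : SO3) (p : S2) :
    fiberMeasure (rotateS2 g p) = (fiberMeasure p).map (rotateSharp g) := by
  have hg := measurable_rotateSharp g
  have h1 := (continuous_tangentLine p).measurable
  have h2 := (continuous_tangentLine (rotateS2 g p)).measurable
  have h3 : Measurable (rotateCircle g p) := (rotateCircle g p).continuous.measurable
  have h4 : rotateSharp g ∘ tangentLine p = tangentLine (rotateS2 g p) ∘ rotateCircle g p := rfl
  rw [fiberMeasure, fiberMeasure, Measure.map_map hg h1, h4, ← Measure.map_map h2 h3,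
    cond_univ_map h3, (rotateCircle g p).map_hausdorffMeasure]

theorem fiberMeasure_framePoint (g : SO3) :
    fiberMeasure (framePoint g) = (fiberMeasure pole).map (rotateSharp g) := by
  rw [← fiberMeasure_rotateS2, pole, ← framePoint_mul, mul_one]

theorem measurable_map_rotateSharp (ρ : Measure PS2) [SFinite ρ] :
    Measurable fun g : SO3 => ρ.map (rotateSharp g) := by
  refine Measure.measurable_of_measurable_coe _ fun B hB => ?_
  have h : ∀ g : SO3, ρ.map (rotateSharp g) B =
      ρ (Prod.mk g ⁻¹' ((fun a : SO3 × PS2 => rotateSharp a.1 a.2) ⁻¹' B)) := fun g => by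
    rw [Measure.map_apply (measurable_rotateSharp g) hB]
    rfl
  simp_rw [h]
  exact measurable_measure_prodMk_left (continuous_rotateSharp.measurable hB)

/-- The horizontal field gives a Borel choice of a rotation taking the pole to `p`; a continuous
choice does not exist on the sphere. -/
theorem measurable_fiberMeasure : Measurable fiberMeasure := by
  have h : fiberMeasure = (fun g : SO3 => (fiberMeasure pole).map (rotateSharp g)) ∘
      fun p => frame (horizontalVector p) := by
    funext p
    simp only [Function.comp]
    rw [← fiberMeasure_framePoint, framePoint_horizontal]
  rw [h]
  exact (measurable_map_rotateSharp _).comp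
    (continuous_frame.measurable.comp measurable_horizontalVector)

theorem map_rotateSharp_haar_prod (ρ : Measure PS2) [IsProbabilityMeasure ρ] :
    (haarSO3.prod ρ).map (fun a => rotateSharp a.1 a.2) = haarSO3.map frameLine :=
  map_act_haar_prod continuous_rotateSharp.measurable continuous_frameLine.measurable
    surjective_frameLine frameLine_mul ρ

/-- Both sides are the law of a uniformly rotated random line over the pole. -/
theorem liouville_eq_map_frameLine : liouville = haarSO3.map frameLine := by
  rw [← map_rotateSharp_haar_prod (fiberMeasure pole)]
  ext B hB
  have hm : Measurable fun p => fiberMeasure p B := (Measure.measurable_coe hB).comp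
    measurable_fiberMeasure
  rw [liouville, Measure.bind_apply hB measurable_fiberMeasure.aemeasurable,
    area_eq_map_framePoint, lintegral_map hm continuous_framePoint.measurable,
    Measure.map_apply continuous_rotateSharp.measurable hB,
    Measure.prod_apply (continuous_rotateSharp.measurable hB)]
  refine lintegral_congr fun g => ?_
  rw [fiberMeasure_framePoint,
    Measure.map_apply (measurable_rotateSharp g) hB]
  rfl

instance : IsProbabilityMeasure liouville := by
  rw [liouville_eq_map_frameLine]
  exact Measure.isProbabilityMeasure_map continuous_frameLine.measurable.aemeasurable

/-! ### The twist map preserves area -/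

/-- The rotation by the angle `t` about the first axis. -/
def axisRotation (t : ℝ) : SO3 :=
  ⟨!![1, 0, 0; 0, Real.cos t, -Real.sin t; 0, Real.sin t, Real.cos t], by
    have h := Real.sin_sq_add_cos_sq t
    rw [Matrix.mem_specialOrthogonalGroup_iff, Matrix.mem_orthogonalGroup_iff']
    constructor
    · ext i j
      fin_cases i <;> fin_cases j <;>
        simp [Matrix.mul_apply, Fin.sum_univ_three, Matrix.transpose_apply] <;>
        linarith
    · rw [Matrix.det_fin_three]
      simp
      linarith⟩

theorem mat_axisRotation (t : ℝ) : mat (axisRotation t) =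
    !![1, 0, 0; 0, Real.cos t, -Real.sin t; 0, Real.sin t, Real.cos t] := rfl

theorem axisRotation_mul (s t : ℝ) : axisRotation s * axisRotation t = axisRotation (s + t) := by
  apply Subtype.ext
  change mat (axisRotation s) * mat (axisRotation t) = mat (axisRotation (s + t))
  simp only [mat_axisRotation, Real.cos_add, Real.sin_add]
  ext i j
  fin_cases i <;> fin_cases j <;> simp [Matrix.mul_apply, Fin.sum_univ_three] <;> ring

theorem axisRotation_periodic : Function.Periodic axisRotation (2 * Real.pi) := fun t => by
  apply Subtype.ext
  change mat (axisRotation _) = mat (axisRotation t)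
  simp [mat_axisRotation]

theorem continuous_axisRotation : Continuous axisRotation := by
  refine Continuous.subtype_mk (continuous_matrix fun i j => ?_) _
  fin_cases i <;> fin_cases j <;> simp <;> fun_prop

theorem twist_eq_rotate (ε : ℝ) (x : E3) :
    twist ε x = rotate (axisRotation (2 * Real.pi * (x 0 + 1 / 2) * ε)) x := by
  ext i
  rw [rotate_apply, mat_axisRotation]
  fin_cases i <;> simp [twist]
  ring

theorem rotate_axisRotation_zero (t : ℝ) (x : E3) : rotate (axisRotation t) x 0 = x 0 := by
  simp [rotate_apply, mat_axisRotation]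

/-- The twist map of the sphere. -/
def twistS2 (ε : ℝ) (p : S2) : S2 :=
  ⟨twist ε p, by rw [mem_sphere_zero_iff_norm, norm_twist, ← mem_sphere_zero_iff_norm]; exact p.2⟩

theorem continuous_twistS2 (ε : ℝ) : Continuous (twistS2 ε) :=
  Continuous.subtype_mk ((contDiff_twist ε).continuous.comp continuous_subtype_val) _

theorem framePoint_twistFrame (ε : ℝ) (g : SO3) :
    framePoint (twistFrame ε g) = twistS2 ε (framePoint g) :=
  Subtype.ext (framePoint_frame _)

/-- On each circle of latitude the twist is a rotation by a constant angle. Area is invariant under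
the axis rotations, so a function may first be averaged over these circles, and that average does
not see the twist. -/
theorem integral_comp_twistS2 (ε : ℝ) (F : S2 →ᵇ ℝ) :
    ∫ p, F (twistS2 ε p) ∂area = ∫ p, F p ∂area := by
  set I : Measure ℝ := volume.restrict (Set.Ioc 0 (2 * Real.pi)) with hI
  have hpi : (0 : ℝ) < 2 * Real.pi := by positivity
  have : IsFiniteMeasure I := by rw [hI]; infer_instance
  have hIuniv : I.real Set.univ = 2 * Real.pi := by
    simp [hI, hpi.le]
  have hmean : ∀ Φ : S2 → ℝ, Continuous Φ →
      (2 * Real.pi) * ∫ p, Φ p ∂area =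
        ∫ p, ∫ t, Φ (rotateS2 (axisRotation t) p) ∂I ∂area := by
    intro Φ hΦ
    have hcont : Continuous fun a : ℝ × S2 => Φ (rotateS2 (axisRotation a.1) a.2) :=
      hΦ.comp (continuous_rotateS2.comp
        ((continuous_axisRotation.comp continuous_fst).prodMk continuous_snd))
    obtain ⟨M, hM⟩ := isCompact_univ.exists_bound_of_continuousOn hΦ.continuousOn
    rw [integral_integral_swap]
    · have h : ∀ t, ∫ p, Φ (rotateS2 (axisRotation t) p) ∂area = ∫ p, Φ p ∂area := by
        intro t
        conv_rhs => rw [← map_rotateS2_area (axisRotation t)]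
        rw [integral_map (measurable_rotateS2 _).aemeasurable hΦ.aestronglyMeasurable]
      simp only [h, integral_const, hIuniv, smul_eq_mul]
    · refine Integrable.of_bound (C := M) ?_ (ae_of_all _ fun a => hM _ (Set.mem_univ _))
      exact (hcont.comp continuous_swap).aestronglyMeasurable
  have hshift : ∀ p : S2, ∫ t, F (twistS2 ε (rotateS2 (axisRotation t) p)) ∂I =
      ∫ t, F (rotateS2 (axisRotation t) p) ∂I := by
    intro p
    set α : ℝ := 2 * Real.pi * ((p : E3) 0 + 1 / 2) * ε
    have h1 : ∀ t, twistS2 ε (rotateS2 (axisRotation t) p) =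
        rotateS2 (axisRotation (t + α)) p := by
      intro t
      apply Subtype.ext
      change twist ε (rotate (axisRotation t) p) = rotate (axisRotation (t + α)) p
      rw [twist_eq_rotate, rotate_axisRotation_zero, add_comm t, ← axisRotation_mul, rotate_mul]
    simp only [h1]
    have hper : Function.Periodic (fun t => F (rotateS2 (axisRotation t) p)) (2 * Real.pi) :=
      fun t => by simp only [axisRotation_periodic t]
    rw [hI, ← intervalIntegral.integral_of_le hpi.le, ← intervalIntegral.integral_of_le hpi.le,
      intervalIntegral.integral_comp_add_right (fun t => F (rotateS2 (axisRotation t) p)) α,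
      zero_add, add_comm (2 * Real.pi)]
    rw [hper.intervalIntegral_add_eq α 0, zero_add]
  have h1 := hmean (fun p => F (twistS2 ε p)) (F.continuous.comp (continuous_twistS2 ε))
  have h2 := hmean F F.continuous
  simp only [hshift] at h1
  exact mul_left_cancel₀ hpi.ne' (h1.trans h2.symm)

theorem map_twistS2_area (ε : ℝ) : area.map (twistS2 ε) = area := by
  have hm := (continuous_twistS2 ε).measurable
  have : IsProbabilityMeasure (area.map (twistS2 ε)) :=
    Measure.isProbabilityMeasure_map hm.aemeasurable
  refine ext_of_forall_integral_eq_of_IsFiniteMeasure fun F => ?_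
  rw [integral_map hm.aemeasurable F.continuous.aestronglyMeasurable, integral_comp_twistS2]

/-! ### The distribution of a row of a random rotation -/

/-- A rotation as a linear isometry of `ℝ³`. -/
def rotateLinear (g : SO3) : E3 ≃ₗᵢ[ℝ] E3 where
  toFun := rotate g
  invFun := rotate g⁻¹
  left_inv := rotate_inv_rotate g
  right_inv := rotate_rotate_inv g
  map_add' x y := by simp [rotate, Matrix.mulVec_add]
  map_smul' c x := rotate_smul g c x
  norm_map' := norm_rotate g

/-- The first row of a rotation. -/
def firstRow (g : SO3) : E3 := rotate g⁻¹ e0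

theorem firstRow_apply (g : SO3) (i : Fin 3) : firstRow g i = mat g 0 i := by
  simp [firstRow, rotate_apply, e0, mat_inv]

theorem norm_firstRow (g : SO3) : ‖firstRow g‖ = 1 := by
  rw [firstRow, norm_rotate]
  simp [e0, EuclideanSpace.norm_eq, Fin.sum_univ_three]

theorem measurable_firstRow : Measurable firstRow :=
  (continuous_rotate.comp (continuous_inv.prodMk continuous_const)).measurable

/-- Polar coordinates: a uniform point of the unit ball has the direction of the first row of a
uniform rotation, independent of its length. -/
theorem lintegral_ball_firstRow {Θ : E3 → ℝ≥0∞} (hΘ : Measurable Θ) :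
    ∫⁻ x in Metric.ball (0 : E3) 1, ∫⁻ g, Θ (‖x‖ • firstRow g) ∂haarSO3 =
      ∫⁻ x in Metric.ball (0 : E3) 1, Θ x := by
  have h1 : ∀ x : E3, ∫⁻ g, Θ (‖x‖ • firstRow g) ∂haarSO3 =
      ∫⁻ g, Θ (rotate g⁻¹ x) ∂haarSO3 := by
    intro x
    obtain ⟨c, hc⟩ := exists_rotate_e0 x
    rw [← lintegral_mul_left_eq_self _ c⁻¹]
    refine lintegral_congr fun g => ?_
    congr 1
    conv_rhs => rw [hc]
    rw [rotate_smul, ← rotate_mul, firstRow, mul_inv_rev, inv_inv]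
  have hm : Measurable fun a : E3 × SO3 => Θ (rotate a.2⁻¹ a.1) :=
    hΘ.comp (continuous_rotate.comp ((continuous_inv.comp continuous_snd).prodMk
      continuous_fst)).measurable
  simp_rw [h1]
  rw [lintegral_lintegral_swap hm.aemeasurable]
  have h2 : ∀ g : SO3, ∫⁻ x in Metric.ball (0 : E3) 1, Θ (rotate g⁻¹ x) =
      ∫⁻ x in Metric.ball (0 : E3) 1, Θ x := by
    intro g
    have h := (rotateLinear g⁻¹).measurePreserving.setLIntegral_comp_preimage
      (s := Metric.ball (0 : E3) 1) measurableSet_ball hΘ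
    rw [LinearIsometryEquiv.preimage_ball, map_zero] at h
    exact h
  simp [h2]

/-- The singular weight `|x₁ x₂| ^ (-1/2)`. -/
def weight (x : E3) : ℝ≥0∞ := ENNReal.ofReal |x 1 * x 2| ^ (-(1 / 2) : ℝ)

theorem measurable_weight : Measurable weight := by
  unfold weight
  fun_prop

theorem rpow_neg_half_antitone {x y : ℝ≥0∞} (h : x ≤ y) :
    y ^ (-(1 / 2) : ℝ) ≤ x ^ (-(1 / 2) : ℝ) := by
  rw [ENNReal.rpow_neg, ENNReal.rpow_neg]
  exact ENNReal.inv_le_inv.2 (ENNReal.rpow_le_rpow h (by norm_num))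

/-- The ball lies in the cube [-1, 1]³, where the weight is a product of one-variable functions, and
|x|^(-1/2) is integrable near 0. -/
theorem lintegral_ball_weight_lt_top : ∫⁻ x in Metric.ball (0 : E3) 1, weight x < ∞ := by
  let f : Fin 3 → ℝ → ℝ := ![(Set.Icc (-1) 1).indicator 1,
    (Set.Icc (-1) 1).indicator fun x => |x| ^ (-(1 / 2) : ℝ),
    (Set.Icc (-1) 1).indicator fun x => |x| ^ (-(1 / 2) : ℝ)]
  have hpow : Integrable ((Set.Icc (-1) 1).indicator fun x : ℝ => |x| ^ (-(1 / 2) : ℝ)) := by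
    rw [integrable_indicator_iff measurableSet_Icc,
      ← intervalIntegrable_iff_integrableOn_Icc_of_le (by norm_num)]
    have h0 : IntervalIntegrable (fun x : ℝ => |x| ^ (-(1 / 2) : ℝ)) volume 0 1 := by
      refine (intervalIntegral.intervalIntegrable_rpow' (r := -(1 / 2)) (by norm_num)).congr ?_
      intro x hx
      rw [Set.uIoc_of_le zero_le_one] at hx
      simp only [abs_of_pos hx.1]
    have h1 : IntervalIntegrable (fun x : ℝ => |x| ^ (-(1 / 2) : ℝ)) volume (-1) 0 := by
      have := (IntervalIntegrable.iff_comp_neg (f := fun x : ℝ => |x| ^ (-(1 / 2) : ℝ))).1 h0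
      simpa using this.symm
    exact h1.trans h0
  have hf : ∀ i, Integrable (f i) volume := by
    intro i
    fin_cases i
    · change Integrable ((Set.Icc (-1 : ℝ) 1).indicator (1 : ℝ → ℝ)) volume
      rw [integrable_indicator_iff measurableSet_Icc]
      exact integrableOn_const isCompact_Icc.measure_lt_top.ne
    · exact hpow
    · exact hpow
  have hprod : Integrable (fun x : Fin 3 → ℝ => ∏ i, f i (x i)) := Integrable.fintype_prod hf
  have hcomp : Integrable (fun x : E3 => ∏ i, f i (x i)) :=
    (PiLp.volume_preserving_ofLp (Fin 3)).integrable_comp_of_integrable hprod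
  -- On the planes x₁ = 0 and x₂ = 0 the weight is `∞` while the real power is 0 by convention, so
  -- the comparison holds only almost everywhere.
  have hne : ∀ i : Fin 3, ∀ᵐ x : E3, x i ≠ 0 := by
    intro i
    have h := (PiLp.volume_preserving_ofLp (Fin 3)).quasiMeasurePreserving.ae
      (p := fun x : Fin 3 → ℝ => x i ≠ 0) ?_
    · exact h
    · rw [ae_iff]
      simpa [volume_pi] using Measure.pi_hyperplane (fun _ : Fin 3 => (volume : Measure ℝ)) i 0
  refine lt_of_le_of_lt ?_ hcomp.2
  rw [← lintegral_indicator measurableSet_ball]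
  refine lintegral_mono_ae ?_
  filter_upwards [hne 1, hne 2] with x h1 h2
  by_cases hx : x ∈ Metric.ball (0 : E3) 1
  · rw [Set.indicator_of_mem hx]
    have hmem : ∀ i, x i ∈ Set.Icc (-1 : ℝ) 1 := fun i => by
      have h := (PiLp.norm_apply_le x i).trans (mem_ball_zero_iff.1 hx).le
      rw [Real.norm_eq_abs] at h
      exact abs_le.1 h
    have hval : ∏ i, f i (x i) = |x 1 * x 2| ^ (-(1 / 2) : ℝ) := by
      rw [Fin.prod_univ_three]
      simp only [f, Matrix.cons_val_zero, Matrix.cons_val_one, Matrix.cons_val]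
      rw [Set.indicator_of_mem (hmem 0), Set.indicator_of_mem (hmem 1),
        Set.indicator_of_mem (hmem 2), Pi.one_apply, one_mul, abs_mul,
        Real.mul_rpow (abs_nonneg _) (abs_nonneg _)]
    rw [hval, Real.enorm_of_nonneg (by positivity), weight,
      ENNReal.ofReal_rpow_of_pos (abs_pos.2 (mul_ne_zero h1 h2))]
  · rw [Set.indicator_of_notMem hx]
    exact zero_le

/-- Shrinking a vector increases its weight. In polar coordinates, the integral over directions
times the volume of the ball is therefore at most the finite integral over the ball. -/
theorem lintegral_weight_firstRow_lt_top : ∫⁻ g, weight (firstRow g) ∂haarSO3 < ∞ := by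
  have hpos : volume (Metric.ball (0 : E3) 1) ≠ 0 := (Metric.measure_ball_pos _ _ one_pos).ne'
  have h : volume (Metric.ball (0 : E3) 1) * ∫⁻ g, weight (firstRow g) ∂haarSO3 ≤
      ∫⁻ x in Metric.ball (0 : E3) 1, weight x := by
    rw [← lintegral_ball_firstRow measurable_weight, mul_comm, ← setLIntegral_const]
    refine setLIntegral_mono' measurableSet_ball fun x hx => lintegral_mono fun g => ?_
    refine rpow_neg_half_antitone (ENNReal.ofReal_le_ofReal ?_)
    have hx1 : ‖x‖ < 1 := mem_ball_zero_iff.1 hx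
    have : (‖x‖ • firstRow g) 1 * (‖x‖ • firstRow g) 2 =
        ‖x‖ ^ 2 * (firstRow g 1 * firstRow g 2) := by
      simp
      ring
    rw [this, abs_mul, abs_of_nonneg (by positivity)]
    have h2 : ‖x‖ ^ 2 ≤ 1 := pow_le_one₀ (norm_nonneg _) hx1.le
    nlinarith [abs_nonneg (firstRow g 1 * firstRow g 2)]
  by_contra htop
  rw [not_lt, top_le_iff] at htop
  rw [htop, ENNReal.mul_top hpos] at h
  exact absurd (top_le_iff.1 h) lintegral_ball_weight_lt_top.ne

/-- Most of a small cap of the sphere of directions. -/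
theorem exists_cap_lower_bound : ∃ c : ℝ, 0 < c ∧ ∀ s : ℝ, 0 < s → s ≤ 1 →
    ENNReal.ofReal (c * s) ≤ haarSO3 {g | 1 - s ≤ mat g 0 0} := by
  set V := volume (Metric.ball (0 : E3) 1) with hV
  have hpos : 0 < V := Metric.measure_ball_pos _ _ one_pos
  have hfin : V ≠ ∞ := measure_ball_lt_top.ne
  refine ⟨(16 * V.toReal)⁻¹, by have := ENNReal.toReal_pos hpos.ne' hfin; positivity, ?_⟩
  intro s hs hs1
  -- The cone over the cap; positivity of x₀ excludes the origin.
  set A : Set E3 := {x | (1 - s) * ‖x‖ ≤ x 0 ∧ 0 < x 0} with hA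
  have hAm : MeasurableSet A := by
    refine MeasurableSet.inter (s₁ := {x : E3 | (1 - s) * ‖x‖ ≤ x 0}) (s₂ := {x : E3 | 0 < x 0})
      (measurableSet_le ?_ ?_) (measurableSet_lt measurable_const ?_) <;> fun_prop
  have hpolar := lintegral_ball_firstRow (Θ := A.indicator 1) (measurable_one.indicator hAm)
  have hle : ∫⁻ x in Metric.ball (0 : E3) 1, ∫⁻ g, A.indicator 1 (‖x‖ • firstRow g) ∂haarSO3 ≤
      haarSO3 {g | 1 - s ≤ mat g 0 0} * V := by
    rw [hV, ← setLIntegral_const]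
    refine setLIntegral_mono' measurableSet_ball fun x hx => ?_
    rw [← lintegral_indicator_one
      (measurableSet_le measurable_const (continuous_entry 0 0).measurable)]
    refine lintegral_mono fun g => ?_
    by_cases hg : ‖x‖ • firstRow g ∈ A
    · have hgm : g ∈ {g : SO3 | 1 - s ≤ mat g 0 0} := by
        obtain ⟨h1, h2⟩ := hg
        rw [norm_smul, norm_norm, norm_firstRow, mul_one] at h1
        have h3 : (‖x‖ • firstRow g) 0 = ‖x‖ * mat g 0 0 := by simp [firstRow_apply]
        rw [h3] at h1 h2
        have h4 : 0 < ‖x‖ := (norm_nonneg x).lt_of_ne fun h => by simp [← h] at h2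
        exact le_of_mul_le_mul_left (by linarith) h4
      rw [Set.indicator_of_mem hg, Set.indicator_of_mem hgm]
      rfl
    · rw [Set.indicator_of_notMem hg]
      exact zero_le
  -- This box has volume s/16 and lies in the ball and in the cone: on it x₁² + x₂² ≤ s/8 and x₀² ≥
  -- 1/4.
  let J : Fin 3 → Set ℝ := ![Set.Icc (1 / 2) (3 / 4), Set.Icc (-(√s / 4)) (√s / 4),
    Set.Icc (-(√s / 4)) (√s / 4)]
  have hbox : ENNReal.ofReal (s / 16) ≤ ∫⁻ x in Metric.ball (0 : E3) 1, A.indicator 1 x := by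
    have hvol : volume ((WithLp.ofLp : E3 → Fin 3 → ℝ) ⁻¹' Set.univ.pi J) =
        ENNReal.ofReal (s / 16) := by
      have hJ : ∀ i, MeasurableSet (J i) := fun i => by
        fin_cases i <;> exact measurableSet_Icc
      rw [(PiLp.volume_preserving_ofLp (Fin 3)).measure_preimage
        (MeasurableSet.univ_pi hJ).nullMeasurableSet, volume_pi_pi, Fin.prod_univ_three]
      simp only [J, Matrix.cons_val_zero, Matrix.cons_val_one, Matrix.cons_val, Real.volume_Icc]
      rw [← ENNReal.ofReal_mul (by norm_num), ← ENNReal.ofReal_mul (by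
        have := Real.sqrt_nonneg s
        nlinarith)]
      congr 1
      have := Real.mul_self_sqrt hs.le
      linear_combination (1 / 16 : ℝ) * this
    rw [lintegral_indicator_one hAm, ← hvol, Measure.restrict_apply hAm]
    refine measure_mono fun x hx => ?_
    have h0 : x 0 ∈ Set.Icc (1 / 2 : ℝ) (3 / 4) := hx 0 (Set.mem_univ _)
    have h1 : x 1 ∈ Set.Icc (-(√s / 4)) (√s / 4) := hx 1 (Set.mem_univ _)
    have h2 : x 2 ∈ Set.Icc (-(√s / 4)) (√s / 4) := hx 2 (Set.mem_univ _)
    have hss := Real.sq_sqrt hs.le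
    have h1' : x 1 ^ 2 ≤ s / 16 := by nlinarith [h1.1, h1.2]
    have h2' : x 2 ^ 2 ≤ s / 16 := by nlinarith [h2.1, h2.2]
    have hn := norm_sq_E3 x
    have hnn := norm_nonneg x
    refine ⟨⟨?_, by linarith [h0.1]⟩, ?_⟩
    · refine abs_le_of_sq_le_sq' ?_ (by linarith [h0.1]) |>.2
      have h3 : (1 - s) ^ 2 ≤ 1 - s := by nlinarith
      have h4 : 1 / 4 ≤ x 0 ^ 2 := by nlinarith [h0.1]
      calc ((1 - s) * ‖x‖) ^ 2 = (1 - s) ^ 2 * ‖x‖ ^ 2 := by ring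
        _ ≤ (1 - s) * ‖x‖ ^ 2 := mul_le_mul_of_nonneg_right h3 (by positivity)
        _ ≤ (1 - s) * (x 0 ^ 2 + s / 8) :=
            mul_le_mul_of_nonneg_left (by linarith) (by linarith)
        _ ≤ x 0 ^ 2 := by nlinarith
    · rw [mem_ball_zero_iff]
      refine abs_lt_of_sq_lt_sq' ?_ zero_le_one |>.2
      nlinarith [h0.1, h0.2]
  have hmain : ENNReal.ofReal (s / 16) ≤ haarSO3 {g | 1 - s ≤ mat g 0 0} * V :=
    hbox.trans (hpolar ▸ hle)
  rw [← ENNReal.div_le_iff hpos.ne' hfin] at hmain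
  refine le_trans (le_of_eq ?_) hmain
  rw [← ENNReal.ofReal_toReal hfin, ← ENNReal.ofReal_div_of_pos (ENNReal.toReal_pos hpos.ne' hfin),
    ENNReal.ofReal_toReal hfin]
  congr 1
  field_simp

/-! ### The distribution of the trace of a random rotation -/

theorem continuous_trace : Continuous fun g : SO3 => (mat g).trace :=
  continuous_mat.matrix_trace

theorem neg_one_le_entry (g : SO3) : 0 ≤ 1 + mat g 0 0 := by
  linarith [(abs_le.1 (abs_entry_le_one g 0 0)).1]

/-- The trace along the cosets of the group of rotations about the first axis. -/
theorem exists_trace_mul_axisRotation (g : SO3) : ∃ t ∈ Set.Icc (-Real.pi) Real.pi, ∀ s,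
    (mat (g * axisRotation s)).trace + 1 = (1 + mat g 0 0) * (1 + Real.cos (s - t)) := by
  obtain ⟨t, ht, h1, h2⟩ := exists_polar (mat g 1 1 + mat g 2 2) (mat g 1 2 - mat g 2 1)
  -- The amplitude of the sinusoid: the four squares add up to 1 + g₀₀² by orthonormality, and the
  -- cross terms to 2 g₀₀ by the cofactor identity.
  have hA : √((mat g 1 1 + mat g 2 2) ^ 2 + (mat g 1 2 - mat g 2 1) ^ 2) = 1 + mat g 0 0 := by
    rw [Real.sqrt_eq_iff_mul_self_eq (by positivity) (neg_one_le_entry g)]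
    have r1 := row_inner g 1 1
    have r2 := row_inner g 2 2
    have c0 := col_inner g 0 0
    have h := entry_zero_zero g
    simp only [if_true] at r1 r2 c0
    linear_combination r1 + r2 - c0 - 2 * h
  rw [hA] at h1 h2
  refine ⟨t, ht, fun s => ?_⟩
  rw [mat_mul, mat_axisRotation, Matrix.trace_fin_three]
  simp [Matrix.mul_apply, Fin.sum_univ_three]
  rw [Real.cos_sub]
  linear_combination Real.cos s * h1 + Real.sin s * h2

/-- Disintegration along the cosets of the axis rotations: right invariance and Fubini reduce Haar
measure to angles, where the trace is explicit. -/
theorem haar_mul_two_pi {S : Set SO3} (hS : MeasurableSet S) :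
    haarSO3 S * ENNReal.ofReal (2 * Real.pi) =
      ∫⁻ g, volume {s ∈ Set.Icc (-Real.pi) Real.pi | g * axisRotation s ∈ S} ∂haarSO3 := by
  set I : Measure ℝ := volume.restrict (Set.Icc (-Real.pi) Real.pi) with hI
  have hm : MeasurableSet {a : SO3 × ℝ | a.1 * axisRotation a.2 ∈ S} :=
    (continuous_fst.mul (continuous_axisRotation.comp continuous_snd)).measurable hS
  have h1 := Measure.prod_apply (μ := haarSO3) (ν := I) hm
  have h2 := Measure.prod_apply_symm (μ := haarSO3) (ν := I) hm
  have h3 : ∀ s : ℝ, haarSO3 ((fun g => (g, s)) ⁻¹' {a : SO3 × ℝ | a.1 * axisRotation a.2 ∈ S}) =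
      haarSO3 S := fun s => measure_preimage_mul_right haarSO3 (axisRotation s) S
  simp only [h3, lintegral_const] at h2
  have h4 : I Set.univ = ENNReal.ofReal (2 * Real.pi) := by
    rw [hI, Measure.restrict_apply_univ, Real.volume_Icc]
    congr 1
    ring
  rw [← h4, ← h2, h1]
  refine lintegral_congr fun g => ?_
  rw [hI, Measure.restrict_apply (measurable_prodMk_left hm)]
  congr 1
  ext s
  simp [and_comm]

/-- When sin x and sin y have the same sign, |cos x - cos y| ≥ 2 sin²((x - y)/2), and Jordan's
inequality bounds this below by 2 ((x - y)/π)². So the diameter is at most π√η; the square root is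
the price of the critical points of the cosine. -/
theorem volume_le_of_cos_close {P : Set ℝ} {d η : ℝ} (hπ : ∀ x ∈ P, ∀ y ∈ P, |x - y| ≤ Real.pi)
    (hs : ∀ x ∈ P, ∀ y ∈ P, 0 ≤ Real.sin x * Real.sin y) (hc : ∀ x ∈ P, |Real.cos x - d| ≤ η) :
    volume P ≤ ENNReal.ofReal (Real.pi * √η) := by
  refine (Real.volume_le_diam P).trans (Metric.ediam_le_of_forall_dist_le fun x hx y hy => ?_)
  have hpi := Real.pi_pos
  have h1 : |Real.cos x - Real.cos y| ≤ 2 * η := by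
    have : Real.cos x - Real.cos y = (Real.cos x - d) - (Real.cos y - d) := by ring
    rw [this]
    exact (abs_sub _ _).trans (by linarith [hc x hx, hc y hy])
  have h2 : Real.sin ((x - y) / 2) ^ 2 ≤ Real.sin ((x + y) / 2) ^ 2 := by
    have key : ∀ a b : ℝ, Real.sin (a + b) * Real.sin (a - b) =
        Real.sin a ^ 2 - Real.sin b ^ 2 := fun a b => by
      rw [Real.sin_add, Real.sin_sub]
      linear_combination Real.sin a ^ 2 * Real.sin_sq_add_cos_sq b -
        Real.sin b ^ 2 * Real.sin_sq_add_cos_sq a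
    have h := key ((x + y) / 2) ((x - y) / 2)
    rw [show (x + y) / 2 + (x - y) / 2 = x by ring, show (x + y) / 2 - (x - y) / 2 = y by ring] at h
    linarith [hs x hx y hy]
  have h3 : |Real.cos x - Real.cos y| =
      2 * (|Real.sin ((x + y) / 2)| * |Real.sin ((x - y) / 2)|) := by
    rw [Real.cos_sub_cos, abs_mul, abs_mul, abs_neg, abs_two]
    ring
  have h4 := Real.mul_abs_le_abs_sin (x := (x - y) / 2) (by
    rw [abs_div, abs_two]; linarith [hπ x hx y hy])
  have h5 := sq_le_sq.1 h2
  have h6 : (|x - y| / Real.pi) ^ 2 ≤ η := by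
    rw [abs_div, abs_two] at h4
    have h7 : |x - y| / Real.pi ≤ |Real.sin ((x - y) / 2)| := by
      refine le_trans (le_of_eq ?_) h4
      field_simp
    have h8 : 0 ≤ |x - y| / Real.pi := by positivity
    nlinarith [abs_nonneg (Real.sin ((x - y) / 2))]
  have h9 := Real.le_sqrt_of_sq_le h6
  rw [div_le_iff₀ hpi] at h9
  rw [Real.dist_eq]
  linarith

/-- The difference s - t ranges over [-2π, 2π], which splits into four intervals of length π on
which the sine keeps its sign. -/
theorem volume_cos_close_le {t d η : ℝ} (ht : t ∈ Set.Icc (-Real.pi) Real.pi) :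
    volume {s ∈ Set.Icc (-Real.pi) Real.pi | |Real.cos (s - t) - d| ≤ η} ≤
      ENNReal.ofReal (4 * Real.pi * √η) := by
  have hpi := Real.pi_pos
  let Q : ℝ → Set ℝ := fun k => {x ∈ Set.Icc k (k + Real.pi) | |Real.cos x - d| ≤ η}
  have hQ : ∀ k, (∀ x ∈ Q k, ∀ y ∈ Q k, 0 ≤ Real.sin x * Real.sin y) →
      volume (Q k) ≤ ENNReal.ofReal (Real.pi * √η) := fun k hk =>
    volume_le_of_cos_close (fun x hx y hy => abs_le.2
      ⟨by linarith [hx.1.1, hy.1.2], by linarith [hx.1.2, hy.1.1]⟩) hk fun x hx => hx.2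
  have hpos : ∀ x : ℝ, x ∈ Set.Icc 0 Real.pi → 0 ≤ Real.sin x := fun x hx =>
    Real.sin_nonneg_of_nonneg_of_le_pi hx.1 hx.2
  have q0 : volume (Q 0) ≤ ENNReal.ofReal (Real.pi * √η) := hQ _ fun x hx y hy =>
    mul_nonneg (hpos x ⟨hx.1.1, by linarith [hx.1.2]⟩) (hpos y ⟨hy.1.1, by linarith [hy.1.2]⟩)
  have q1 : volume (Q Real.pi) ≤ ENNReal.ofReal (Real.pi * √η) := hQ _ fun x hx y hy => by
    have h1 := hpos (x - Real.pi) ⟨by linarith [hx.1.1], by linarith [hx.1.2]⟩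
    have h2 := hpos (y - Real.pi) ⟨by linarith [hy.1.1], by linarith [hy.1.2]⟩
    rw [Real.sin_sub_pi] at h1 h2
    exact mul_nonneg_of_nonpos_of_nonpos (by linarith) (by linarith)
  have q2 : volume (Q (-Real.pi)) ≤ ENNReal.ofReal (Real.pi * √η) := hQ _ fun x hx y hy => by
    have h1 := hpos (x + Real.pi) ⟨by linarith [hx.1.1], by linarith [hx.1.2]⟩
    have h2 := hpos (y + Real.pi) ⟨by linarith [hy.1.1], by linarith [hy.1.2]⟩
    rw [Real.sin_add_pi] at h1 h2
    exact mul_nonneg_of_nonpos_of_nonpos (by linarith) (by linarith)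
  have q3 : volume (Q (-(2 * Real.pi))) ≤ ENNReal.ofReal (Real.pi * √η) := hQ _ fun x hx y hy => by
    have h1 := hpos (x + 2 * Real.pi) ⟨by linarith [hx.1.1], by linarith [hx.1.2]⟩
    have h2 := hpos (y + 2 * Real.pi) ⟨by linarith [hy.1.1], by linarith [hy.1.2]⟩
    rw [Real.sin_add_two_pi] at h1 h2
    exact mul_nonneg h1 h2
  have hsub : {s ∈ Set.Icc (-Real.pi) Real.pi | |Real.cos (s - t) - d| ≤ η} ⊆
      (fun s => s - t) ⁻¹' (Q 0 ∪ Q Real.pi ∪ Q (-Real.pi) ∪ Q (-(2 * Real.pi))) := by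
    rintro s ⟨hs, hc⟩
    simp only [Q, Set.mem_preimage, Set.mem_union, Set.mem_ofPred_eq, Set.mem_Icc, hc, and_true]
    have l1 : -(2 * Real.pi) ≤ s - t := by linarith [hs.1, ht.2]
    have l2 : s - t ≤ 2 * Real.pi := by linarith [hs.2, ht.1]
    rcases le_total 0 (s - t) with h | h
    · rcases le_total (s - t) Real.pi with h' | h'
      · exact Or.inl (Or.inl (Or.inl ⟨h, by linarith⟩))
      · exact Or.inl (Or.inl (Or.inr ⟨h', by linarith⟩))
    · rcases le_total (-Real.pi) (s - t) with h' | h'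
      · exact Or.inl (Or.inr ⟨h', by linarith⟩)
      · exact Or.inr ⟨l1, by linarith⟩
  refine (measure_mono hsub).trans ?_
  simp only [sub_eq_add_neg]
  rw [measure_preimage_add_right]
  calc volume (Q 0 ∪ Q Real.pi ∪ Q (-Real.pi) ∪ Q (-(2 * Real.pi)))
      ≤ volume (Q 0) + volume (Q Real.pi) + volume (Q (-Real.pi)) +
          volume (Q (-(2 * Real.pi))) :=
        (measure_union_le _ _).trans (add_le_add_left ((measure_union_le _ _).trans
          (add_le_add_left (measure_union_le _ _) _)) _)
    _ ≤ ENNReal.ofReal (Real.pi * √η) + ENNReal.ofReal (Real.pi * √η) +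
          ENNReal.ofReal (Real.pi * √η) + ENNReal.ofReal (Real.pi * √η) :=
        add_le_add (add_le_add (add_le_add q0 q1) q2) q3
    _ = ENNReal.ofReal (4 * Real.pi * √η) := by
        have h0 : 0 ≤ Real.pi * √η := by positivity
        rw [← ENNReal.ofReal_add h0 h0, ← ENNReal.ofReal_add (by positivity) h0,
          ← ENNReal.ofReal_add (by positivity) h0]
        congr 1
        ring

/-- By the arithmetic-geometric mean, |g₀₁ g₀₂| ≤ (1 - g₀₀²)/2 ≤ 1 + g₀₀. Hence the weight that
controls the twist also controls small amplitudes of the trace. -/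
theorem abs_mul_le_one_add_entry (g : SO3) : |mat g 0 1 * mat g 0 2| ≤ 1 + mat g 0 0 := by
  have h := row_inner g 0 0
  simp only [if_true] at h
  have h0 := abs_le.1 (abs_entry_le_one g 0 0)
  rw [abs_le]
  constructor <;> nlinarith [sq_nonneg (mat g 0 1 - mat g 0 2), sq_nonneg (mat g 0 1 + mat g 0 2)]

/-- The trace has amplitude `A ≥ w` along the coset, so a band of half-width t for the trace lies in
one of half-width t/w for the cosine. If w = 0 the weight is `∞` and nothing is claimed. -/
theorem volume_trace_close_le (g : SO3) (c : ℝ) {t : ℝ} (ht : 0 < t) :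
    volume {s ∈ Set.Icc (-Real.pi) Real.pi |
      g * axisRotation s ∈ {u : SO3 | |(mat u).trace - c| ≤ t}} ≤
      ENNReal.ofReal (4 * Real.pi * √t) * weight (firstRow g) := by
  have hpi := Real.pi_pos
  obtain ⟨r, hr, htr⟩ := exists_trace_mul_axisRotation g
  rw [weight, firstRow_apply, firstRow_apply]
  have hw0 := abs_nonneg (mat g 0 1 * mat g 0 2)
  have hle := abs_mul_le_one_add_entry g
  set w := |mat g 0 1 * mat g 0 2|
  set A := 1 + mat g 0 0
  rcases hw0.eq_or_lt with hw | hw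
  · rw [← hw, ENNReal.ofReal_zero, ENNReal.zero_rpow_of_neg (by norm_num), ENNReal.mul_top]
    · exact le_top
    · exact (ENNReal.ofReal_pos.2 (by positivity)).ne'
  have hA : 0 < A := hw.trans_le hle
  have hsub : {s ∈ Set.Icc (-Real.pi) Real.pi |
      g * axisRotation s ∈ {u : SO3 | |(mat u).trace - c| ≤ t}} ⊆
      {s ∈ Set.Icc (-Real.pi) Real.pi | |Real.cos (s - r) - ((c + 1) / A - 1)| ≤ t / w} := by
    rintro s ⟨hs, hc⟩
    refine ⟨hs, ?_⟩
    simp only [Set.mem_ofPred_eq] at hc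
    have e : Real.cos (s - r) - ((c + 1) / A - 1) =
        ((mat (g * axisRotation s)).trace - c) / A := by
      have := htr s
      field_simp
      linarith
    rw [e, abs_div, abs_of_pos hA]
    exact div_le_div₀ ht.le hc hw hle
  refine (measure_mono hsub).trans ((volume_cos_close_le hr).trans (le_of_eq ?_))
  rw [ENNReal.ofReal_rpow_of_pos hw, ← ENNReal.ofReal_mul (by positivity)]
  congr 1
  rw [Real.sqrt_div ht.le, Real.rpow_neg hw.le, ← Real.sqrt_eq_rpow]
  ring

/-- The law of the trace has no concentration. -/
theorem exists_trace_band_bound : ∃ C : ℝ, 0 < C ∧ ∀ c t : ℝ, 0 ≤ t →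
    haarSO3 {u | |(mat u).trace - c| ≤ t} ≤ ENNReal.ofReal (C * √t) := by
  have hpi := Real.pi_pos
  set K := ∫⁻ g, weight (firstRow g) ∂haarSO3 with hK
  have hKt : K ≠ ∞ := lintegral_weight_firstRow_lt_top.ne
  refine ⟨2 * K.toReal + 1, by positivity, fun c => ?_⟩
  have hpos : ∀ t : ℝ, 0 < t →
      haarSO3 {u | |(mat u).trace - c| ≤ t} ≤ ENNReal.ofReal ((2 * K.toReal + 1) * √t) := by
    intro t ht
    have hS : MeasurableSet {u : SO3 | |(mat u).trace - c| ≤ t} :=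
      measurableSet_le ((continuous_trace.sub continuous_const).abs).measurable measurable_const
    have h := haar_mul_two_pi hS
    have h2 : haarSO3 {u | |(mat u).trace - c| ≤ t} * ENNReal.ofReal (2 * Real.pi) ≤
        ENNReal.ofReal (4 * Real.pi * √t) * K := by
      rw [h, hK, ← lintegral_const_mul (f := fun g => weight (firstRow g)) _
        (measurable_weight.comp measurable_firstRow)]
      exact lintegral_mono fun g => volume_trace_close_le g c ht
    rw [← ENNReal.ofReal_toReal hKt, ← ENNReal.ofReal_mul (by positivity)] at h2
    rw [← ENNReal.le_div_iff_mul_le (Or.inl (ENNReal.ofReal_pos.2 (by positivity)).ne')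
      (Or.inl ENNReal.ofReal_ne_top), ← ENNReal.ofReal_div_of_pos (by positivity)] at h2
    refine h2.trans (ENNReal.ofReal_le_ofReal ?_)
    rw [div_le_iff₀ (by positivity)]
    have : 0 ≤ √t * Real.pi := by positivity
    nlinarith
  intro t ht
  -- The case t = 0 follows by letting t decrease to 0.
  rcases ht.eq_or_lt with rfl | ht
  · have hlim : Tendsto (fun t : ℝ => ENNReal.ofReal ((2 * K.toReal + 1) * √t)) (𝓝[>] 0)
        (𝓝 (ENNReal.ofReal ((2 * K.toReal + 1) * √0))) := by
      refine Tendsto.mono_left ?_ nhdsWithin_le_nhds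
      exact (ENNReal.continuous_ofReal.comp
        (continuous_const.mul Real.continuous_sqrt)).tendsto 0
    refine ge_of_tendsto hlim ?_
    filter_upwards [self_mem_nhdsWithin] with t ht
    exact (measure_mono fun u (hu : _ ≤ _) => hu.trans (Set.mem_Ioi.1 ht).le).trans (hpos t ht)
  · exact hpos t ht

/-! ### The balls of the rotation group -/

theorem rotationBall_eq_univ {δ : ℝ} (hδ : Real.pi < δ) : rotationBall δ = Set.univ :=
  Set.eq_univ_of_forall fun _ => (Real.arccos_le_pi _).trans_lt hδ

theorem mem_rotationBall_iff {δ : ℝ} (h0 : 0 < δ) (hδ : δ ≤ Real.pi) (g : SO3) :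
    g ∈ rotationBall δ ↔ 1 + 2 * Real.cos δ < (mat g).trace := by
  -- `Real.arccos` is constant outside [-1, 1], so the range of the trace is needed. The bound tr g
  -- ≥ -1 is the coset formula at angle 0.
  have h1 : ((mat g).trace - 1) / 2 ∈ Set.Icc (-1 : ℝ) 1 := by
    have hi := fun i => abs_le.1 (abs_entry_le_one g i i)
    obtain ⟨r, -, hr⟩ := exists_trace_mul_axisRotation g
    have h2 := hr 0
    have h3 : axisRotation 0 = 1 := by
      apply Subtype.ext
      change mat (axisRotation 0) = 1
      rw [mat_axisRotation, Matrix.one_fin_three]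
      simp
    rw [h3, mul_one] at h2
    have h4 : 0 ≤ (1 + mat g 0 0) * (1 + Real.cos (0 - r)) :=
      mul_nonneg (neg_one_le_entry g) (by linarith [Real.neg_one_le_cos (0 - r)])
    rw [Matrix.trace_fin_three] at *
    constructor
    · linarith
    · linarith [(hi 0).2, (hi 1).2, (hi 2).2]
  have h2 : Real.cos δ ∈ Set.Icc (-1 : ℝ) 1 := ⟨Real.neg_one_le_cos δ, Real.cos_le_one δ⟩
  have h3 := Real.strictAntiOn_arccos.lt_iff_gt h1 h2
  rw [Real.arccos_cos h0.le hδ] at h3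
  change Real.arccos _ < δ ↔ _
  rw [h3]
  constructor <;> intro h <;> linarith

theorem measurableSet_rotationBall (δ : ℝ) : MeasurableSet (rotationBall δ) :=
  measurableSet_lt (Real.continuous_arccos.comp
    ((continuous_trace.sub continuous_const).div_const _)).measurable measurable_const

/-- The ball contains a piece fibred over a cap of measure of order δ², with an arc of length of
order δ in each coset. -/
theorem exists_rotationBall_lower_bound : ∃ c : ℝ, 0 < c ∧ ∀ δ : ℝ, 0 < δ → δ ≤ Real.pi →
    c * δ ^ 3 ≤ haarSO3.real (rotationBall δ) := by
  have hpi := Real.pi_pos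
  have hpi2 : Real.pi ^ 2 < 10 := by nlinarith [Real.pi_lt_d2]
  obtain ⟨c, hc, hcap⟩ := exists_cap_lower_bound
  refine ⟨c / (160 * Real.pi), by positivity, fun δ h0 hδ => ?_⟩
  have hδ2 : δ ^ 2 ≤ Real.pi ^ 2 := pow_le_pow_left₀ h0.le hδ 2
  -- Then 4s < 4δ²/π² ≤ 2 - 2 cos δ, so (2 - s)² ≥ 4 - 4s exceeds 2 + 2 cos δ; also (δ/4)²/2 ≤ s.
  set s := δ ^ 2 / 20 with hs
  have hs0 : 0 < s := by positivity
  have hs1 : s ≤ 1 := by rw [hs]; linarith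
  have hcos : 4 * s < 2 - 2 * Real.cos δ := by
    have h := Real.cos_le_one_sub_mul_cos_sq (x := δ) (by rw [abs_of_pos h0]; exact hδ)
    have h1 : 1 / 10 * δ ^ 2 < 2 / Real.pi ^ 2 * δ ^ 2 := by
      refine mul_lt_mul_of_pos_right ?_ (by positivity)
      rw [div_lt_div_iff₀ (by norm_num) (by positivity)]
      linarith
    linarith
  have key : ∀ g : SO3, {g : SO3 | 1 - s ≤ mat g 0 0}.indicator
      (fun _ => ENNReal.ofReal (δ / 4)) g ≤
      volume {r ∈ Set.Icc (-Real.pi) Real.pi | g * axisRotation r ∈ rotationBall δ} := by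
    intro g
    by_cases hg : g ∈ {g : SO3 | 1 - s ≤ mat g 0 0}
    swap
    · rw [Set.indicator_of_notMem hg]; exact zero_le
    rw [Set.indicator_of_mem hg]
    obtain ⟨r, hr, htr⟩ := exists_trace_mul_axisRotation g
    have hin : ∀ x, |x - r| ≤ δ / 4 → g * axisRotation x ∈ rotationBall δ := by
      intro x hx
      rw [mem_rotationBall_iff h0 hδ]
      have h1 := htr x
      have h2 := Real.one_sub_sq_div_two_le_cos (x := x - r)
      have h3 : (x - r) ^ 2 ≤ (δ / 4) ^ 2 := by
        rw [← sq_abs]; exact pow_le_pow_left₀ (abs_nonneg _) hx 2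
      have h4 : 2 - s ≤ 1 + Real.cos (x - r) := by rw [hs] at *; nlinarith
      have h5 : 2 - s ≤ 1 + mat g 0 0 := by
        have : 1 - s ≤ mat g 0 0 := hg
        linarith
      have h6 : (2 - s) * (2 - s) ≤ (1 + mat g 0 0) * (1 + Real.cos (x - r)) :=
        mul_le_mul h5 h4 (by linarith) (by linarith)
      nlinarith
    -- Only the half of the window around `r` that points towards 0 is sure to stay in [-π, π];
    -- hence length δ/4.
    rcases le_total r 0 with h | h
    · calc ENNReal.ofReal (δ / 4) = volume (Set.Icc r (r + δ / 4)) := by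
            rw [Real.volume_Icc]; congr 1; ring
        _ ≤ volume {r ∈ Set.Icc (-Real.pi) Real.pi | g * axisRotation r ∈ rotationBall δ} :=
          measure_mono fun x hx => ⟨⟨hr.1.trans hx.1, by linarith [hx.2]⟩,
            hin x (abs_le.2 ⟨by linarith [hx.1], by linarith [hx.2]⟩)⟩
    · calc ENNReal.ofReal (δ / 4) = volume (Set.Icc (r - δ / 4) r) := by
            rw [Real.volume_Icc]; congr 1; ring
        _ ≤ volume {r ∈ Set.Icc (-Real.pi) Real.pi | g * axisRotation r ∈ rotationBall δ} :=
          measure_mono fun x hx => ⟨⟨by linarith [hx.1], hx.2.trans hr.2⟩,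
            hin x (abs_le.2 ⟨by linarith [hx.1], by linarith [hx.2]⟩)⟩
  have h1 : ENNReal.ofReal (δ / 4) * haarSO3 {g | 1 - s ≤ mat g 0 0} ≤
      haarSO3 (rotationBall δ) * ENNReal.ofReal (2 * Real.pi) := by
    rw [haar_mul_two_pi (measurableSet_rotationBall δ), ← lintegral_indicator_const
      (measurableSet_le measurable_const (continuous_entry 0 0).measurable)]
    exact lintegral_mono key
  have h2 : ENNReal.ofReal (δ / 4 * (c * s)) ≤
      ENNReal.ofReal (haarSO3.real (rotationBall δ) * (2 * Real.pi)) := by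
    rw [ENNReal.ofReal_mul (by positivity), ENNReal.ofReal_mul measureReal_nonneg,
      ofReal_measureReal]
    exact (mul_le_mul_right (hcap s hs0 hs1) _).trans h1
  rw [ENNReal.ofReal_le_ofReal_iff (by positivity)] at h2
  rw [div_mul_eq_mul_div, div_le_iff₀ (by positivity)]
  rw [hs] at h2
  nlinarith

theorem rotationBall_real_pos {δ : ℝ} (hδ : 0 < δ) : 0 < haarSO3.real (rotationBall δ) := by
  rcases le_or_gt δ Real.pi with h | h
  · obtain ⟨c, hc, hcb⟩ := exists_rotationBall_lower_bound
    exact lt_of_lt_of_le (by positivity) (hcb δ hδ h)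
  · rw [rotationBall_eq_univ h]
    simp

/-! ### The noise -/

instance (δ : ℝ) : IsZeroOrProbabilityMeasure (noise δ) :=
  inferInstanceAs (IsZeroOrProbabilityMeasure (ProbabilityTheory.cond _ _))

theorem haar_rotationBall_ne_zero {δ : ℝ} (hδ : 0 < δ) : haarSO3 (rotationBall δ) ≠ 0 := fun h =>
  (rotationBall_real_pos hδ).ne' (by simp [measureReal_def, h])

theorem isProbabilityMeasure_noise {δ : ℝ} (hδ : 0 < δ) : IsProbabilityMeasure (noise δ) :=
  ProbabilityTheory.cond_isProbabilityMeasure (haar_rotationBall_ne_zero hδ)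

/-- The `ℓ¹` distance of the matrices of two rotations. -/
def frameGap (x y : SO3) : ℝ := ∑ i, ∑ j, |mat x i j - mat y i j|

theorem frameGap_nonneg (x y : SO3) : 0 ≤ frameGap x y :=
  Finset.sum_nonneg fun _ _ => Finset.sum_nonneg fun _ _ => abs_nonneg _

theorem frameGap_self (x : SO3) : frameGap x x = 0 := by simp [frameGap]

theorem continuous_frameGap : Continuous fun a : SO3 × SO3 => frameGap a.1 a.2 := by
  refine continuous_finsetSum _ fun i _ => continuous_finsetSum _ fun j _ => ?_
  exact (((continuous_entry i j).comp continuous_fst).sub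
    ((continuous_entry i j).comp continuous_snd)).abs

/-- The trace of b (g z)⁻¹ is linear in the entries of z, with the entries of the rotation g⁻¹ b as
coefficients, all at most 1 in absolute value. -/
theorem abs_trace_sub_le (b g x y : SO3) :
    |(mat (b * (g * x)⁻¹)).trace - (mat (b * (g * y)⁻¹)).trace| ≤ frameGap x y := by
  have h : ∀ z : SO3, (mat (b * (g * z)⁻¹)).trace =
      ∑ i, ∑ j, mat (g⁻¹ * b) i j * mat z i j := by
    intro z
    rw [mul_inv_rev, ← mul_assoc, mat_mul, Matrix.trace_mul_comm, ← mat_mul, ← mul_assoc, mat_mul,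
      mat_inv z]
    simp [Matrix.trace, Matrix.mul_apply]
  rw [h, h, ← Finset.sum_sub_distrib]
  refine (Finset.abs_sum_le_sum_abs _ _).trans (Finset.sum_le_sum fun i _ => ?_)
  rw [← Finset.sum_sub_distrib]
  refine (Finset.abs_sum_le_sum_abs _ _).trans (Finset.sum_le_sum fun j _ => ?_)
  rw [← mul_sub, abs_mul]
  exact mul_le_of_le_one_left (abs_nonneg _) (abs_entry_le_one _ _ _)

/-- The substitution b = u x moves the dependence on `x` from `F` to the density. Smoothing
estimates then require no regularity of `F`. -/
theorem integral_noise_mul (δ : ℝ) (F : SO3 → ℝ) (x : SO3) :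
    ∫ u, F (u * x) ∂noise δ = (haarSO3.real (rotationBall δ))⁻¹ *
      ∫ b, (rotationBall δ).indicator 1 (b * x⁻¹) * F b ∂haarSO3 := by
  rw [noise, ProbabilityTheory.cond, integral_smul_measure, ENNReal.toReal_inv, smul_eq_mul,
    ← measureReal_def, ← integral_indicator (measurableSet_rotationBall δ),
    ← integral_mul_right_eq_self _ x⁻¹]
  congr 2
  funext b
  by_cases hb : b * x⁻¹ ∈ rotationBall δ <;> simp [hb]

/-- Rotations for which translates by `x` and `y` of the ball differ. -/
def ballDiff (δ : ℝ) (x y : SO3) : Set SO3 :=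
  {b | ¬(b * x⁻¹ ∈ rotationBall δ ↔ b * y⁻¹ ∈ rotationBall δ)}

theorem measurable_ball_indicator (δ : ℝ) (x : SO3) :
    Measurable fun b : SO3 => (rotationBall δ).indicator (1 : SO3 → ℝ) (b * x⁻¹) :=
  (measurable_one.indicator (measurableSet_rotationBall δ)).comp (measurable_mul_const x⁻¹)

theorem measurableSet_ballDiff (δ : ℝ) (x y : SO3) : MeasurableSet (ballDiff δ x y) := by
  have h : ∀ x : SO3, MeasurableSet {b | b * x⁻¹ ∈ rotationBall δ} := fun x =>
    (measurable_mul_const x⁻¹) (measurableSet_rotationBall δ)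
  exact ((h x).iff (h y)).compl

theorem abs_integral_noise_sub_le (δ : ℝ) {F : SO3 → ℝ} (hF : Measurable F) {M : ℝ}
    (hM : ∀ b, |F b| ≤ M) (x y : SO3) :
    |∫ u, F (u * x) ∂noise δ - ∫ u, F (u * y) ∂noise δ| ≤
      (haarSO3.real (rotationBall δ))⁻¹ * (M * haarSO3.real (ballDiff δ x y)) := by
  have hM0 : 0 ≤ M := (abs_nonneg _).trans (hM 1)
  have hint : ∀ z : SO3,
      Integrable (fun b => (rotationBall δ).indicator (1 : SO3 → ℝ) (b * z⁻¹) * F b) haarSO3 := by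
    intro z
    refine Integrable.of_bound ((measurable_ball_indicator δ z).mul hF).aestronglyMeasurable M
      (ae_of_all _ fun b => ?_)
    by_cases hb : b * z⁻¹ ∈ rotationBall δ <;> simp [hb, hM b, hM0]
  rw [integral_noise_mul, integral_noise_mul, ← mul_sub, abs_mul, abs_of_nonneg (by positivity),
    ← integral_sub (hint x) (hint y)]
  refine mul_le_mul_of_nonneg_left ?_ (by positivity)
  rw [← Real.norm_eq_abs]
  have hbd : ∫ b, (ballDiff δ x y).indicator (fun _ => M) b ∂haarSO3 =
      M * haarSO3.real (ballDiff δ x y) := by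
    rw [integral_indicator_const _ (measurableSet_ballDiff δ x y), smul_eq_mul, mul_comm]
  rw [← hbd]
  refine norm_integral_le_of_norm_le ((integrable_const M).indicator
    (measurableSet_ballDiff δ x y)) (ae_of_all _ fun b => ?_)
  by_cases h1 : b * x⁻¹ ∈ rotationBall δ <;> by_cases h2 : b * y⁻¹ ∈ rotationBall δ <;>
    simp [ballDiff, h1, h2, hM b, Set.indicator]

/-- If b lies in just one of the two translates, the traces for x and y lie on opposite sides of 1 +
2 cos δ and differ by at most the gap. So b lies in a band of that half-width, whose measure is of
order its square root. -/
theorem exists_ballDiff_bound : ∃ C : ℝ, 0 < C ∧ ∀ δ : ℝ, 0 < δ → ∀ g x y : SO3,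
    haarSO3.real (ballDiff δ (g * x) (g * y)) ≤ C * √(frameGap x y) := by
  obtain ⟨C, hC, hband⟩ := exists_trace_band_bound
  refine ⟨C, hC, fun δ hδ g x y => ?_⟩
  rcases le_or_gt δ Real.pi with h | h
  · have hsub : ballDiff δ (g * x) (g * y) ⊆
        (fun b => b * (g * x)⁻¹) ⁻¹'
          {u | |(mat u).trace - (1 + 2 * Real.cos δ)| ≤ frameGap x y} := by
      intro b hb
      have h1 := abs_le.1 (abs_trace_sub_le b g x y)
      simp only [ballDiff, Set.mem_ofPred_eq, mem_rotationBall_iff hδ h] at hb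
      simp only [Set.mem_preimage, Set.mem_ofPred_eq]
      rw [abs_le]
      by_cases h2 : 1 + 2 * Real.cos δ < (mat (b * (g * x)⁻¹)).trace
      · have h3 : ¬ 1 + 2 * Real.cos δ < (mat (b * (g * y)⁻¹)).trace := fun h3 =>
          hb ⟨fun _ => h3, fun _ => h2⟩
        constructor <;> linarith
      · have h3 : 1 + 2 * Real.cos δ < (mat (b * (g * y)⁻¹)).trace := by
          by_contra h3
          exact hb ⟨fun h => absurd h h2, fun h => absurd h h3⟩
        constructor <;> linarith
    have h1 := (measure_mono hsub).trans
      ((measure_preimage_mul_right haarSO3 (g * x)⁻¹ _).le.trans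
        (hband (1 + 2 * Real.cos δ) _ (frameGap_nonneg x y)))
    exact ENNReal.toReal_le_of_le_ofReal (by positivity) h1
  · have : ballDiff δ (g * x) (g * y) = ∅ := by
      simp [ballDiff, rotationBall_eq_univ h]
    rw [this, measureReal_empty]
    positivity

theorem noise_preimage_le (δ : ℝ) {B : Set SO3} (hB : MeasurableSet B) (x : SO3) :
    noise δ {u | u * x ∈ B} ≤ (haarSO3 (rotationBall δ))⁻¹ * haarSO3 B := by
  have hm : MeasurableSet {u : SO3 | u * x ∈ B} := (measurable_mul_const x) hB
  rw [noise, ProbabilityTheory.cond_apply (measurableSet_rotationBall δ)]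
  refine mul_le_mul_right ((measure_mono Set.inter_subset_right).trans ?_) _
  exact (measure_preimage_mul_right haarSO3 x B).le

/-! ### A mean ergodic theorem -/

/-- Averages of the iterates of a contraction converge if they stay in a compact set. -/
theorem exists_tendsto_birkhoffAverage {E : Type*} [NormedAddCommGroup E] [NormedSpace ℝ E]
    (T : E →L[ℝ] E) (hT : ∀ x, ‖T x‖ ≤ ‖x‖) (x : E) {K : Set E} (hK : IsCompact K)
    (hx : ∀ n, birkhoffAverage ℝ T _root_.id n x ∈ K) :
    ∃ y, T y = y ∧ Tendsto (fun n => birkhoffAverage ℝ T _root_.id n x) atTop (𝓝 y) := by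
  have hlip : LipschitzWith 1 T := LipschitzWith.of_dist_le_mul fun a b => by
    rw [dist_eq_norm, ← map_sub, NNReal.coe_one, one_mul, dist_eq_norm]
    exact hT _
  have hiter : ∀ (k : ℕ) (z : E), ‖T^[k] z‖ ≤ ‖z‖ := by
    intro k z
    induction k with
    | zero => simp
    | succ k ih => rw [Function.iterate_succ_apply']; exact (hT _).trans ih
  have hsub : ∀ (n : ℕ) (a b : E), birkhoffAverage ℝ T _root_.id n (a - b) =
      birkhoffAverage ℝ T _root_.id n a - birkhoffAverage ℝ T _root_.id n b := by
    intro n a b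
    simp only [birkhoffAverage, birkhoffSum, id_eq, ← smul_sub, ← Finset.sum_sub_distrib]
    congr 1
    exact Finset.sum_congr rfl fun k _ => iterate_map_sub T k a b
  have hmap : ∀ (n : ℕ) (z : E), T (birkhoffAverage ℝ T _root_.id n z) =
      birkhoffAverage ℝ T _root_.id n (T z) := by
    intro n z
    simp only [birkhoffAverage, birkhoffSum, id_eq, map_smul, map_sum]
    congr 1
    refine Finset.sum_congr rfl fun k _ => ?_
    rw [← Function.iterate_succ_apply' T, Function.iterate_succ_apply]
  have hzero : ∀ z : E, Tendsto (fun n => birkhoffAverage ℝ T _root_.id n (T z) -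
      birkhoffAverage ℝ T _root_.id n z) atTop (𝓝 0) := by
    intro z
    refine tendsto_birkhoffAverage_apply_sub_birkhoffAverage ℝ ?_
    rw [isBounded_iff_forall_norm_le]
    refine ⟨‖z‖, ?_⟩
    rintro _ ⟨k, rfl⟩
    exact hiter k z
  -- Compactness serves only to find a cluster point, which is invariant.
  obtain ⟨y, -, φ, hφ, hy⟩ := hK.tendsto_subseq hx
  have hTy : T y = y := by
    have h1 : Tendsto (fun n => T (birkhoffAverage ℝ T _root_.id (φ n) x) -
        birkhoffAverage ℝ T _root_.id (φ n) x) atTop (𝓝 (T y - y)) :=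
      ((T.continuous.tendsto y).comp hy).sub hy
    simp only [hmap] at h1
    exact sub_eq_zero.1 (tendsto_nhds_unique h1 ((hzero x).comp hφ.tendsto_atTop))
  refine ⟨y, hTy, ?_⟩
  -- The averages tend to 0 on `R` by telescoping, and on its closure because `T` is a contraction.
  -- Since `y - x` lies in that closure and the averages of `y` tend to `y`, the whole sequence
  -- converges to `y`.
  let R : Submodule ℝ E := LinearMap.range (T.toLinearMap - LinearMap.id)
  have hR : ∀ z, T z - z ∈ R := fun z => ⟨z, rfl⟩
  have hRk : ∀ k : ℕ, T^[k] x - x ∈ R := by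
    intro k
    induction k with
    | zero => simp
    | succ k ih =>
      rw [Function.iterate_succ_apply']
      have := R.add_mem (hR (T^[k] x)) ih
      rwa [sub_add_sub_cancel] at this
  have hAR : ∀ n : ℕ, n ≠ 0 → birkhoffAverage ℝ T _root_.id n x - x ∈ R := by
    intro n hn
    have hn' : (n : ℝ) ≠ 0 := Nat.cast_ne_zero.2 hn
    have h : birkhoffAverage ℝ T _root_.id n x - x =
        (n : ℝ)⁻¹ • ∑ k ∈ Finset.range n, (T^[k] x - x) := by
      rw [Finset.sum_sub_distrib, smul_sub, Finset.sum_const, Finset.card_range,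
        ← Nat.cast_smul_eq_nsmul ℝ, smul_smul, inv_mul_cancel₀ hn', one_smul]
      rfl
    rw [h]
    exact R.smul_mem _ (R.sum_mem fun k _ => hRk k)
  have hcl : y - x ∈ closure (R : Set E) := by
    refine mem_closure_of_tendsto (hy.sub_const x) ?_
    filter_upwards [eventually_gt_atTop 0] with n hn
    exact hAR _ (hn.trans_le (hφ.id_le n)).ne'
  have hS : IsClosed {z : E | Tendsto (birkhoffAverage ℝ T _root_.id · z) atTop (𝓝 0)} :=
    isClosed_setOfPred_tendsto_birkhoffAverage ℝ hlip uniformContinuous_id continuous_const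
  have hRS : (R : Set E) ⊆ {z : E | Tendsto (birkhoffAverage ℝ T _root_.id · z) atTop (𝓝 0)} := by
    rintro _ ⟨z, rfl⟩
    have h := hzero z
    simp only [← hsub] at h
    exact h
  have h1 : Tendsto (birkhoffAverage ℝ T _root_.id · (y - x)) atTop (𝓝 0) :=
    closure_minimal hRS hS hcl
  have h2 : Tendsto (birkhoffAverage ℝ T _root_.id · y) atTop (𝓝 y) :=
    Function.IsFixedPt.tendsto_birkhoffAverage ℝ hTy _root_.id
  have h3 := h2.sub h1
  simp only [hsub, sub_sub_cancel, sub_zero] at h3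
  exact h3

/-! ### The process on frames -/

/-- One step of the diffused process on frames. -/
def stepFrame (ε δ : ℝ) (g : SO3) (κ : Measure SO3) : Measure SO3 :=
  ((noise δ).prod κ).map fun a => a.1 * (g * twistFrame ε a.2)

theorem continuous_stepMap (ε : ℝ) (g : SO3) :
    Continuous fun a : SO3 × SO3 => a.1 * (g * twistFrame ε a.2) :=
  continuous_fst.mul (continuous_const.mul ((continuous_twistFrame ε).comp continuous_snd))

theorem isProbabilityMeasure_stepFrame (ε : ℝ) {δ : ℝ} (hδ : 0 < δ) (g : SO3) (κ : Measure SO3)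
    [IsProbabilityMeasure κ] : IsProbabilityMeasure (stepFrame ε δ g κ) := by
  have := isProbabilityMeasure_noise hδ
  exact Measure.isProbabilityMeasure_map (continuous_stepMap ε g).measurable.aemeasurable

/-- `frameLine` intertwines left multiplication and `twistFrame` with the actions on lines, so the
process can be studied on the group. -/
theorem step_map_frameLine (ε δ : ℝ) (g : SO3) (κ : Measure SO3) [SFinite κ] :
    step ε δ g (κ.map frameLine) = (stepFrame ε δ g κ).map frameLine := by
  have hq := continuous_frameLine.measurable
  have hm : Measurable fun a : SO3 × PS2 =>
      rotateSharp a.1 (rotateSharp g (twistSharp ε a.2)) :=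
    (continuous_rotateSharp.comp (continuous_fst.prodMk ((continuous_rotateSharp.comp
      (Continuous.prodMk_right g)).comp
        ((continuous_twistSharp ε).comp continuous_snd)))).measurable
  have hprod : (noise δ).prod (κ.map frameLine) =
      ((noise δ).prod κ).map (Prod.map id frameLine) := by
    rw [← Measure.map_prod_map _ _ measurable_id hq, Measure.map_id]
  rw [step, hprod, Measure.map_map hm (measurable_id.prodMap hq), stepFrame,
    Measure.map_map hq (continuous_stepMap ε g).measurable]
  congr 1
  funext a
  simp [frameLine_mul, frameLine_twistFrame]

theorem isProbabilityMeasure_iterate_stepFrame (ε : ℝ) {δ : ℝ} (hδ : 0 < δ) (g : SO3) (k : ℕ) :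
    IsProbabilityMeasure ((stepFrame ε δ g)^[k] haarSO3) := by
  induction k with
  | zero => exact inferInstanceAs (IsProbabilityMeasure haarSO3)
  | succ k ih =>
    rw [Function.iterate_succ_apply']
    exact isProbabilityMeasure_stepFrame ε hδ g _

theorem iterate_step_liouville (ε : ℝ) {δ : ℝ} (hδ : 0 < δ) (g : SO3) (k : ℕ) :
    (step ε δ g)^[k] liouville = ((stepFrame ε δ g)^[k] haarSO3).map frameLine := by
  induction k with
  | zero => exact liouville_eq_map_frameLine
  | succ k ih =>
    have := isProbabilityMeasure_iterate_stepFrame ε hδ g k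
    rw [Function.iterate_succ_apply', Function.iterate_succ_apply', ih, step_map_frameLine]

/-- Cesàro averages of the process on frames. -/
def cesaroFrame (ε δ : ℝ) (g : SO3) (n : ℕ) : Measure SO3 :=
  (n : ℝ≥0∞)⁻¹ • ∑ k ∈ Finset.Icc 1 n, (stepFrame ε δ g)^[k] haarSO3

theorem cesaro_eq_map (ε : ℝ) {δ : ℝ} (hδ : 0 < δ) (g : SO3) (n : ℕ) :
    cesaro ε δ g n = (cesaroFrame ε δ g n).map frameLine := by
  ext B hB
  rw [Measure.map_apply continuous_frameLine.measurable hB]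
  simp only [cesaro, cesaroFrame, Measure.smul_apply, Measure.finsetSum_apply,
    iterate_step_liouville ε hδ, Measure.map_apply continuous_frameLine.measurable hB]

theorem isProbabilityMeasure_cesaroFrame (ε : ℝ) {δ : ℝ} (hδ : 0 < δ) (g : SO3) {n : ℕ}
    (hn : n ≠ 0) : IsProbabilityMeasure (cesaroFrame ε δ g n) := by
  have h := isProbabilityMeasure_iterate_stepFrame ε hδ g
  constructor
  simp only [cesaroFrame, Measure.smul_apply, Measure.finsetSum_apply, measure_univ,
    Finset.sum_const, Nat.card_Icc, add_tsub_cancel_right, smul_eq_mul, nsmul_eq_mul, mul_one]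
  exact ENNReal.inv_mul_cancel (Nat.cast_ne_zero.2 hn) (ENNReal.natCast_ne_top n)

theorem continuous_integral_noise (ε δ : ℝ) (g : SO3) (F : SO3 →ᵇ ℝ) :
    Continuous fun a => ∫ u, F (u * (g * twistFrame ε a)) ∂noise δ := by
  refine continuous_of_dominated (bound := fun _ => ‖F‖) (fun a => ?_)
    (fun a => ae_of_all _ fun u => F.norm_coe_le_norm _) (integrable_const _)
    (ae_of_all _ fun u => ?_)
  · exact (F.continuous.comp (continuous_mul_const _)).aestronglyMeasurable
  · exact F.continuous.comp ((continuous_stepMap ε g).comp (Continuous.prodMk_right u))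

theorem norm_integral_noise_le (ε δ : ℝ) (g : SO3) (F : SO3 →ᵇ ℝ) (a : SO3) :
    ‖∫ u, F (u * (g * twistFrame ε a)) ∂noise δ‖ ≤ ‖F‖ := by
  refine (norm_integral_le_of_norm_le_const (ae_of_all _ fun u => F.norm_coe_le_norm _)).trans ?_
  exact mul_le_of_le_one_right (norm_nonneg _) measureReal_le_one

/-- The Markov operator of the process on continuous functions of frames. -/
def diffuse (ε δ : ℝ) (g : SO3) : (SO3 →ᵇ ℝ) →L[ℝ] (SO3 →ᵇ ℝ) :=
  LinearMap.mkContinuous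
    { toFun := fun F => BoundedContinuousFunction.ofNormedAddCommGroup
        (fun a => ∫ u, F (u * (g * twistFrame ε a)) ∂noise δ)
        (continuous_integral_noise ε δ g F) ‖F‖ (norm_integral_noise_le ε δ g F)
      map_add' := fun F H => by
        ext a
        have hint : ∀ F : SO3 →ᵇ ℝ,
            Integrable (fun u => F (u * (g * twistFrame ε a))) (noise δ) := fun F =>
          Integrable.of_bound (F.continuous.comp (continuous_mul_const _)).aestronglyMeasurable ‖F‖
            (ae_of_all _ fun u => F.norm_coe_le_norm _)
        exact integral_add (hint F) (hint H)
      map_smul' := fun c F => by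
        ext a
        exact integral_const_mul c _ } 1 fun F => by
    rw [one_mul]
    exact BoundedContinuousFunction.norm_ofNormedAddCommGroup_le _ (norm_nonneg _)
      (norm_integral_noise_le ε δ g F)

theorem diffuse_apply (ε δ : ℝ) (g : SO3) (F : SO3 →ᵇ ℝ) (a : SO3) :
    diffuse ε δ g F a = ∫ u, F (u * (g * twistFrame ε a)) ∂noise δ := rfl

theorem norm_diffuse_le (ε δ : ℝ) (g : SO3) (F : SO3 →ᵇ ℝ) : ‖diffuse ε δ g F‖ ≤ ‖F‖ :=
  BoundedContinuousFunction.norm_ofNormedAddCommGroup_le _ (norm_nonneg _)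
      (norm_integral_noise_le ε δ g F)

theorem integral_stepFrame (ε δ : ℝ) (g : SO3) (κ : Measure SO3) [IsFiniteMeasure κ]
    (F : SO3 →ᵇ ℝ) : ∫ a, F a ∂stepFrame ε δ g κ = ∫ a, diffuse ε δ g F a ∂κ := by
  have hc := continuous_stepMap ε g
  rw [stepFrame, integral_map hc.measurable.aemeasurable F.continuous.aestronglyMeasurable,
    integral_prod_symm]
  · rfl
  · exact Integrable.of_bound (F.continuous.comp hc).aestronglyMeasurable ‖F‖
      (ae_of_all _ fun u => F.norm_coe_le_norm _)

theorem integral_iterate_stepFrame (ε : ℝ) {δ : ℝ} (hδ : 0 < δ) (g : SO3) (k : ℕ) (F : SO3 →ᵇ ℝ) :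
    ∫ a, F a ∂(stepFrame ε δ g)^[k] haarSO3 = ∫ a, (diffuse ε δ g)^[k] F a ∂haarSO3 := by
  induction k generalizing F with
  | zero => rfl
  | succ k ih =>
    have := isProbabilityMeasure_iterate_stepFrame ε hδ g k
    rw [Function.iterate_succ_apply', integral_stepFrame, ih, Function.iterate_succ_apply]

theorem integral_cesaroFrame (ε : ℝ) {δ : ℝ} (hδ : 0 < δ) (g : SO3) (n : ℕ) (F : SO3 →ᵇ ℝ) :
    ∫ a, F a ∂cesaroFrame ε δ g n =
      (n : ℝ)⁻¹ * ∑ k ∈ Finset.Icc 1 n, ∫ a, (diffuse ε δ g)^[k] F a ∂haarSO3 := by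
  have h := isProbabilityMeasure_iterate_stepFrame ε hδ g
  rw [cesaroFrame, integral_smul_measure, integral_finsetSum_measure fun k _ =>
    F.integrable _]
  simp only [integral_iterate_stepFrame ε hδ, smul_eq_mul, ENNReal.toReal_inv,
    ENNReal.toReal_natCast]

/-- The Cesàro sum starts at 1 and the Birkhoff sum at 0. Starting from `diffuse ε δ g F` absorbs
the shift and keeps the averages in the relatively compact image of a ball. -/
theorem integral_cesaroFrame_eq_birkhoffAverage (ε : ℝ) {δ : ℝ} (hδ : 0 < δ) (g : SO3) (n : ℕ)
    (F : SO3 →ᵇ ℝ) : ∫ a, F a ∂cesaroFrame ε δ g n =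
      ∫ a, birkhoffAverage ℝ (diffuse ε δ g) _root_.id n (diffuse ε δ g F) a ∂haarSO3 := by
  rw [integral_cesaroFrame ε hδ]
  have h : ∀ a, birkhoffAverage ℝ (diffuse ε δ g) _root_.id n (diffuse ε δ g F) a =
      (n : ℝ)⁻¹ * ∑ k ∈ Finset.Icc 1 n, (diffuse ε δ g)^[k] F a := by
    intro a
    rw [birkhoffAverage, BoundedContinuousFunction.coe_smul]
    simp only [smul_eq_mul, birkhoffSum, BoundedContinuousFunction.coe_sum, Finset.sum_apply]
    rw [Finset.range_eq_Ico, ← Finset.Ico_succ_right_eq_Icc]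
    rw [Finset.sum_Ico_eq_sum_range, Finset.sum_Ico_eq_sum_range]
    rw [Nat.sub_zero, Order.succ_eq_add_one, Nat.add_sub_cancel]
    simp only [id_eq, add_comm 1, Function.iterate_succ_apply, zero_add]
  simp only [h]
  rw [integral_const_mul, integral_finsetSum _ fun k _ => BoundedContinuousFunction.integrable _ _]

/-- Diffusion turns bounded families into equicontinuous ones. -/
theorem isCompact_closure_diffuse (ε : ℝ) {δ : ℝ} (hδ : 0 < δ) (g : SO3) (M : ℝ) :
    IsCompact (closure (diffuse ε δ g '' {F | ‖F‖ ≤ M})) := by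
  obtain ⟨C, hC, hdiff⟩ := exists_ballDiff_bound
  refine BoundedContinuousFunction.arzela_ascoli (Set.Icc (-M) M) isCompact_Icc _ ?_ ?_
  · rintro _ a ⟨F, hF, rfl⟩
    have h := ((diffuse ε δ g F).norm_coe_le_norm a).trans
      ((norm_diffuse_le ε δ g F).trans hF)
    rw [Real.norm_eq_abs] at h
    exact abs_le.1 h
  · intro a
    rw [Metric.equicontinuousAt_iff_right]
    intro r hr
    set c : ℝ := (haarSO3.real (rotationBall δ))⁻¹ with hc
    have hc0 : 0 ≤ c := inv_nonneg.2 measureReal_nonneg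
    have hcont : Continuous fun b => √(frameGap (twistFrame ε a) (twistFrame ε b)) := by
      have h : Continuous fun b => (twistFrame ε a, twistFrame ε b) :=
        continuous_const.prodMk (continuous_twistFrame ε)
      exact (continuous_frameGap.comp h).sqrt
    have hlim : Tendsto (fun b => c * (M * (C * √(frameGap (twistFrame ε a) (twistFrame ε b)))))
        (𝓝 a) (𝓝 (c * (M * (C * √(frameGap (twistFrame ε a) (twistFrame ε a)))))) :=
      (((hcont.tendsto a).const_mul C).const_mul M).const_mul c
    rw [frameGap_self, Real.sqrt_zero, mul_zero, mul_zero, mul_zero] at hlim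
    filter_upwards [hlim.eventually (gt_mem_nhds hr)] with b hb
    rintro ⟨_, F, hF, rfl⟩
    refine lt_of_le_of_lt ?_ hb
    have hM : 0 ≤ M := (norm_nonneg F).trans hF
    rw [Real.dist_eq]
    -- The modulus of continuity depends on `F` only through `M`, which gives equicontinuity.
    have h1 := abs_integral_noise_sub_le δ F.continuous.measurable (M := M)
      (fun x => (F.norm_coe_le_norm x).trans hF) (g * twistFrame ε a) (g * twistFrame ε b)
    exact h1.trans (mul_le_mul_of_nonneg_left
      (mul_le_mul_of_nonneg_left (hdiff δ hδ g _ _) hM) hc0)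

theorem exists_tendsto_average_diffuse (ε : ℝ) {δ : ℝ} (hδ : 0 < δ) (g : SO3) (F : SO3 →ᵇ ℝ) :
    ∃ H, diffuse ε δ g H = H ∧ Tendsto (fun n =>
      birkhoffAverage ℝ (diffuse ε δ g) _root_.id n (diffuse ε δ g F)) atTop (𝓝 H) := by
  refine exists_tendsto_birkhoffAverage _ (norm_diffuse_le ε δ g) _
    (isCompact_closure_diffuse ε hδ g ‖F‖) fun n => subset_closure ?_
  refine ⟨birkhoffAverage ℝ (diffuse ε δ g) _root_.id n F, ?_, ?_⟩
  · have hiter : ∀ k : ℕ, ‖(diffuse ε δ g)^[k] F‖ ≤ ‖F‖ := by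
      intro k
      induction k with
      | zero => simp
      | succ k ih => rw [Function.iterate_succ_apply']; exact (norm_diffuse_le ε δ g _).trans ih
    simp only [Set.mem_ofPred_eq, birkhoffAverage, birkhoffSum, norm_smul, norm_inv,
      RCLike.norm_natCast, id_eq]
    refine inv_mul_le_of_le_mul₀ (Nat.cast_nonneg n) (norm_nonneg _) ?_
    refine (norm_sum_le _ _).trans ((Finset.sum_le_sum fun k _ => hiter k).trans ?_)
    simp
  · simp only [birkhoffAverage, birkhoffSum, id_eq, map_smul, map_sum]
    congr 1
    refine Finset.sum_congr rfl fun k _ => ?_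
    rw [← Function.iterate_succ_apply' (diffuse ε δ g), Function.iterate_succ_apply]

theorem continuous_integral_haar : Continuous fun F : SO3 →ᵇ ℝ => ∫ a, F a ∂haarSO3 := by
  refine (LipschitzWith.of_dist_le_mul (K := 1) fun F H => ?_).continuous
  rw [dist_eq_norm, ← integral_sub (F.integrable _) (H.integrable _), NNReal.coe_one, one_mul,
    dist_eq_norm]
  refine (norm_integral_le_of_norm_le_const (C := ‖F - H‖)
    (ae_of_all _ fun u => (F - H).norm_coe_le_norm u)).trans ?_
  simp

/-- The Cesàro averages on frames converge to a stationary measure. -/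
theorem exists_frame_limit (ε : ℝ) {δ : ℝ} (hδ : 0 < δ) (g : SO3) : ∃ κ : Measure SO3,
    IsProbabilityMeasure κ ∧ stepFrame ε δ g κ = κ ∧ ∀ F : SO3 →ᵇ ℝ,
      Tendsto (fun n => ∫ a, F a ∂cesaroFrame ε δ g n) atTop (𝓝 (∫ a, F a ∂κ)) := by
  choose H hH hlim using exists_tendsto_average_diffuse ε hδ g
  have hconv : ∀ F : SO3 →ᵇ ℝ, Tendsto (fun n => ∫ a, F a ∂cesaroFrame ε δ g n) atTop
      (𝓝 (∫ a, H F a ∂haarSO3)) := by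
    intro F
    simp only [integral_cesaroFrame_eq_birkhoffAverage ε hδ]
    exact (continuous_integral_haar.tendsto _).comp (hlim F)
  -- The index is shifted because the average with n = 0 is the zero measure. Weak compactness of
  -- the probability measures then represents the limit functional by a measure.
  let P : ℕ → ProbabilityMeasure SO3 := fun n =>
    ⟨cesaroFrame ε δ g (n + 1), isProbabilityMeasure_cesaroFrame ε hδ g n.succ_ne_zero⟩
  obtain ⟨κ, hκ⟩ : ∃ κ, MapClusterPt κ atTop P := exists_clusterPt_of_compactSpace _
  have hint : ∀ F : SO3 →ᵇ ℝ, ∫ a, F a ∂(κ : Measure SO3) = ∫ a, H F a ∂haarSO3 := by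
    intro F
    have h1 : MapClusterPt (∫ a, F a ∂(κ : Measure SO3)) atTop
        (fun n => ∫ a, F a ∂(P n : Measure SO3)) :=
      hκ.continuousAt_comp
        (ProbabilityMeasure.continuous_integral_boundedContinuousFunction F).continuousAt
    have h2 : Tendsto (fun n => ∫ a, F a ∂(P n : Measure SO3)) atTop
        (𝓝 (∫ a, H F a ∂haarSO3)) := (hconv F).comp (tendsto_add_atTop_nat 1)
    exact eq_of_nhds_neBot (h1.neBot.mono (inf_le_inf_left _ h2))
  refine ⟨κ, inferInstance, ?_, fun F => by rw [hint]; exact hconv F⟩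
  have := isProbabilityMeasure_stepFrame ε hδ g (κ : Measure SO3)
  refine ext_of_forall_integral_eq_of_IsFiniteMeasure fun F => ?_
  rw [integral_stepFrame, hint, hint]
  congr 1
  -- The operator commutes with its averages and fixes `H F`, so `F` and `diffuse ε δ g F` have the
  -- same limit; this is stationarity.
  have h1 := ((diffuse ε δ g).continuous.tendsto _).comp (hlim F)
  have h2 : (diffuse ε δ g) ∘ (fun n =>
      birkhoffAverage ℝ (diffuse ε δ g) _root_.id n (diffuse ε δ g F)) = fun n =>
      birkhoffAverage ℝ (diffuse ε δ g) _root_.id n (diffuse ε δ g (diffuse ε δ g F)) := by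
    funext n
    simp only [Function.comp, birkhoffAverage, birkhoffSum, id_eq, map_smul, map_sum]
    congr 1
    refine Finset.sum_congr rfl fun k _ => ?_
    rw [← Function.iterate_succ_apply' (diffuse ε δ g), Function.iterate_succ_apply]
  rw [h2, hH F] at h1
  rw [tendsto_nhds_unique (hlim (diffuse ε δ g F)) h1]

/-! ### The stationary measures -/

theorem stepFrame_apply (ε δ : ℝ) (g : SO3) (κ : Measure SO3) [SFinite κ] {B : Set SO3}
    (hB : MeasurableSet B) : stepFrame ε δ g κ B =
      ∫⁻ a, noise δ {u | u * (g * twistFrame ε a) ∈ B} ∂κ := by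
  have hm := (continuous_stepMap ε g).measurable
  rw [stepFrame, Measure.map_apply hm hB, Measure.prod_apply_symm (hm hB)]
  rfl

/-- Whatever the starting law, one step of noise has density at most 1/|U|. A stationary law
inherits the bound, hence absolute continuity. -/
theorem stepFrame_le (ε δ : ℝ) (g : SO3) (κ : Measure SO3) [IsProbabilityMeasure κ] :
    stepFrame ε δ g κ ≤ (haarSO3 (rotationBall δ))⁻¹ • haarSO3 := by
  refine Measure.le_iff.2 fun B hB => ?_
  rw [stepFrame_apply ε δ g κ hB, Measure.smul_apply, smul_eq_mul]
  refine (lintegral_mono fun a => noise_preimage_le δ hB _).trans ?_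
  simp

/-- For each fixed `u` the map on base points is a rotation after the twist, and both preserve area.
-/
theorem map_framePoint_stepFrame (ε : ℝ) {δ : ℝ} (hδ : 0 < δ) (g : SO3) {κ : Measure SO3}
    [IsProbabilityMeasure κ] (hκ : κ.map framePoint = area) :
    (stepFrame ε δ g κ).map framePoint = area := by
  have := isProbabilityMeasure_noise hδ
  have hm := (continuous_stepMap ε g).measurable
  have hp := continuous_framePoint.measurable
  ext B hB
  rw [Measure.map_apply hp hB, stepFrame, Measure.map_apply hm (hp hB),
    Measure.prod_apply (hm (hp hB))]
  have h : ∀ u : SO3, κ (Prod.mk u ⁻¹' ((fun a : SO3 × SO3 => a.1 * (g * twistFrame ε a.2)) ⁻¹'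
      (framePoint ⁻¹' B))) = area B := by
    intro u
    have h1 : Prod.mk u ⁻¹' ((fun a : SO3 × SO3 => a.1 * (g * twistFrame ε a.2)) ⁻¹'
        (framePoint ⁻¹' B)) = framePoint ⁻¹' (twistS2 ε ⁻¹' (rotateS2 (u * g) ⁻¹' B)) := by
      ext a
      simp only [Set.mem_preimage, ← mul_assoc, framePoint_mul, framePoint_twistFrame]
    have h2 := measurable_rotateS2 (u * g)
    have h3 := (continuous_twistS2 ε).measurable
    rw [h1, ← Measure.map_apply hp (h3 (h2 hB)), hκ, ← Measure.map_apply h3 (h2 hB),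
      map_twistS2_area, ← Measure.map_apply h2 hB, map_rotateS2_area]
  simp [h]

theorem map_framePoint_cesaroFrame (ε : ℝ) {δ : ℝ} (hδ : 0 < δ) (g : SO3) {n : ℕ} (hn : n ≠ 0) :
    (cesaroFrame ε δ g n).map framePoint = area := by
  have hiter : ∀ k : ℕ, ((stepFrame ε δ g)^[k] haarSO3).map framePoint = area := by
    intro k
    induction k with
    | zero => exact area_eq_map_framePoint.symm
    | succ k ih =>
      have := isProbabilityMeasure_iterate_stepFrame ε hδ g k
      rw [Function.iterate_succ_apply']
      exact map_framePoint_stepFrame ε hδ g ih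
  have hp := continuous_framePoint.measurable
  ext B hB
  have h : ∀ k : ℕ, (stepFrame ε δ g)^[k] haarSO3 (framePoint ⁻¹' B) = area B := fun k => by
    rw [← Measure.map_apply hp hB, hiter]
  rw [Measure.map_apply hp hB]
  simp only [cesaroFrame, Measure.smul_apply, Measure.finsetSum_apply, h,
    Finset.sum_const, Nat.card_Icc, add_tsub_cancel_right, smul_eq_mul, nsmul_eq_mul]
  rw [← mul_assoc, ENNReal.inv_mul_cancel (Nat.cast_ne_zero.2 hn) (ENNReal.natCast_ne_top n),
    one_mul]

/-- The limit of the Cesàro averages on frames. -/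
def frameLimit (ε : ℝ) {δ : ℝ} (hδ : 0 < δ) (g : SO3) : Measure SO3 :=
  (exists_frame_limit ε hδ g).choose

section

variable (ε : ℝ) {δ : ℝ} (hδ : 0 < δ) (g : SO3)

instance isProbabilityMeasure_frameLimit : IsProbabilityMeasure (frameLimit ε hδ g) :=
  (exists_frame_limit ε hδ g).choose_spec.1

theorem stepFrame_frameLimit : stepFrame ε δ g (frameLimit ε hδ g) = frameLimit ε hδ g :=
  (exists_frame_limit ε hδ g).choose_spec.2.1

theorem tendsto_cesaroFrame (F : SO3 →ᵇ ℝ) :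
    Tendsto (fun n => ∫ a, F a ∂cesaroFrame ε δ g n) atTop (𝓝 (∫ a, F a ∂frameLimit ε hδ g)) :=
  (exists_frame_limit ε hδ g).choose_spec.2.2 F

theorem frameLimit_le : frameLimit ε hδ g ≤ (haarSO3 (rotationBall δ))⁻¹ • haarSO3 := by
  have := stepFrame_le ε δ g (frameLimit ε hδ g)
  rwa [stepFrame_frameLimit] at this

theorem frameLimit_absolutelyContinuous : frameLimit ε hδ g ≪ haarSO3 :=
  (Measure.absolutelyContinuous_of_le (frameLimit_le ε hδ g)).trans
    Measure.smul_absolutelyContinuous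

theorem map_framePoint_frameLimit : (frameLimit ε hδ g).map framePoint = area := by
  have hp := continuous_framePoint.measurable
  have : IsProbabilityMeasure ((frameLimit ε hδ g).map framePoint) :=
    Measure.isProbabilityMeasure_map hp.aemeasurable
  refine ext_of_forall_integral_eq_of_IsFiniteMeasure fun F => ?_
  rw [integral_map hp.aemeasurable F.continuous.aestronglyMeasurable]
  refine tendsto_nhds_unique
    (tendsto_cesaroFrame ε hδ g (F.compContinuous ⟨framePoint, continuous_framePoint⟩)) ?_
  refine tendsto_const_nhds.congr' ?_
  filter_upwards [eventually_ne_atTop 0] with n hn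
  rw [← map_framePoint_cesaroFrame ε hδ g hn,
    integral_map hp.aemeasurable F.continuous.aestronglyMeasurable]
  rfl

theorem isCesaroLimit_map_frameLimit :
    IsCesaroLimit ε δ g ((frameLimit ε hδ g).map frameLine) := by
  have hq := continuous_frameLine.measurable
  refine ⟨Measure.isProbabilityMeasure_map hq.aemeasurable, fun F => ?_⟩
  have h := tendsto_cesaroFrame ε hδ g (F.compContinuous ⟨frameLine, continuous_frameLine⟩)
  simp only [cesaro_eq_map ε hδ,
    integral_map hq.aemeasurable F.continuous.aestronglyMeasurable]
  exact h

/-- Weak limits are unique, so the choice in the definition must agree with the constructed limit.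
-/
theorem diffusedMeasure_eq : diffusedMeasure ε δ g = (frameLimit ε hδ g).map frameLine := by
  have hlim := isCesaroLimit_map_frameLimit ε hδ g
  have hex : ∃ κ, IsCesaroLimit ε δ g κ := ⟨_, hlim⟩
  have h : diffusedMeasure ε δ g = hex.choose := by
    unfold diffusedMeasure
    rw [dif_pos hex]
  rw [h]
  have h1 := hex.choose_spec
  have := h1.1
  have := hlim.1
  exact ext_of_forall_integral_eq_of_IsFiniteMeasure fun F =>
    tendsto_nhds_unique (h1.2 F) (hlim.2 F)

end

theorem isDiffusedStationary (ε : ℝ) {δ : ℝ} (hδ : 0 < δ) (g : SO3) :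
    IsDiffusedStationary ε δ g (diffusedMeasure ε δ g) := by
  rw [diffusedMeasure_eq ε hδ]
  have hq := continuous_frameLine.measurable
  refine ⟨Measure.isProbabilityMeasure_map hq.aemeasurable, ?_, ?_, ?_⟩
  · rw [step_map_frameLine, stepFrame_frameLimit]
  · rw [liouville_eq_map_frameLine]
    exact (frameLimit_absolutelyContinuous ε hδ g).map hq
  · rw [Measure.map_map continuous_proj.measurable hq]
    exact map_framePoint_frameLimit ε hδ g

/-! ### Measurable dependence on the rotation -/

/-- Closed sets form a generating π-system, and their indicators are limits of bounded continuous
functions. -/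
theorem measurable_of_forall_measurable_integral {X Y : Type*} [MeasurableSpace X]
    [TopologicalSpace Y] [HasOuterApproxClosed Y] [MeasurableSpace Y] [BorelSpace Y]
    {κ : X → Measure Y} [∀ x, IsProbabilityMeasure (κ x)]
    (h : ∀ F : Y →ᵇ ℝ, Measurable fun x => ∫ y, F y ∂κ x) : Measurable κ := by
  refine Measurable.measure_of_isPiSystem_of_isProbabilityMeasure
    (S := {s | IsClosed s}) (by rw [‹BorelSpace Y›.measurable_eq, borel_eq_generateFrom_isClosed])
    isPiSystem_isClosed fun s hs => ?_
  refine measurable_of_tendsto_metrizable (f := fun n x => ∫⁻ y, IsClosed.apprSeq hs n y ∂κ x)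
    (fun n => ?_) (tendsto_pi_nhds.2 fun x =>
      HasOuterApproxClosed.tendsto_lintegral_apprSeq hs (κ x))
  have hF := h ((IsClosed.apprSeq hs n).comp _ (NNReal.isometry_coe).lipschitz)
  convert hF.ennreal_ofReal using 2 with x
  rw [← ENNReal.ofReal_toReal
      (BoundedContinuousFunction.lintegral_lt_top_of_nnreal (κ x) (IsClosed.apprSeq hs n)).ne,
    BoundedContinuousFunction.toReal_lintegral_coe_eq_integral]
  rfl

theorem measurable_integral_iterate_diffuse (ε δ : ℝ) (F : SO3 →ᵇ ℝ) (k : ℕ) :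
    Measurable fun g => ∫ a, (diffuse ε δ g)^[k] F a ∂haarSO3 := by
  have h : StronglyMeasurable fun a : SO3 × SO3 => (diffuse ε δ a.1)^[k] F a.2 := by
    induction k with
    | zero => exact (F.continuous.comp continuous_snd).stronglyMeasurable
    | succ k ih =>
      simp only [Function.iterate_succ_apply', diffuse_apply]
      have hm : Measurable fun b : (SO3 × SO3) × SO3 =>
          (b.1.1, b.2 * (b.1.1 * twistFrame ε b.1.2)) := by
        refine Continuous.measurable ?_
        have := continuous_twistFrame ε
        fun_prop
      exact (ih.comp_measurable hm).integral_prod_right'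
  exact h.integral_prod_right'.measurable

/-- The limit is chosen separately for each `g`, but its integrals are limits of Cesàro integrals
measurable in `g`. This gives the average over `g` its meaning. -/
theorem measurable_frameLimit (ε : ℝ) {δ : ℝ} (hδ : 0 < δ) : Measurable (frameLimit ε hδ) := by
  refine measurable_of_forall_measurable_integral fun F => ?_
  refine measurable_of_tendsto_metrizable (f := fun n g => ∫ a, F a ∂cesaroFrame ε δ g n)
    (fun n => ?_) (tendsto_pi_nhds.2 fun g => tendsto_cesaroFrame ε hδ g F)
  simp only [integral_cesaroFrame ε hδ]
  exact (Finset.measurable_fun_sum _ fun k _ =>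
    measurable_integral_iterate_diffuse ε δ F k).const_mul _

theorem averagedMeasure_apply (ε : ℝ) {δ : ℝ} (hδ : 0 < δ) {B : Set PS2} (hB : MeasurableSet B) :
    averagedMeasure ε δ B = ∫⁻ g, frameLimit ε hδ g (frameLine ⁻¹' B) ∂haarSO3 := by
  have hq := continuous_frameLine.measurable
  have hm : Measurable (diffusedMeasure ε δ) := by
    have : diffusedMeasure ε δ = fun g => (frameLimit ε hδ g).map frameLine := by
      funext g
      exact diffusedMeasure_eq ε hδ g
    rw [this]
    exact (Measure.measurable_map _ hq).comp (measurable_frameLimit ε hδ)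
  rw [averagedMeasure, Measure.bind_apply hB hm.aemeasurable]
  simp only [diffusedMeasure_eq ε hδ, Measure.map_apply hq hB]

theorem isProbabilityMeasure_averagedMeasure (ε : ℝ) {δ : ℝ} (hδ : 0 < δ) :
    IsProbabilityMeasure (averagedMeasure ε δ) := by
  constructor
  rw [averagedMeasure_apply ε hδ MeasurableSet.univ]
  simp

theorem averagedMeasure_absolutelyContinuous (ε : ℝ) {δ : ℝ} (hδ : 0 < δ) :
    averagedMeasure ε δ ≪ liouville := by
  have hq := continuous_frameLine.measurable
  refine Measure.AbsolutelyContinuous.mk fun B hB h0 => ?_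
  rw [liouville_eq_map_frameLine, Measure.map_apply hq hB] at h0
  rw [averagedMeasure_apply ε hδ hB]
  simp [frameLimit_absolutelyContinuous ε hδ _ h0]

/-! ### The twist map makes tangent lines horizontal -/

/-- The rotation angle depends only on the axis coordinate; differentiating it adds a multiple of
the generator of axis rotations at `p`. The derivative is a shear followed by a rotation. -/
theorem fderiv_twist_apply (ε : ℝ) (p v : E3) : fderiv ℝ (twist ε) p v =
    rotate (axisRotation (2 * Real.pi * (p 0 + 1 / 2) * ε))
      (v + (2 * Real.pi * ε * v 0) • !₂[0, -p 2, p 1]) := by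
  have h1 : HasDerivAt (fun t : ℝ => twist ε (p + t • v)) (fderiv ℝ (twist ε) p v) 0 := by
    have hl : HasDerivAt (fun t : ℝ => p + t • v) v 0 := by
      simpa using ((hasDerivAt_id (0 : ℝ)).smul_const v).const_add p
    have hd : HasFDerivAt (twist ε) (fderiv ℝ (twist ε) p) (p + (0 : ℝ) • v) := by
      simpa using (differentiable_twist ε p).hasFDerivAt
    exact hd.comp_hasDerivAt 0 hl
  have hα : HasDerivAt (fun t : ℝ => 2 * Real.pi * (p 0 + t * v 0 + 1 / 2) * ε)
      (2 * Real.pi * ε * v 0) 0 := by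
    have h := ((((hasDerivAt_id (0 : ℝ)).mul_const (v 0)).const_add (p 0)).add_const (1 / 2 : ℝ))
    refine ((h.const_mul (2 * Real.pi)).mul_const ε).congr_deriv ?_
    ring
  have hlin : ∀ i : Fin 3, HasDerivAt (fun t : ℝ => p i + t * v i) (v i) 0 := fun i => by
    simpa using ((hasDerivAt_id (0 : ℝ)).mul_const (v i)).const_add (p i)
  have h2 : ∀ i : Fin 3, HasDerivAt (fun t : ℝ => twist ε (p + t • v) i)
      (fderiv ℝ (twist ε) p v i) 0 := fun i =>
    (EuclideanSpace.proj (𝕜 := ℝ) i : E3 →L[ℝ] ℝ).hasFDerivAt.comp_hasDerivAt 0 h1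
  have d0 : HasDerivAt (fun t : ℝ => twist ε (p + t • v) 0) (v 0) 0 := hlin 0
  have d1 : HasDerivAt (fun t : ℝ => twist ε (p + t • v) 1) _ 0 :=
    (hα.cos.mul (hlin 1)).sub (hα.sin.mul (hlin 2))
  have d2 : HasDerivAt (fun t : ℝ => twist ε (p + t • v) 2) _ 0 :=
    (hα.sin.mul (hlin 1)).add (hα.cos.mul (hlin 2))
  have c0 := (h2 0).unique d0
  have c1 := (h2 1).unique d1
  have c2 := (h2 2).unique d2
  simp only [zero_mul, add_zero] at c1 c2
  ext i
  rw [rotate_apply, mat_axisRotation]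
  fin_cases i
  · simpa using c0
  · refine c1.trans ?_
    simp
    ring
  · refine c2.trans ?_
    simp
    ring

/-- If the shear term X has |X| ≥ 2|y|, then x² (k x y)² ≤ X² ≤ 4 (y + X)². Otherwise |k x y| ≤ 2,
and the right side is at least 1 while the left side is at most 1. -/
theorem shear_ratio_le {k x y : ℝ} (hx : x ≠ 0) (hy : y ≠ 0) (hk : 0 < k) :
    x ^ 2 / ((y + k * x * (x ^ 2 + y ^ 2)) ^ 2 + x ^ 2) ≤ 4 / (k * x * y) ^ 2 := by
  rw [div_le_div_iff₀ (by positivity) (by positivity)]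
  set X := k * x * (x ^ 2 + y ^ 2) with hX
  rcases le_total (2 * |y|) |X| with h | h
  · have h1 : X ^ 2 ≤ 4 * (y + X) ^ 2 := by
      have h2 : |X| ≤ 2 * |y + X| := by
        have := abs_sub_abs_le_abs_sub X (-y)
        rw [abs_neg, sub_neg_eq_add, add_comm X] at this
        linarith
      have := pow_le_pow_left₀ (abs_nonneg X) h2 2
      rwa [mul_pow, sq_abs, sq_abs, show (2 : ℝ) ^ 2 = 4 by norm_num] at this
    have h3 : x ^ 2 * (k * x * y) ^ 2 ≤ X ^ 2 := by
      have : X ^ 2 - x ^ 2 * (k * x * y) ^ 2 = (k * x) ^ 2 * (x ^ 4 + x ^ 2 * y ^ 2 + y ^ 4) := by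
        rw [hX]; ring
      have h4 : 0 ≤ (k * x) ^ 2 * (x ^ 4 + x ^ 2 * y ^ 2 + y ^ 4) := by positivity
      linarith
    nlinarith [sq_nonneg x]
  · have h1 : |k * x * y| ≤ 2 := by
      have h2 : |k * x * y| * |y| ≤ 2 * |y| := by
        refine le_trans ?_ h
        rw [hX, abs_mul (k * x) y, abs_mul (k * x) (x ^ 2 + y ^ 2), mul_assoc]
        refine mul_le_mul_of_nonneg_left ?_ (abs_nonneg _)
        rw [abs_of_nonneg (by positivity : 0 ≤ x ^ 2 + y ^ 2), abs_mul_abs_self]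
        nlinarith [sq_nonneg x]
      exact le_of_mul_le_mul_right h2 (abs_pos.2 hy)
    have h3 : (k * x * y) ^ 2 ≤ 4 := by
      rw [← sq_abs]
      nlinarith [abs_nonneg (k * x * y)]
    nlinarith [sq_nonneg x, sq_nonneg (y + X)]

/-- The cosine of the angle between the image of a frame vector under the twist map and the
horizontal direction. -/
def twistCos (ε : ℝ) (g : SO3) : ℝ :=
  inner ℝ (twistT1 ε (frameVector g)).1.2 (horizontal (twistT1 ε (frameVector g)).1.1)

/-- The left side is the squared sine of the angle to the horizontal. With x = g₀₁ and y = g₀₂ it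
equals the ratio in `shear_ratio_le` for k = π ε. -/
theorem one_sub_twistCos_sq_le {ε : ℝ} (hε : 0 < ε) (g : SO3) (hx : mat g 0 1 ≠ 0)
    (hy : mat g 0 2 ≠ 0) :
    1 - twistCos ε g ^ 2 ≤ 4 / (Real.pi * ε * mat g 0 1 * mat g 0 2) ^ 2 := by
  have hk : 0 < Real.pi * ε := mul_pos Real.pi_pos hε
  refine le_trans (le_of_eq ?_) (shear_ratio_le hx hy hk)
  set p := (frameVector g).1.1 with hp
  set v := (frameVector g).1.2 with hv
  have hp_i : ∀ i, p i = mat g i 0 / 2 := frameVector_fst_apply g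
  have hv_i : ∀ i, v i = mat g i 1 := frameVector_snd_apply g
  have hcol := (col_two g).1
  have hrow := row_inner g 0 0
  have hc0 := col_inner g 0 0
  have hc1 := col_inner g 1 1
  simp only [if_true] at hrow hc0 hc1
  set x := mat g 0 1
  set y := mat g 0 2
  set α := 2 * Real.pi * (p 0 + 1 / 2) * ε with hα
  set b := 2 * Real.pi * ε * v 0 with hb
  set T := fderiv ℝ (twist ε) p v with hT
  have hTv : T = rotate (axisRotation α) (v + b • !₂[0, -p 2, p 1]) := fderiv_twist_apply ε p v
  have hF : twist ε p = rotate (axisRotation α) p := twist_eq_rotate ε p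
  have hsc := Real.sin_sq_add_cos_sq α
  -- The squared radius of the circle of latitude through `p`.
  have hρ : p 1 ^ 2 + p 2 ^ 2 = (x ^ 2 + y ^ 2) / 4 := by
    rw [hp_i, hp_i]
    linear_combination (1 / 4 : ℝ) * (hc0 - hrow)
  have hρ0 : 0 < p 1 ^ 2 + p 2 ^ 2 := by rw [hρ]; positivity
  have hj : p 1 * v 2 - p 2 * v 1 = y / 2 := by
    rw [hp_i, hp_i, hv_i, hv_i]
    linear_combination -(1 / 2 : ℝ) * hcol
  have hvn : v 0 ^ 2 + v 1 ^ 2 + v 2 ^ 2 = 1 := by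
    rw [hv_i, hv_i, hv_i]
    linear_combination hc1
  have hnT : ‖T‖ ^ 2 = 1 + b * y + b ^ 2 * (p 1 ^ 2 + p 2 ^ 2) := by
    rw [hTv, norm_rotate, norm_sq_E3]
    simp
    linear_combination hvn + 2 * b * hj
  have hF12 : (twist ε p) 1 ^ 2 + (twist ε p) 2 ^ 2 = p 1 ^ 2 + p 2 ^ 2 := by
    rw [hF, rotate_apply, rotate_apply, mat_axisRotation]
    simp
    linear_combination (p 1 ^ 2 + p 2 ^ 2) * hsc
  have hne : ¬((twist ε p) 1 = 0 ∧ (twist ε p) 2 = 0) := by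
    rintro ⟨h1, h2⟩
    rw [h1, h2] at hF12
    linarith
  have hcos : twistCos ε g = ‖T‖⁻¹ * ((√(p 1 ^ 2 + p 2 ^ 2))⁻¹ *
      (y / 2 + b * (p 1 ^ 2 + p 2 ^ 2))) := by
    change inner ℝ (‖T‖⁻¹ • T) (horizontal (twist ε p)) = _
    rw [horizontal, if_neg hne, hF12, inner_smul_left, inner_smul_right]
    congr 2
    rw [hF, hTv, inner_E3]
    simp only [rotate_apply, mat_axisRotation]
    simp
    linear_combination hj + (p 1 * v 2 - p 2 * v 1 + b * (p 1 ^ 2 + p 2 ^ 2)) * hsc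
  have hbx : b * (p 1 ^ 2 + p 2 ^ 2) = Real.pi * ε * x * (x ^ 2 + y ^ 2) / 2 := by
    rw [hρ, hb, hv_i]
    ring
  have hTpos : 0 < ‖T‖ ^ 2 * (p 1 ^ 2 + p 2 ^ 2) := by
    have : ‖T‖ ^ 2 * (p 1 ^ 2 + p 2 ^ 2) =
        (y / 2 + b * (p 1 ^ 2 + p 2 ^ 2)) ^ 2 + x ^ 2 / 4 := by
      rw [hnT]
      linear_combination hρ
    rw [this]
    positivity
  have hprod : ‖T‖ ^ 2 * (p 1 ^ 2 + p 2 ^ 2) =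
      ((y + Real.pi * ε * x * (x ^ 2 + y ^ 2)) ^ 2 + x ^ 2) / 4 := by
    have h1 : Real.pi * ε * x * (x ^ 2 + y ^ 2) = 2 * (b * (p 1 ^ 2 + p 2 ^ 2)) := by
      rw [hbx]; ring
    rw [h1, hnT]
    linear_combination hρ
  have hden : (y + Real.pi * ε * x * (x ^ 2 + y ^ 2)) ^ 2 + x ^ 2 ≠ 0 := by positivity
  rw [hcos, mul_pow, mul_pow, inv_pow, inv_pow, Real.sq_sqrt hρ0.le, hbx, ← mul_assoc, ← mul_inv,
    hprod]
  field_simp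
  ring

/-- A unit tangent vector at the same point in horizontal direction closest to the given one. -/
def nearestHorizontal (x : T1S2) : T1S2 :=
  ⟨(x.1.1, (if 0 ≤ inner ℝ x.1.2 (horizontal x.1.1) then (1 : ℝ) else -1) • horizontal x.1.1),
    x.2.1, by split_ifs <;> simp [norm_horizontal],
    by rw [inner_smul_right, inner_horizontal, mul_zero]⟩

theorem mk_nearestHorizontal (x : T1S2) {p : S2} (hp : (p : E3) = x.1.1) :
    PS2.mk (nearestHorizontal x) = PS2.mk (horizontalVector p) := by
  refine Quotient.sound ⟨hp.symm, ?_⟩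
  simp only [nearestHorizontal, horizontalVector, hp]
  split_ifs
  · exact Or.inl (one_smul _ _)
  · exact Or.inr (neg_one_smul _ _)

/-- With c the inner product, the squared distance is 2 - 2|c|, and c² ≤ |c| since |c| ≤ 1. -/
theorem norm_sub_nearestHorizontal_sq_le (x : T1S2) :
    ‖x.1.2 - (nearestHorizontal x).1.2‖ ^ 2 ≤
      2 * (1 - inner ℝ x.1.2 (horizontal x.1.1) ^ 2) := by
  have h := norm_sub_sq_real x.1.2 (nearestHorizontal x).1.2
  have hc := abs_real_inner_le_norm x.1.2 (horizontal x.1.1)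
  rw [x.2.2.1, norm_horizontal, mul_one] at hc
  rw [h, x.2.2.1, (nearestHorizontal x).2.2.1]
  simp only [nearestHorizontal, inner_smul_right]
  set c : ℝ := inner ℝ x.1.2 (horizontal x.1.1)
  have hc' := abs_le.1 hc
  split_ifs with h0
  · nlinarith
  · nlinarith

theorem abs_apply_le_norm (x : E3) (i : Fin 3) : |x i| ≤ ‖x‖ := by
  simpa using PiLp.norm_apply_le x i

/-- The first columns agree; each entry of the second contributes at most the norm of the
difference, and each entry of the cross product at most twice it: 3 + 6 = 9. -/
theorem frameGap_frame_le {x y : T1S2} (h : x.1.1 = y.1.1) :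
    frameGap (frame x) (frame y) ≤ 9 * ‖x.1.2 - y.1.2‖ := by
  set d := x.1.2 - y.1.2 with hd
  have hdi : ∀ i, |x.1.2 i - y.1.2 i| ≤ ‖d‖ := fun i => abs_apply_le_norm d i
  have hp : ∀ i, |x.1.1 i| ≤ 1 / 2 := fun i =>
    (abs_apply_le_norm x.1.1 i).trans x.2.1.le
  have key : ∀ i j : Fin 3, |2 * (x.1.1 i * x.1.2 j - x.1.1 j * x.1.2 i) -
      2 * (x.1.1 i * y.1.2 j - x.1.1 j * y.1.2 i)| ≤ 2 * ‖d‖ := by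
    intro i j
    have e : 2 * (x.1.1 i * x.1.2 j - x.1.1 j * x.1.2 i) -
        2 * (x.1.1 i * y.1.2 j - x.1.1 j * y.1.2 i) =
        2 * (x.1.1 i * (x.1.2 j - y.1.2 j) - x.1.1 j * (x.1.2 i - y.1.2 i)) := by ring
    rw [e, abs_mul, abs_two]
    have h1 := abs_sub (x.1.1 i * (x.1.2 j - y.1.2 j)) (x.1.1 j * (x.1.2 i - y.1.2 i))
    rw [abs_mul, abs_mul] at h1
    have h2 := mul_le_mul (hp i) (hdi j) (abs_nonneg _) (by norm_num)
    have h3 := mul_le_mul (hp j) (hdi i) (abs_nonneg _) (by norm_num)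
    linarith
  have k0 := key 1 2
  have k1 := key 2 0
  have k2 := key 0 1
  have d0 := hdi 0
  have d1 := hdi 1
  have d2 := hdi 2
  simp only [frameGap, Fin.sum_univ_three, mat_frame, frameMat, h] at *
  simp
  linarith

/-- The distance of the image of a frame to the horizontal frames. -/
theorem ofReal_sqrt_frameGap_le {ε : ℝ} (hε : 0 < ε) (g : SO3) :
    ENNReal.ofReal √(frameGap (twistFrame ε g)
      (frame (nearestHorizontal (twistT1 ε (frameVector g))))) ≤
      ENNReal.ofReal (3 * ε ^ (-(1 / 2) : ℝ)) * weight (firstRow g) := by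
  rw [weight, firstRow_apply, firstRow_apply]
  have hε' : 0 < ε ^ (-(1 / 2) : ℝ) := Real.rpow_pos_of_pos hε _
  rcases eq_or_ne (mat g 0 1 * mat g 0 2) 0 with hw | hw
  · rw [hw, abs_zero, ENNReal.ofReal_zero, ENNReal.zero_rpow_of_neg (by norm_num), ENNReal.mul_top]
    · exact le_top
    · exact (ENNReal.ofReal_pos.2 (by positivity)).ne'
  have hx : mat g 0 1 ≠ 0 := left_ne_zero_of_mul hw
  have hy : mat g 0 2 ≠ 0 := right_ne_zero_of_mul hw
  have hwpos := abs_pos.2 hw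
  set X := twistT1 ε (frameVector g)
  have h1 := norm_sub_nearestHorizontal_sq_le X
  have h2 : 1 - inner ℝ X.1.2 (horizontal X.1.1) ^ 2 ≤ _ := one_sub_twistCos_sq_le hε g hx hy
  have h3 : frameGap (frame X) (frame (nearestHorizontal X)) ≤
      9 * ‖X.1.2 - (nearestHorizontal X).1.2‖ := frameGap_frame_le rfl
  set w := |mat g 0 1 * mat g 0 2| with hwdef
  -- The constants combine to 2 · 4 / π² ≤ 1.
  have h4 : ‖X.1.2 - (nearestHorizontal X).1.2‖ ≤ 1 / (ε * w) := by
    refine abs_le_of_sq_le_sq' (h1.trans ?_) (by positivity) |>.2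
    refine (mul_le_mul_of_nonneg_left h2 zero_le_two).trans ?_
    have e : (Real.pi * ε * mat g 0 1 * mat g 0 2) ^ 2 = Real.pi ^ 2 * (ε * w) ^ 2 := by
      rw [hwdef, mul_pow ε, sq_abs]
      ring
    rw [e, ← mul_div_assoc, div_pow, one_pow, div_le_div_iff₀ (by positivity) (by positivity)]
    have h5 : 8 ≤ Real.pi ^ 2 := by nlinarith [Real.pi_gt_three]
    nlinarith [sq_nonneg (ε * w)]
  have h5 : √(frameGap (frame X) (frame (nearestHorizontal X))) ≤
      3 * ε ^ (-(1 / 2) : ℝ) * w ^ (-(1 / 2) : ℝ) := by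
    rw [Real.sqrt_le_left (by positivity)]
    have e1 : (3 * ε ^ (-(1 / 2) : ℝ) * w ^ (-(1 / 2) : ℝ)) ^ 2 = 9 * (1 / (ε * w)) := by
      rw [mul_pow, mul_pow, ← Real.rpow_natCast, ← Real.rpow_natCast, ← Real.rpow_natCast,
        ← Real.rpow_mul hε.le, ← Real.rpow_mul hwpos.le]
      norm_num
      rw [Real.rpow_neg_one, Real.rpow_neg_one]
      ring
    rw [e1]
    linarith
  rw [ENNReal.ofReal_rpow_of_pos hwpos, ← ENNReal.ofReal_mul (by positivity)]
  exact ENNReal.ofReal_le_ofReal h5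

/-! ### Comparison with Liouville measure -/

/-- The field of horizontal lines on the sphere. -/
def horizontalLine (p : S2) : PS2 := PS2.mk (horizontalVector p)

theorem measurable_horizontalLine : Measurable horizontalLine :=
  continuous_mk.measurable.comp measurable_horizontalVector

/-- The replacement line depends on the frame only through its base point, whose law under the limit
measure is known. -/
theorem frameLine_nearestHorizontal (ε : ℝ) (a : SO3) :
    frameLine (frame (nearestHorizontal (twistT1 ε (frameVector a)))) =
      horizontalLine (twistS2 ε (framePoint a)) := by
  rw [frameLine, frameVector_frame]
  refine mk_nearestHorizontal _ ?_
  rw [← framePoint_twistFrame, twistFrame, framePoint_frame]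

theorem exists_noise_sub_bound : ∃ C : ℝ, 0 < C ∧ ∀ δ : ℝ, 0 < δ → ∀ g x y : SO3,
    ∀ A : Set SO3, MeasurableSet A → noise δ {u | u * (g * x) ∈ A} ≤
      noise δ {u | u * (g * y) ∈ A} +
        ENNReal.ofReal ((haarSO3.real (rotationBall δ))⁻¹ * C) *
          ENNReal.ofReal √(frameGap x y) := by
  obtain ⟨C, hC, hball⟩ := exists_ballDiff_bound
  refine ⟨C, hC, fun δ hδ g x y A hA => ?_⟩
  have := isProbabilityMeasure_noise hδ
  have hreal : ∀ z : SO3, ∫ u, A.indicator (1 : SO3 → ℝ) (u * z) ∂noise δ =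
      (noise δ).real {u | u * z ∈ A} := by
    intro z
    have hz : MeasurableSet {u | u * z ∈ A} := (measurable_mul_const z) hA
    rw [← integral_indicator_one hz]
    rfl
  have h := abs_integral_noise_sub_le δ (F := A.indicator (1 : SO3 → ℝ))
    (measurable_one.indicator hA) (M := 1)
    (fun b => by by_cases hb : b ∈ A <;> simp [hb]) (g * x) (g * y)
  rw [hreal, hreal, one_mul] at h
  have h1 := mul_le_mul_of_nonneg_left (hball δ hδ g x y)
    (inv_nonneg.2 (measureReal_nonneg (μ := haarSO3) (s := rotationBall δ)))
  have h2 : (noise δ).real {u | u * (g * x) ∈ A} ≤ (noise δ).real {u | u * (g * y) ∈ A} +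
      (haarSO3.real (rotationBall δ))⁻¹ * C * √(frameGap x y) := by
    linarith [le_abs_self ((noise δ).real {u | u * (g * x) ∈ A} -
      (noise δ).real {u | u * (g * y) ∈ A})]
  rw [← ENNReal.ofReal_mul (by positivity), ← ofReal_measureReal, ← ofReal_measureReal,
    ← ENNReal.ofReal_add measureReal_nonneg (by positivity)]
  exact ENNReal.ofReal_le_ofReal h2

theorem measurable_noise_horizontalLine (δ : ℝ) (g : SO3) {B : Set PS2} (hB : MeasurableSet B) :
    Measurable fun p => noise δ {u | rotateSharp (u * g) (horizontalLine p) ∈ B} := by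
  have hm : Measurable fun a : SO3 × S2 => rotateSharp (a.1 * g) (horizontalLine a.2) :=
    continuous_rotateSharp.measurable.comp
      ((measurable_fst.mul_const g).prodMk (measurable_horizontalLine.comp measurable_snd))
  have : SFinite (noise δ) := by unfold noise; infer_instance
  exact measurable_measure_prodMk_right (hm hB)

/-- For fixed `u` and `p`, the line u g ℓ with ℓ horizontal at `p` and `g` uniform is already
Liouville distributed; Fubini does the rest. -/
theorem lintegral_noise_horizontalLine {δ : ℝ} (hδ : 0 < δ) {B : Set PS2}
    (hB : MeasurableSet B) :
    ∫⁻ g, ∫⁻ p, noise δ {u | rotateSharp (u * g) (horizontalLine p) ∈ B} ∂area ∂haarSO3 =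
      liouville B := by
  have := isProbabilityMeasure_noise hδ
  have hm : Measurable fun a : (SO3 × S2) × SO3 =>
      rotateSharp (a.2 * a.1.1) (horizontalLine a.1.2) := by
    refine continuous_rotateSharp.measurable.comp (Measurable.prodMk ?_
      (measurable_horizontalLine.comp (measurable_snd.comp measurable_fst)))
    exact continuous_mul.measurable.comp
      (measurable_snd.prodMk (measurable_fst.comp measurable_fst))
  have h : ∀ (u : SO3) (p : S2), haarSO3 {g | rotateSharp (u * g) (horizontalLine p) ∈ B} =
      liouville B := by
    intro u p
    obtain ⟨c, hc⟩ := surjective_frameLine (horizontalLine p)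
    rw [liouville_eq_map_frameLine, Measure.map_apply continuous_frameLine.measurable hB,
      ← measure_preimage_mul_right haarSO3 c (frameLine ⁻¹' B),
      ← measure_preimage_mul haarSO3 u (_ ⁻¹' (frameLine ⁻¹' B))]
    congr 1
    ext a
    simp [← hc, frameLine_mul]
  have hset := hm hB
  have h1 : Measurable fun b : SO3 × S2 =>
      noise δ {u | rotateSharp (u * b.1) (horizontalLine b.2) ∈ B} :=
    measurable_measure_prodMk_left hset
  rw [lintegral_lintegral_swap h1.aemeasurable]
  have h2 : ∀ p : S2,
      ∫⁻ g, noise δ {u | rotateSharp (u * g) (horizontalLine p) ∈ B} ∂haarSO3 =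
        liouville B := by
    intro p
    have hs : MeasurableSet {a : SO3 × SO3 | rotateSharp (a.2 * a.1) (horizontalLine p) ∈ B} := by
      have hmp : Measurable fun a : SO3 × SO3 => ((a.1, p), a.2) := by fun_prop
      exact hmp hset
    have e1 := Measure.prod_apply (μ := haarSO3) (ν := noise δ) hs
    have e2 := Measure.prod_apply_symm (μ := haarSO3) (ν := noise δ) hs
    rw [e1] at e2
    refine e2.trans ?_
    refine (lintegral_congr fun u => h u p).trans ?_
    simp
  simp [h2]

theorem lintegral_frameLimit_comp (ε : ℝ) {δ : ℝ} (hδ : 0 < δ) (g : SO3) {F : S2 → ℝ≥0∞}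
    (hF : Measurable F) :
    ∫⁻ a, F (twistS2 ε (framePoint a)) ∂frameLimit ε hδ g = ∫⁻ p, F p ∂area := by
  have ht := (continuous_twistS2 ε).measurable
  conv_rhs => rw [← map_twistS2_area ε, lintegral_map hF ht, ← map_framePoint_frameLimit ε hδ g]
  exact (lintegral_map (hF.comp ht) continuous_framePoint.measurable).symm

theorem exists_averagedMeasure_le : ∃ C : ℝ, 0 < C ∧ ∀ ε δ : ℝ, 0 < ε → 0 < δ → δ ≤ Real.pi →
    ∀ B : Set PS2, MeasurableSet B → averagedMeasure ε δ B ≤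
      liouville B + ENNReal.ofReal (C * (δ ^ 6)⁻¹ * ε ^ (-(1 / 2) : ℝ)) := by
  obtain ⟨C, hC, hnoise⟩ := exists_noise_sub_bound
  obtain ⟨c, hc, hball⟩ := exists_rotationBall_lower_bound
  set K : ℝ≥0∞ := ∫⁻ a, weight (firstRow a) ∂haarSO3 with hK
  have hKtop : K ≠ ∞ := lintegral_weight_firstRow_lt_top.ne
  refine ⟨c⁻¹ * C * 3 * c⁻¹ * (K.toReal + 1), by positivity, fun ε δ hε hδ hδπ B hB => ?_⟩
  have hε' : 0 < ε ^ (-(1 / 2) : ℝ) := Real.rpow_pos_of_pos hε _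
  have hU := hball δ hδ hδπ
  set U := haarSO3.real (rotationBall δ) with hUdef
  have hq := continuous_frameLine.measurable
  set D : ℝ≥0∞ := ENNReal.ofReal (U⁻¹ * C) * ENNReal.ofReal (3 * ε ^ (-(1 / 2) : ℝ)) with hD
  have hw : Measurable fun a => weight (firstRow a) := measurable_weight.comp measurable_firstRow
  have hbound : ∀ g : SO3, frameLimit ε hδ g (frameLine ⁻¹' B) ≤
      ∫⁻ p, noise δ {u | rotateSharp (u * g) (horizontalLine p) ∈ B} ∂area +
        D * ((haarSO3 (rotationBall δ))⁻¹ * K) := by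
    intro g
    -- Stationarity supplies one more twist and one more step of noise, which are then estimated.
    rw [← stepFrame_frameLimit, stepFrame_apply _ _ _ _ (hq hB)]
    calc _ ≤ ∫⁻ a, (noise δ {u | rotateSharp (u * g) (horizontalLine
              (twistS2 ε (framePoint a))) ∈ B} + D * weight (firstRow a)) ∂frameLimit ε hδ g := by
          refine lintegral_mono fun a => ?_
          refine (hnoise δ hδ g (twistFrame ε a)
            (frame (nearestHorizontal (twistT1 ε (frameVector a)))) _ (hq hB)).trans ?_
          refine add_le_add (le_of_eq ?_) ?_
          · congr 1
            ext u
            simp only [Set.mem_preimage, Set.mem_ofPred_eq, ← mul_assoc, frameLine_mul,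
              frameLine_nearestHorizontal]
          · rw [hD, mul_assoc]
            gcongr
            exact ofReal_sqrt_frameGap_le hε a
      _ = ∫⁻ p, noise δ {u | rotateSharp (u * g) (horizontalLine p) ∈ B} ∂area +
            D * ∫⁻ a, weight (firstRow a) ∂frameLimit ε hδ g := by
          rw [lintegral_add_right _ (hw.const_mul D), lintegral_const_mul _ hw,
            lintegral_frameLimit_comp ε hδ g (measurable_noise_horizontalLine δ g hB)]
      _ ≤ _ := by
          gcongr
          -- The density bound costs a second factor 1/|U| beside the one in `D`; together they give
          -- δ⁻⁶.
          refine (lintegral_mono' (frameLimit_le ε hδ g) le_rfl).trans ?_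
          rw [lintegral_smul_measure, smul_eq_mul]
  rw [averagedMeasure_apply ε hδ hB]
  refine (lintegral_mono hbound).trans ?_
  rw [lintegral_add_right _ measurable_const, lintegral_noise_horizontalLine hδ hB]
  simp only [lintegral_const, measure_univ, mul_one]
  gcongr
  have hδ3 : 0 < c * δ ^ 3 := by positivity
  have hU0 : 0 < U := hδ3.trans_le hU
  have hUe : haarSO3 (rotationBall δ) = ENNReal.ofReal U := by rw [hUdef, ofReal_measureReal]
  rw [hD, hUe, ← ENNReal.ofReal_inv_of_pos hU0, ← ENNReal.ofReal_toReal hKtop,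
    ← ENNReal.ofReal_mul (by positivity), ← ENNReal.ofReal_mul (by positivity),
    ← ENNReal.ofReal_mul (by positivity)]
  refine ENNReal.ofReal_le_ofReal ?_
  have hinv : U⁻¹ ≤ (c * δ ^ 3)⁻¹ := inv_anti₀ hδ3 hU
  have hK0 : 0 ≤ K.toReal := ENNReal.toReal_nonneg
  calc U⁻¹ * C * (3 * ε ^ (-(1 / 2) : ℝ)) * (U⁻¹ * K.toReal)
      ≤ (c * δ ^ 3)⁻¹ * C * (3 * ε ^ (-(1 / 2) : ℝ)) * ((c * δ ^ 3)⁻¹ * (K.toReal + 1)) := by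
        gcongr
        linarith
    _ = _ := by
        rw [ENNReal.toReal_ofReal hK0]
        field_simp

/-- Beyond π the ball is the whole group and the density bound is 1, so there is no error. -/
theorem averagedMeasure_le_of_pi_lt (ε : ℝ) {δ : ℝ} (hδ : Real.pi < δ) {B : Set PS2}
    (hB : MeasurableSet B) : averagedMeasure ε δ B ≤ liouville B := by
  have hδ0 := Real.pi_pos.trans hδ
  rw [averagedMeasure_apply ε hδ0 hB, liouville_eq_map_frameLine,
    Measure.map_apply continuous_frameLine.measurable hB]
  refine (lintegral_mono fun g => frameLimit_le ε hδ0 g _).trans ?_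
  simp [rotationBall_eq_univ hδ]

/-! ### Densities -/

/-- Since f - 1 has mean zero, its L¹ norm is twice its integral over {f ≥ 1}. An upper bound on
sets suffices. -/
theorem integral_abs_rnDeriv_sub_one_le {X : Type*} [MeasurableSpace X] {P m : Measure X}
    [IsProbabilityMeasure P] [IsProbabilityMeasure m] (hP : P ≪ m) {E : ℝ} (hE : 0 ≤ E)
    (h : ∀ B, MeasurableSet B → P B ≤ m B + ENNReal.ofReal E) :
    ∫ x, |(P.rnDeriv m x).toReal - 1| ∂m ≤ 2 * E := by
  set f : X → ℝ := fun x => (P.rnDeriv m x).toReal with hf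
  have hfi : Integrable f m := Measure.integrable_toReal_rnDeriv
  have hfm : Measurable f := (Measure.measurable_rnDeriv P m).ennreal_toReal
  have hgi : Integrable (fun x => f x - 1) m := hfi.sub (integrable_const 1)
  set B : Set X := {x | 1 ≤ f x} with hBdef
  have hB : MeasurableSet B := measurableSet_le measurable_const hfm
  have habs : ∀ x, |f x - 1| = 2 * B.indicator (fun x => f x - 1) x - (f x - 1) := by
    intro x
    by_cases hx : x ∈ B
    · rw [Set.indicator_of_mem hx, abs_of_nonneg (sub_nonneg.2 hx)]
      ring
    · rw [Set.indicator_of_notMem hx, abs_of_neg (sub_neg.2 (not_le.1 hx))]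
      ring
  have htot : ∫ x, (f x - 1) ∂m = 0 := by
    rw [integral_sub hfi (integrable_const 1), hf, Measure.integral_toReal_rnDeriv hP]
    simp
  have hpos : ∫ x in B, (f x - 1) ∂m ≤ E := by
    rw [integral_sub hfi.integrableOn (integrable_const 1), hf,
      Measure.setIntegral_toReal_rnDeriv hP]
    have h1 : P.real B ≤ m.real B + E := by
      have := ENNReal.toReal_mono (by finiteness) (h B hB)
      rwa [ENNReal.toReal_add (by finiteness) (by finiteness), ENNReal.toReal_ofReal hE] at this
    simp
    linarith
  change ∫ x, |f x - 1| ∂m ≤ 2 * E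
  simp only [habs]
  rw [integral_sub ((hgi.indicator hB).const_mul 2) hgi, integral_const_mul,
    integral_indicator hB, htot]
  linarith

theorem exists_density_bound : ∃ C : ℝ, 0 < C ∧ ∀ ε δ : ℝ, 0 < ε → 0 < δ →
    ∫ x, |density ε δ x - 1| ∂liouville < C * δ ^ (-11 : ℤ) * ε ^ (-(1 / 2) : ℝ) := by
  obtain ⟨C, hC, h⟩ := exists_averagedMeasure_le
  -- The factor π⁵ trades δ⁻⁶ for δ⁻¹¹ when δ ≤ π, and the added 1 makes the inequality strict.
  refine ⟨2 * C * Real.pi ^ 5 + 1, by positivity, fun ε δ hε hδ => ?_⟩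
  have hε' : 0 < ε ^ (-(1 / 2) : ℝ) := Real.rpow_pos_of_pos hε _
  have := isProbabilityMeasure_averagedMeasure ε hδ
  have hac := averagedMeasure_absolutelyContinuous ε hδ
  have hz : δ ^ (-11 : ℤ) = (δ ^ 11)⁻¹ := by
    rw [zpow_neg]
    norm_cast
  rw [hz]
  rcases le_or_gt δ Real.pi with hδπ | hδπ
  · refine (integral_abs_rnDeriv_sub_one_le hac (by positivity) (h ε δ hε hδ hδπ)).trans_lt ?_
    have h1 : (δ ^ 6)⁻¹ ≤ Real.pi ^ 5 * (δ ^ 11)⁻¹ := by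
      rw [← div_eq_mul_inv, le_div_iff₀ (by positivity)]
      have : (δ ^ 6)⁻¹ * δ ^ 11 = δ ^ 5 := by field_simp
      rw [this]
      gcongr
    have h2 : 0 < (δ ^ 11)⁻¹ * ε ^ (-(1 / 2) : ℝ) := by positivity
    calc 2 * (C * (δ ^ 6)⁻¹ * ε ^ (-(1 / 2) : ℝ))
        ≤ 2 * (C * (Real.pi ^ 5 * (δ ^ 11)⁻¹) * ε ^ (-(1 / 2) : ℝ)) := by gcongr
      _ < _ := by nlinarith
  · refine (integral_abs_rnDeriv_sub_one_le hac le_rfl fun B hB => ?_).trans_lt ?_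
    · simpa using averagedMeasure_le_of_pi_lt ε hδπ hB
    · rw [mul_zero]
      positivity

theorem integrable_density (ε : ℝ) {δ : ℝ} (hδ : 0 < δ) : Integrable (density ε δ) liouville := by
  have := isProbabilityMeasure_averagedMeasure ε hδ
  exact Measure.integrable_toReal_rnDeriv

theorem eLpNorm_density_sub_one (ε : ℝ) {δ : ℝ} (hδ : 0 < δ) :
    eLpNorm (fun x => density ε δ x - 1) 1 liouville =
      ENNReal.ofReal (∫ x, |density ε δ x - 1| ∂liouville) := by
  rw [eLpNorm_one_eq_lintegral_enorm]
  exact (ofReal_integral_norm_eq_lintegral_enorm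
    ((integrable_density ε hδ).sub (integrable_const 1))).symm

theorem abs_integral_averagedMeasure_sub_le (ε : ℝ) {δ : ℝ} (hδ : 0 < δ) (F : PS2 →ᵇ ℝ) :
    |∫ x, F x ∂averagedMeasure ε δ - ∫ x, F x ∂liouville| ≤
      ‖F‖ * ∫ x, |density ε δ x - 1| ∂liouville := by
  have := isProbabilityMeasure_averagedMeasure ε hδ
  have hd := integrable_density ε hδ
  have hFm : AEStronglyMeasurable F liouville := F.continuous.aestronglyMeasurable
  have hFi : Integrable F liouville := F.integrable liouville
  have hdF : Integrable (fun x => density ε δ x * F x) liouville :=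
    hd.mul_bdd (c := ‖F‖) hFm (ae_of_all _ F.norm_coe_le_norm)
  have h : ∫ x, F x ∂averagedMeasure ε δ = ∫ x, density ε δ x * F x ∂liouville := by
    rw [← integral_rnDeriv_smul (averagedMeasure_absolutelyContinuous ε hδ)]
    rfl
  rw [h, ← integral_sub hdF hFi, ← integral_const_mul, ← Real.norm_eq_abs]
  refine norm_integral_le_of_norm_le ((hd.sub (integrable_const 1)).abs.const_mul _)
    (ae_of_all _ fun x => ?_)
  have : density ε δ x * F x - F x = F x * (density ε δ x - 1) := by ring
  rw [this, norm_mul]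
  exact mul_le_mul_of_nonneg_right (F.norm_coe_le_norm x) (norm_nonneg _)

theorem tendsto_integral_averagedMeasure {δ : ℝ} (hδ : 0 < δ) (F : PS2 →ᵇ ℝ) :
    Tendsto (fun ε => ∫ x, F x ∂averagedMeasure ε δ) atTop (𝓝 (∫ x, F x ∂liouville)) := by
  obtain ⟨C, hC, h⟩ := exists_density_bound
  rw [tendsto_iff_norm_sub_tendsto_zero]
  have hlim : Tendsto (fun ε : ℝ => ‖F‖ * (C * δ ^ (-11 : ℤ) * ε ^ (-(1 / 2) : ℝ))) atTop
      (𝓝 0) := by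
    have := ((tendsto_rpow_neg_atTop (y := 1 / 2) (by norm_num)).const_mul
      (C * δ ^ (-11 : ℤ))).const_mul ‖F‖
    simpa only [mul_zero] using this
  refine squeeze_zero' (Eventually.of_forall fun _ => norm_nonneg _) ?_ hlim
  filter_upwards [eventually_gt_atTop 0] with ε hε
  exact (abs_integral_averagedMeasure_sub_le ε hδ F).trans
    (mul_le_mul_of_nonneg_left (h ε δ hε hδ).le (norm_nonneg _))

end TwistSphere

end

theorem mainTheorem1 :
    (∃ C : ℝ, 0 < C ∧ ∀ ε δ : ℝ, 0 < ε → 0 < δ →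
      (∀ g : TwistSphere.SO3,
        TwistSphere.IsDiffusedStationary ε δ g (TwistSphere.diffusedMeasure ε δ g)) ∧
      IsProbabilityMeasure (TwistSphere.averagedMeasure ε δ) ∧
      TwistSphere.averagedMeasure ε δ ≪ TwistSphere.liouville ∧
      eLpNorm (fun x => TwistSphere.density ε δ x - 1) 1 TwistSphere.liouville <
        ENNReal.ofReal (C * δ ^ (-11 : ℤ) * ε ^ (-(1 / 2) : ℝ))) ∧
    ∀ δ : ℝ, 0 < δ → ∀ F : TwistSphere.PS2 →ᵇ ℝ,
      Tendsto (fun ε => ∫ x, F x ∂(TwistSphere.averagedMeasure ε δ)) atTop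
        (𝓝 (∫ x, F x ∂TwistSphere.liouville)) := by
  refine ⟨?_, fun δ hδ F => TwistSphere.tendsto_integral_averagedMeasure hδ F⟩
  obtain ⟨C, hC, h⟩ := TwistSphere.exists_density_bound
  refine ⟨C, hC, fun ε δ hε hδ => ⟨TwistSphere.isDiffusedStationary ε hδ,
    TwistSphere.isProbabilityMeasure_averagedMeasure ε hδ,
    TwistSphere.averagedMeasure_absolutelyContinuous ε hδ, ?_⟩⟩
  rw [TwistSphere.eLpNorm_density_sub_one ε hδ]
  have hε' : 0 < ε ^ (-(1 / 2) : ℝ) := Real.rpow_pos_of_pos hε _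
  exact (ENNReal.ofReal_lt_ofReal_iff (by positivity)).2 (h ε δ hε hδ)
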